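/- Let $k$ be any field, $R=k[x_0,\dots,x_N]$, and let $X\subset\mathbb P^N=\mathrm{Proj}(R)$ be a closed subscheme defined by a homogeneous ideal $I\subset R$ (for instance its saturated ideal $I_X$). Assume that $X$ is nondegenerate, meaning that $I$ contains no nonzero linear form, and let $\mathtt q\in X$ be a $k$-rational point (any closed point, if $k$ is algebraically closed). Choose linear coordinates in which $\mathtt q=(1:0:\cdots:0)$ and put $S=k[x_1,\dots,x_N]$. For $i\ge 0$ let $K_i(I)\subset S$ be the $i$-th partial elimination ideal of $I$ in these coordinates, that is, the ideal of all $\bar f\in S$ for which some element of $I$ has the form $x_0^i\bar f+(\text{terms of degree}<i\text{ in }x_0)$. Let $X_{\mathtt q}\subset\mathbb P^{N-1}=\mathrm{Proj}(S)$ be the closure of the image of $X\setminus\{\mathtt q\}$ under the projection from $\mathtt q$, with the scheme structure given by $K_0(I)=I\cap S$. For a polynomial ring $A$ over $k$ and a graded $A$-module $M$ put $\beta^A_{p,q}(M)=\dim_k\mathrm{Tor}^A_p(M,k)_{p+q}$, which is $0$ for $p<0$, and write $\beta_{p,q}(X)=\beta^R_{p,q}(R/I)$ and $\beta_{p,q}(X_{\mathtt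 q})=\beta^S_{p,q}(S/K_0(I))$. Let $t=\dim_k K_1(I)_1$ and let $e=\operatorname{codim}_{\mathtt q}(X,\mathbb P^N)$ be the local codimension of $X$ at $\mathtt q$ (the least codimension of an irreducible component of $X$ through $\mathtt q$). Let $a(X)\in\mathbb N\cup\{\infty\}$ be the supremum of all $a$ such that $\beta_{p,q}(X)=0$ for all $1\le p\le a$ and all $q\ge 2$. (a) For every $p\ge 1$, $$\beta_{p,1}(X)\le\beta_{p,1}(X_{\mathtt q})+\beta_{p-1,1}(X_{\mathtt q})+\binom tp\le\beta_{p,1}(X_{\mathtt q})+\beta_{p-1,1}(X_{\mathtt q})+\binom ep,$$ $$\beta_{p,1}(X)\ge\beta_{p,1}(X_{\mathtt q})+\beta_{p-1,1}(X_{\mathtt q})+\binom tp-\beta_{p-1,2}(X_{\mathtt q})-\beta^S_{p-2,2}(K_1(I)).$$ In particular, for $p=1$, $$\beta_{1,1}(X)=\beta_{1,1}(X_{\mathtt q})+t\le\beta_{1,1}(X_{\mathtt q})+e.$$ (b) Suppose in addition that $\mathtt q$ is a smooth point of $X$. Then for every integer $a$ with $1\le a\le a(X)$, $$\beta_{p,1}(X)=\beta_{p,1}(X_{\mathtt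 q})+\beta_{p-1,1}(X_{\mathtt q})+\binom ep\quad\text{for all }1\le p\le a,$$ $$\beta_{a+1,1}(X)=\beta_{a+1,1}(X_{\mathtt q})+\beta_{a,1}(X_{\mathtt q})-\beta_{a,2}(X_{\mathtt q})+\binom e{a+1}.$$ -/

import Mathlib

open MvPolynomial

noncomputable section

/-! ### Graded Betti numbers

`A = k[x_0, …, x_{n-1}]` is standard graded. The exterior algebra on basis elements `e_i` has the
basis `e_s`, for `s` a set of variables, so an element `∑ₛ e_s ⊗ f s` of the Koszul complex with
coefficients in an `A`-module `M` is a function `f : Finset (Fin n) → M`. -/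

/-- The Koszul differential `e_s ⊗ m ↦ ∑_{i ∈ s} (-1)^{#{j ∈ s, j < i}} e_{s \ i} ⊗ x_i m`. -/
def koszulD (k : Type*) [Field k] (n : ℕ) (M : Type*) [AddCommGroup M]
    [Module (MvPolynomial (Fin n) k) M] :
    (Finset (Fin n) → M) →ₗ[MvPolynomial (Fin n) k] (Finset (Fin n) → M) where
  toFun f s := ∑ i ∈ sᶜ, (-1 : ℤ) ^ (s.filter (· < i)).card •
    ((X i : MvPolynomial (Fin n) k) • f (insert i s))
  map_add' f g := by
    funext s
    simp [smul_add, Finset.sum_add_distrib]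
  map_smul' a f := by
    funext s
    simp only [Pi.smul_apply, RingHom.id_apply, Finset.smul_sum]
    refine Finset.sum_congr rfl fun i _ => ?_
    rw [smul_comm (X i) a, smul_comm a ((-1 : ℤ) ^ _)]

theorem koszulD_apply (k : Type*) [Field k] (n : ℕ) (M : Type*) [AddCommGroup M]
    [Module (MvPolynomial (Fin n) k) M] (f : Finset (Fin n) → M) (s : Finset (Fin n)) :
    koszulD k n M f s = ∑ i ∈ sᶜ, (-1 : ℤ) ^ (s.filter (· < i)).card •
      ((X i : MvPolynomial (Fin n) k) • f (insert i s)) := rfl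

/-- The Koszul complex is a complex. -/
theorem koszulD_comp (k : Type*) [Field k] (n : ℕ) (M : Type*) [AddCommGroup M]
    [Module (MvPolynomial (Fin n) k) M] (f : Finset (Fin n) → M) :
    koszulD k n M (koszulD k n M f) = 0 := by
  classical
  funext s
  rw [koszulD_apply, Pi.zero_apply]
  simp only [koszulD_apply, Finset.smul_sum]
  rw [Finset.sum_sigma']
  refine Finset.sum_involution (fun x _ => ⟨x.2, x.1⟩) ?_ ?_ ?_ ?_
  · rintro ⟨i, j⟩ hij
    simp only [Finset.mem_sigma, Finset.mem_compl, Finset.mem_insert, not_or] at hij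
    obtain ⟨hi, hji, hj⟩ := hij
    have key : ∀ a b : Fin n, a ∉ s → b ∉ s → a ≠ b →
        (((insert a s).filter (· < b)).card : ℕ) =
          (s.filter (· < b)).card + if a < b then 1 else 0 := by
      intro a b ha _ _
      rw [Finset.filter_insert]
      split_ifs
      · rw [Finset.card_insert_of_notMem (by simp [ha])]
      · rfl
    have hsw : insert i (insert j s) = insert j (insert i s) := Finset.insert_comm i j s
    simp only [key i j hi hj (Ne.symm hji), key j i hj hi hji, hsw]
    rw [smul_comm (X i : MvPolynomial (Fin n) k) ((-1 : ℤ) ^ _),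
      smul_comm (X j : MvPolynomial (Fin n) k) ((-1 : ℤ) ^ _),
      smul_comm (X i : MvPolynomial (Fin n) k) (X j), smul_smul, smul_smul, smul_smul, ← add_smul]
    rcases lt_or_gt_of_ne hji with h | h
    · simp only [h, h.not_gt, if_true, if_false]
      convert zero_smul ℤ _
      ring
    · simp only [h, h.not_gt, if_true, if_false]
      convert zero_smul ℤ _
      ring
  · rintro ⟨i, j⟩ hij _ heq
    simp only [Finset.mem_sigma, Finset.mem_compl, Finset.mem_insert, not_or] at hij
    simp only [Sigma.mk.injEq, heq_eq_eq] at heq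
    exact hij.2.1 heq.1
  · rintro ⟨i, j⟩ hij
    simp only [Finset.mem_sigma, Finset.mem_compl, Finset.mem_insert, not_or] at hij ⊢
    exact ⟨hij.2.2, fun h => hij.2.1 h.symm, hij.1⟩
  · rintro ⟨i, j⟩ _
    rfl

/-- The Koszul complex of the polynomial ring `A` resolves `k = A / (x_0, …, x_{n-1})`: a cycle is
a boundary as soon as its component in homological degree `0` has no constant term. Therefore
`Tor_p^A(M, k)` is the `p`-th homology of the Koszul complex with coefficients in `M`. -/
theorem koszul_resolves {k : Type*} [Field k] {n : ℕ}
    (f : Finset (Fin n) → MvPolynomial (Fin n) k)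
    (hf : koszulD k n _ f = 0) (h0 : coeff 0 (f ∅) = 0) :
    ∃ h, koszulD k n _ h = f := by
  classical
  -- coefficients of the differential
  have hd : ∀ (F : Finset (Fin n) → MvPolynomial (Fin n) k) (s : Finset (Fin n)) (c : Fin n →₀ ℕ),
      coeff c (koszulD k n _ F s) = ∑ i ∈ sᶜ, (-1 : k) ^ (s.filter (· < i)).card *
        (if c i ≠ 0 then coeff (c - Finsupp.single i 1) (F (insert i s)) else 0) := by
    intro F s c
    rw [koszulD_apply, coeff_sum]
    refine Finset.sum_congr rfl fun i _ => ?_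
    have h1 : ((-1 : ℤ) ^ (s.filter (· < i)).card •
        ((X i : MvPolynomial (Fin n) k) • F (insert i s))) =
        ((-1 : k) ^ (s.filter (· < i)).card) • (X i * F (insert i s)) := by
      rw [smul_eq_mul]
      rcases neg_one_pow_eq_or ℤ (s.filter (· < i)).card with h | h <;>
        rcases Nat.even_or_odd (s.filter (· < i)).card with h' | h' <;>
        simp [h'.neg_one_pow]
    rw [h1, coeff_smul, coeff_X_mul', smul_eq_mul]
    simp [Finsupp.mem_support_iff]
  -- the contracting homotopy: divide by the variable `x_m` of least index
  let P : Finset (Fin n) → Fin n → (Fin n →₀ ℕ) → Prop := fun t m b =>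
    (∀ j ∈ t, m ≤ j) ∧ ∀ j, b j ≠ 0 → m ≤ j
  let cut : MvPolynomial (Fin n) k → ((Fin n →₀ ℕ) → Prop) → MvPolynomial (Fin n) k :=
    fun p Q => ∑ b ∈ p.support.filter Q, monomial b (coeff b p)
  have hcut : ∀ p Q b, coeff b (cut p Q) = if Q b then coeff b p else 0 := by
    intro p Q b
    simp only [cut, coeff_sum, coeff_monomial, Finset.sum_ite_eq', Finset.mem_filter,
      mem_support_iff]
    by_cases hQ : Q b <;> by_cases hb : coeff b p = 0 <;> simp [hQ, hb]
  let hh : Finset (Fin n) → MvPolynomial (Fin n) k := fun t =>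
    ∑ m ∈ t, cut (divMonomial (f (t.erase m)) (Finsupp.single m 1)) (P t m)
  have hhc : ∀ t b, coeff b (hh t) = ∑ m ∈ t,
      if P t m b then coeff (Finsupp.single m 1 + b) (f (t.erase m)) else 0 := by
    intro t b
    simp only [hh, coeff_sum, hcut, coeff_divMonomial]
    exact Finset.sum_congr rfl fun _ _ => by congr
  refine ⟨hh, ?_⟩
  funext T
  ext c
  rw [hd]
  by_cases hW : (T ∪ c.support).Nonempty
  swap
  · rw [Finset.not_nonempty_iff_eq_empty, Finset.union_eq_empty] at hW
    obtain ⟨rfl, hc⟩ := hW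
    rw [Finsupp.support_eq_empty] at hc
    subst hc
    simp [h0]
  set m := (T ∪ c.support).min' hW with hm
  have hmin : ∀ j, j ∈ T ∨ c j ≠ 0 → m ≤ j := fun j hj =>
    Finset.min'_le _ _ (by simpa [Finsupp.mem_support_iff] using hj)
  have hmem : m ∈ T ∨ c m ≠ 0 := by
    simpa [Finsupp.mem_support_iff] using Finset.min'_mem _ hW
  have key : ∀ i, i ∉ T → c i ≠ 0 →
      coeff (c - Finsupp.single i 1) (hh (insert i T)) =
        if m ∈ insert i T then
          coeff (Finsupp.single m 1 + (c - Finsupp.single i 1)) (f ((insert i T).erase m))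
        else 0 := by
    intro i hiT hci
    rw [hhc]
    have hP : ∀ m' ∈ insert i T, P (insert i T) m' (c - Finsupp.single i 1) ↔ m' = m := by
      intro m' hm'
      constructor
      · rintro ⟨h1, h2⟩
        refine le_antisymm ?_ ?_
        · rcases hmem with h | h
          · exact h1 _ (Finset.mem_insert_of_mem h)
          · by_cases hmi : m = i
            · rw [hmi]; exact h1 _ (Finset.mem_insert_self _ _)
            · refine h2 m ?_
              simpa [Finsupp.single_apply, Ne.symm hmi] using h
        · rcases Finset.mem_insert.1 hm' with rfl | h
          · exact hmin _ (Or.inr hci)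
          · exact hmin _ (Or.inl h)
      · rintro rfl
        refine ⟨fun j hj => ?_, fun j hj => ?_⟩
        · rcases Finset.mem_insert.1 hj with rfl | h
          · exact hmin _ (Or.inr hci)
          · exact hmin _ (Or.inl h)
        · refine hmin _ (Or.inr fun h => hj ?_)
          simp [h]
    rw [Finset.sum_congr rfl fun m' hm' => if_congr (hP m' hm') rfl rfl]
    simp [Finset.sum_ite_eq']
  by_cases hmT : m ∈ T
  · -- use the cycle condition
    have hz := hd f (T.erase m) (c + Finsupp.single m 1)
    rw [hf, Pi.zero_apply, coeff_zero] at hz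
    have hcompl : (T.erase m)ᶜ = insert m Tᶜ := by
      ext j
      by_cases hj : j = m <;> simp [hj]
    rw [hcompl, Finset.sum_insert (by simpa using hmT)] at hz
    have hfil : ((T.erase m).filter (· < m)) = ∅ := by
      ext j
      simp only [Finset.mem_filter, Finset.mem_erase, Finset.notMem_empty, iff_false, not_and,
        not_lt]
      exact fun hj => hmin _ (Or.inl hj.2)
    rw [hfil, Finset.insert_erase hmT] at hz
    rw [Finset.card_empty, pow_zero, one_mul, add_tsub_cancel_right, if_pos (by simp)] at hz
    have : ∀ i ∈ Tᶜ, (-1 : k) ^ (T.filter (· < i)).card *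
        (if c i ≠ 0 then coeff (c - Finsupp.single i 1) (hh (insert i T)) else 0) =
        - ((-1 : k) ^ ((T.erase m).filter (· < i)).card *
        (if (c + Finsupp.single m 1 : Fin n →₀ ℕ) i ≠ 0 then
          coeff (c + Finsupp.single m 1 - Finsupp.single i 1) (f (insert i (T.erase m)))
          else 0)) := by
      intro i hi
      have hiT : i ∉ T := by simpa using hi
      have him : i ≠ m := fun h => hiT (h ▸ hmT)
      have hci' : (c + Finsupp.single m 1 : Fin n →₀ ℕ) i = c i := by
        simp [him.symm]
      rw [hci']
      by_cases hci : c i = 0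
      · simp [hci]
      · rw [if_pos hci, if_pos hci, key i hiT hci, if_pos (Finset.mem_insert_of_mem hmT)]
        have hlt : m < i := lt_of_le_of_ne (hmin _ (Or.inr hci)) him.symm
        have hcard : (T.filter (· < i)).card = ((T.erase m).filter (· < i)).card + 1 := by
          rw [Finset.filter_erase, Finset.card_erase_add_one]
          simp [hmT, hlt]
        have hset : (insert i T).erase m = insert i (T.erase m) :=
          Finset.erase_insert_of_ne him
        have hexp : Finsupp.single m 1 + (c - Finsupp.single i 1) =
            c + Finsupp.single m 1 - Finsupp.single i 1 := by
          ext j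
          have : 0 < c i := Nat.pos_of_ne_zero hci
          by_cases hji : j = i
          · subst hji
            simp [him.symm]
          · simp [Finsupp.single_apply, Ne.symm hji, add_comm]
        rw [hcard, hset, hexp, pow_succ]
        ring
    rw [Finset.sum_congr rfl this, Finset.sum_neg_distrib]
    linear_combination hz
  · have hcm : c m ≠ 0 := hmem.resolve_left hmT
    rw [Finset.sum_eq_single m]
    · rw [if_pos hcm, key m hmT hcm, if_pos (Finset.mem_insert_self _ _),
        Finset.erase_insert hmT]
      have hfil : (T.filter (· < m)) = ∅ := by
        ext j
        simp only [Finset.mem_filter, Finset.notMem_empty, iff_false, not_and, not_lt]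
        exact fun hj => hmin _ (Or.inl hj)
      have hexp : Finsupp.single m 1 + (c - Finsupp.single m 1) = c := by
        ext j
        have : 0 < c m := Nat.pos_of_ne_zero hcm
        by_cases hjm : j = m
        · subst hjm
          simp
          omega
        · simp [Ne.symm hjm]
      rw [hfil, hexp]
      simp
    · intro i hi him
      have hiT : i ∉ T := by simpa using hi
      by_cases hci : c i = 0
      · simp [hci]
      · rw [if_pos hci, key i hiT hci, if_neg, mul_zero]
        simp [him.symm, hmT]
    · intro h
      simp [hmT] at h

/-- The degree `m` part of `A = k[x_0, …, x_{n-1}]`, for any integer `m`. -/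
def homPart (k : Type*) [Field k] (n : ℕ) (m : ℤ) : Submodule k (MvPolynomial (Fin n) k) :=
  if 0 ≤ m then homogeneousSubmodule (Fin n) k m.toNat else ⊥

section Betti

variable {k : Type*} [Field k] (n : ℕ) {M : Type*} [AddCommGroup M] [Module k M]
  [Module (MvPolynomial (Fin n) k) M] [IsScalarTower k (MvPolynomial (Fin n) k) M]

/-- The part `⋀^p ⊗ M_q` (of internal degree `p + q`) of the Koszul complex, where `Mdeg q` is the
degree `q` part of `M`. -/
def koszulChain (Mdeg : ℤ → Submodule k M) (p q : ℤ) : Submodule k (Finset (Fin n) → M) :=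
  Submodule.pi Set.univ fun s => if (s.card : ℤ) = p then Mdeg q else ⊥

/-- Koszul cycles in `⋀^p ⊗ M_q`. -/
def koszulCycles (Mdeg : ℤ → Submodule k M) (p q : ℤ) : Submodule k (Finset (Fin n) → M) :=
  koszulChain n Mdeg p q ⊓ LinearMap.ker ((koszulD k n M).restrictScalars k)

/-- Koszul boundaries in `⋀^p ⊗ M_q`. -/
def koszulBoundaries (Mdeg : ℤ → Submodule k M) (p q : ℤ) : Submodule k (Finset (Fin n) → M) :=
  (koszulChain n Mdeg (p + 1) (q - 1)).map ((koszulD k n M).restrictScalars k)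

/-- `Tor_p^A(M, k)_{p+q}` for a graded `A`-module `M`, computed with the Koszul resolution of `k`;
it is `0` for `p < 0`. -/
abbrev GradedTor (Mdeg : ℤ → Submodule k M) (p q : ℤ) : Type _ :=
  koszulCycles n Mdeg p q ⧸ (koszulBoundaries n Mdeg p q).comap (koszulCycles n Mdeg p q).subtype

/-- The graded Betti number `β_{p,q}(M) = dim_k Tor_p^A(M, k)_{p+q}`. -/
def gradedBetti (Mdeg : ℤ → Submodule k M) (p q : ℤ) : ℕ :=
  Module.finrank k (GradedTor n Mdeg p q)

end Betti

section Ideals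

variable {k : Type*} [Field k] {n : ℕ}

/-- `β_{p,q}^A(A / I)`, the graded Betti numbers of the projective scheme with ideal `I`. -/
def bettiQuot (I : Ideal (MvPolynomial (Fin n) k)) (p q : ℤ) : ℕ :=
  gradedBetti n (M := MvPolynomial (Fin n) k ⧸ I)
    (fun m => (homPart k n m).map (Ideal.Quotient.mkₐ k I).toLinearMap) p q

/-- `β_{p,q}^A(I)`, the graded Betti numbers of a homogeneous ideal `I` as an `A`-module. -/
def bettiIdeal (I : Ideal (MvPolynomial (Fin n) k)) (p q : ℤ) : ℕ :=
  gradedBetti n (M := I) (fun m => (homPart k n m).comap (I.subtype.restrictScalars k)) p q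

/-- `a(X)`: the supremum of the `a` such that the minimal free resolution of `A / I` has only linear
syzygies up to step `a`, that is `β_{p,q}(A / I) = 0` for `1 ≤ p ≤ a` and `q ≥ 2`. -/
def linearIndex (I : Ideal (MvPolynomial (Fin n) k)) : ℕ∞ :=
  ⨆ a ∈ {a : ℕ | ∀ p q : ℤ, 1 ≤ p → p ≤ a → 2 ≤ q → bettiQuot I p q = 0}, (a : ℕ∞)

/-- The codimension at the point `v` of the closed subscheme of projective space with the
homogeneous ideal `I`: the least codimension of an irreducible component through `v`. The components
are the zero loci of the minimal primes `P` of `I` (which are homogeneous), and the codimension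
of such a component is the height of `P`. -/
def codimAt (I : Ideal (MvPolynomial (Fin n) k)) (v : Fin n → k) : ℕ∞ :=
  ⨅ P ∈ {P ∈ I.minimalPrimes | ∀ f ∈ P, eval v f = 0}, P.height

/-- The rank at `v` of the Jacobian matrix of (generators of) `I`. -/
def jacobianRank (I : Ideal (MvPolynomial (Fin n) k)) (v : Fin n → k) : ℕ :=
  Module.finrank k (Submodule.span k
    {w : Fin n → k | ∃ f ∈ I, w = fun i => eval v (pderiv i f)})

/-- `v` is a smooth point of the projective scheme with homogeneous ideal `I`: the Jacobian matrix
at `v` has rank equal to the codimension at `v`. -/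
def IsSmoothPoint (I : Ideal (MvPolynomial (Fin n) k)) (v : Fin n → k) : Prop :=
  (jacobianRank I v : ℕ∞) = codimAt I v

end Ideals

section Projection

variable {k : Type*} [Field k] {N : ℕ}

/-- The linear coordinate change `f ↦ f ∘ g`. It transforms the ideal of `X` into that of
`g⁻¹(X)`. -/
def changeCoords (g : GL (Fin (N + 1)) k) (I : Ideal (MvPolynomial (Fin (N + 1)) k)) :
    Ideal (MvPolynomial (Fin (N + 1)) k) :=
  I.map (aeval fun i => ∑ j, C (g.val i j) * X j :
    MvPolynomial (Fin (N + 1)) k →ₐ[k] MvPolynomial (Fin (N + 1)) k)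

/-- The partial elimination ideal `K_i(I) ⊆ S = k[x_1, …, x_N]` with respect to `x_0`: all
coefficients of `x_0^i` in elements of `I` of degree at most `i` in `x_0`. -/
def partialElim (I : Ideal (MvPolynomial (Fin (N + 1)) k)) (i : ℕ) :
    Ideal (MvPolynomial (Fin N) k) :=
  (I.map (finSuccEquiv k N : MvPolynomial (Fin (N + 1)) k →ₐ[k]
    Polynomial (MvPolynomial (Fin N) k))).leadingCoeffNth i

/-- The ideal `I ∩ S` in `S = k[x_1, …, x_N]`, which equals `K_0(I)`. If `I` defines `X`, then it
defines `X_q`, the closure of the image of `X \ {q}` under the projection from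
`q = (1 : 0 : ⋯ : 0)`, with its natural scheme structure. -/
def projIdeal (I : Ideal (MvPolynomial (Fin (N + 1)) k)) : Ideal (MvPolynomial (Fin N) k) :=
  I.comap (rename Fin.succ : MvPolynomial (Fin N) k →ₐ[k] MvPolynomial (Fin (N + 1)) k)

/-- `dim_k J_1`, the number of independent linear forms in the ideal `J`. -/
def numLinearForms (J : Ideal (MvPolynomial (Fin N) k)) : ℕ :=
  Module.finrank k ↥(J.restrictScalars k ⊓ homogeneousSubmodule (Fin N) k 1)

end Projection

end

attribute [local instance] MvPolynomial.gradedAlgebra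

/-! Work over S = k[x_1, …, x_N] and truncate R/I by powers of x_0: put E_j = R/(I + S·1 + … +
S·x_0^{j-1}), so that E_0 = R/I and E_j starts in degree j. Since s x_0^j vanishes in E_j exactly
when s ∈ K_j, there are exact sequences 0 → (S/K_j)(-j) → E_j → E_{j+1} → 0
(`gradedShortExact_elim`). Splitting off the basis vector e_0 exhibits the Koszul complex over R as
the mapping cone of x_0 on the Koszul complex over S, so Tor^R_p(R/I) is an extension of ker(x_0 on
Tor^S_{p-1}(E_0)) by coker(x_0 on Tor^S_p(E_0)) (`finrank_tor_cone`). Below, Tor_p(M)_q denotes the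
part of internal degree p + q.

For the linear strand, nondegeneracy gives Tor_p(E_0)_0 = 0 for p ≥ 1, the lowest strand
Tor_p(E_1)_1 = Tor_p(S/K_1)_0 has dimension binom(t, p), and x_0 : E_1 → E_2 is injective on lowest
strands. Counting dimensions gives (`bettiQuot_one_eq`) that β_{p,1}(X) plus two corrections equals
β_{p,1}(X_q) + β_{p-1,1}(X_q) + binom(t, p). The corrections are the dimension of the kernel of
Tor_{p-1}(S/K_0)_2 → Tor_{p-1}(E_0)_2 and the rank of Tor_{p-1}(S/K_0)_1 → Tor_{p-1}(E_0)_1 →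
Tor_{p-1}(E_0)_2, the second arrow being x_0. They are nonnegative, and `finrank_corrections_le`
bounds their sum; this is (a) apart from t ≤ e.

A linear form ℓ in K_1 comes from x_0 ℓ + (quadric in S) in I, hence from a function with linear
part ℓ near the point (1, 0, …, 0) of the affine cone. A prime through that point containing t
functions with independent linear parts has height at least t (`card_le_height`), so t ≤ e. If
equality holds for some component, all lowest forms lie in the ideal of those linear forms
(`mem_span_of_height_le`). The elements of K_j are such lowest forms, so every K_j with j ≥ 1 is
generated by linear forms and Tor(S/K_j) is concentrated in q = 0.

In (b), a(X) ≥ 1 makes I generated by quadrics, whose gradients at the point are linear forms in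
K_1. Smoothness then forces t = e (`jacobianRank_le`). If Tor^R_p(R/I) is purely linear, x_0 is
surjective on Tor_p(E_0) into strands q ≥ 2 and injective on Tor_{p-1}(E_0) from those strands.
Multiplying by a high power of x_0 moves questions about Tor(S/K_0)_2 to a range where Tor(S/K_0)
vanishes, whence β_{p-1,2}(X_q) = 0 (`bettiQuot_projIdeal_two_eq_zero`) and both corrections
disappear. One step further the corrections add up to exactly β_{a,2}(X_q)
(`finrank_corrections_eq`). -/

noncomputable section

set_option linter.unusedSectionVars false

/-! ### Interior and exterior multiplication on the Koszul complex -/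

section Operators

variable {k : Type*} [Field k] {n : ℕ} {M : Type*} [AddCommGroup M]
  [Module (MvPolynomial (Fin n) k) M]

/-- The sign `(-1)^{#{j ∈ s, j < i}}` of the Koszul differential. -/
def koszulSign (i : Fin n) (s : Finset (Fin n)) : ℤ := (-1) ^ (s.filter (· < i)).card

theorem koszulSign_mul_self (i : Fin n) (s : Finset (Fin n)) :
    koszulSign i s * koszulSign i s = 1 := by
  rw [koszulSign, ← mul_pow]; simp

theorem koszulSign_insert {i j : Fin n} {s : Finset (Fin n)} (h : j ∉ s) :
    koszulSign i (insert j s) = (if j < i then -1 else 1) * koszulSign i s := by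
  rw [koszulSign, koszulSign, Finset.filter_insert]
  split_ifs with hij
  · rw [Finset.card_insert_of_notMem (by simp [h]), pow_succ]; ring
  · simp

theorem koszulSign_insert_self (i : Fin n) (s : Finset (Fin n)) :
    koszulSign i (insert i s) = koszulSign i s := by
  simp [koszulSign, Finset.filter_insert]

theorem koszulSign_erase {i j : Fin n} {s : Finset (Fin n)} (h : j ∈ s) :
    koszulSign i (s.erase j) = (if j < i then -1 else 1) * koszulSign i s := by
  conv_rhs => rw [← Finset.insert_erase h, koszulSign_insert (Finset.notMem_erase j s)]
  split_ifs <;> simp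

/-- Contraction with the `i`-th dual basis vector. -/
def koszulContract (k : Type*) [Field k] {n : ℕ} (M : Type*) [AddCommGroup M]
    [Module (MvPolynomial (Fin n) k) M] (i : Fin n) :
    (Finset (Fin n) → M) →ₗ[MvPolynomial (Fin n) k] (Finset (Fin n) → M) where
  toFun f s := if i ∈ s then 0 else koszulSign i s • f (insert i s)
  map_add' f g := by
    funext s; by_cases h : i ∈ s <;> simp [h]
  map_smul' a f := by
    funext s; by_cases h : i ∈ s <;> simp [h, smul_comm a]

theorem koszulContract_apply (i : Fin n) (f : Finset (Fin n) → M) (s : Finset (Fin n)) :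
    koszulContract k M i f s = if i ∈ s then 0 else koszulSign i s • f (insert i s) := rfl

/-- Exterior multiplication with the `i`-th basis vector. -/
def koszulWedge (k : Type*) [Field k] {n : ℕ} (M : Type*) [AddCommGroup M]
    [Module (MvPolynomial (Fin n) k) M] (i : Fin n) :
    (Finset (Fin n) → M) →ₗ[MvPolynomial (Fin n) k] (Finset (Fin n) → M) where
  toFun f s := if i ∈ s then koszulSign i s • f (s.erase i) else 0
  map_add' f g := by
    funext s; by_cases h : i ∈ s <;> simp [h]
  map_smul' a f := by
    funext s; by_cases h : i ∈ s <;> simp [h, smul_comm a]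

theorem koszulWedge_apply (i : Fin n) (f : Finset (Fin n) → M) (s : Finset (Fin n)) :
    koszulWedge k M i f s = if i ∈ s then koszulSign i s • f (s.erase i) else 0 := rfl

/-- In the form d = ∑ x_i ι_i, every commutation of the differential with another operator follows
from the anticommutation relations of contractions and exterior multiplications. -/
theorem koszulD_eq_sum (f : Finset (Fin n) → M) :
    koszulD k n M f = ∑ i, (X i : MvPolynomial (Fin n) k) • koszulContract k M i f := by
  funext s
  rw [koszulD_apply, Finset.sum_apply, ← Finset.sum_subset (Finset.subset_univ sᶜ)]
  · refine Finset.sum_congr rfl fun i hi => ?_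
    rw [Pi.smul_apply, koszulContract_apply, if_neg (Finset.mem_compl.1 hi), koszulSign, smul_comm]
  · intro i _ hi
    rw [Finset.mem_compl, not_not] at hi
    simp [koszulContract_apply, hi]

/-- One of the Clifford relations, the others being `koszulContract_wedge_self` and
`koszulContract_wedge`. Exactly one of i < j and j < i holds, which produces the single sign. -/
theorem koszulContract_comm (i j : Fin n) (f : Finset (Fin n) → M) :
    koszulContract k M i (koszulContract k M j f) =
      -koszulContract k M j (koszulContract k M i f) := by
  funext s
  rcases eq_or_ne i j with rfl | hij
  · simp [koszulContract_apply]
  simp only [koszulContract_apply, Pi.neg_apply, Finset.mem_insert]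
  by_cases hi : i ∈ s <;> by_cases hj : j ∈ s <;> simp only [hi, hj, hij, hij.symm, if_true,
    if_false, or_true, or_false, smul_zero, neg_zero]
  rw [koszulSign_insert hi, koszulSign_insert hj, Finset.insert_comm j i, smul_smul, smul_smul,
    ← neg_smul]
  congr 1
  rcases lt_or_gt_of_ne hij with h | h <;> simp [h, h.not_gt] <;> ring

theorem koszulContract_wedge_self (i : Fin n) (f : Finset (Fin n) → M) :
    koszulContract k M i (koszulWedge k M i f) + koszulWedge k M i (koszulContract k M i f) = f := by
  funext s
  simp only [koszulContract_apply, koszulWedge_apply, Pi.add_apply]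
  by_cases hi : i ∈ s
  · simp only [hi, if_true, Finset.notMem_erase, if_false, Finset.insert_erase hi, zero_add]
    rw [koszulSign_erase hi, smul_smul]
    simp [koszulSign_mul_self]
  · simp only [hi, if_false, Finset.mem_insert_self, if_true, add_zero,
      Finset.erase_insert hi, koszulSign_insert_self]
    rw [smul_smul, koszulSign_mul_self, one_smul]

theorem koszulContract_wedge {i j : Fin n} (hij : i ≠ j) (f : Finset (Fin n) → M) :
    koszulContract k M i (koszulWedge k M j f) = -koszulWedge k M j (koszulContract k M i f) := by
  funext s
  simp only [koszulContract_apply, koszulWedge_apply, Pi.neg_apply, Finset.mem_insert,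
    Finset.mem_erase]
  by_cases hi : i ∈ s <;> by_cases hj : j ∈ s <;> simp only [hi, hj, hij, hij.symm, if_true,
    if_false, or_true, or_false, and_true, and_false, not_false_eq_true, ne_eq, smul_zero, neg_zero]
  rw [koszulSign_insert hi, koszulSign_erase hj, Finset.erase_insert_of_ne hij, smul_smul,
    smul_smul, ← neg_smul]
  congr 1
  rcases lt_or_gt_of_ne hij with h | h <;> simp [h, h.not_gt] <;> ring

theorem koszulD_contract (i : Fin n) (f : Finset (Fin n) → M) :
    koszulD k n M (koszulContract k M i f) = -koszulContract k M i (koszulD k n M f) := by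
  simp only [koszulD_eq_sum, map_sum, map_smul, ← Finset.sum_neg_distrib]
  exact Finset.sum_congr rfl fun j _ => by rw [koszulContract_comm, smul_neg]

/-- Exterior multiplication with `e_j` is a homotopy between multiplication by `x_j` and `0`. -/
theorem koszulD_wedge (j : Fin n) (f : Finset (Fin n) → M) :
    koszulD k n M (koszulWedge k M j f) =
      (X j : MvPolynomial (Fin n) k) • f - koszulWedge k M j (koszulD k n M f) := by
  rw [eq_sub_iff_add_eq]
  simp only [koszulD_eq_sum, map_sum, map_smul, ← Finset.sum_add_distrib, ← smul_add]
  rw [Finset.sum_eq_single j]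
  · rw [koszulContract_wedge_self]
  · intro i _ hij
    rw [koszulContract_wedge hij, neg_add_cancel, smul_zero]
  · simp

end Operators

/-! ### Homology of graded differential spaces -/

section Homology

variable {k : Type*} [Field k] {V W U : Type*} [AddCommGroup V] [Module k V] [AddCommGroup W]
  [Module k W] [AddCommGroup U] [Module k U]

/-- Cycles in `G` modulo boundaries of elements of `G'`. -/
abbrev PartHomology (d : V →ₗ[k] V) (G' G : Submodule k V) : Type _ :=
  ↥(G ⊓ LinearMap.ker d) ⧸ (G'.map d).comap (G ⊓ LinearMap.ker d).subtype

variable {d : V →ₗ[k] V} {d₁ : W →ₗ[k] W} {d₂ : U →ₗ[k] U}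

/-- The homology class of a cycle. -/
def homologyClass (d : V →ₗ[k] V) (G' G : Submodule k V) (z : V) (hz : z ∈ G) (hd : d z = 0) :
    PartHomology d G' G :=
  Submodule.Quotient.mk ⟨z, hz, hd⟩

theorem homologyClass_eq_zero {G' G : Submodule k V} {z : V} {hz : z ∈ G} {hd : d z = 0} :
    homologyClass d G' G z hz hd = 0 ↔ ∃ y ∈ G', d y = z := by
  rw [homologyClass, Submodule.Quotient.mk_eq_zero]
  rfl

theorem homologyClass_eq {G' G : Submodule k V} {z z' : V} {hz : z ∈ G} {hd : d z = 0}
    {hz' : z' ∈ G} {hd' : d z' = 0} :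
    homologyClass d G' G z hz hd = homologyClass d G' G z' hz' hd' ↔ ∃ y ∈ G', d y = z - z' := by
  rw [homologyClass, homologyClass, Submodule.Quotient.eq]
  rfl

theorem exists_homologyClass {G' G : Submodule k V} (x : PartHomology d G' G) :
    ∃ z hz hd, x = homologyClass d G' G z hz hd := by
  obtain ⟨⟨z, hz⟩, rfl⟩ := Submodule.Quotient.mk_surjective _ x
  exact ⟨z, hz.1, hz.2, rfl⟩

/-- The map on homology induced by a chain map. -/
def homologyMap (f : V →ₗ[k] W) (hf : ∀ v, f (d v) = d₁ (f v)) {G' G : Submodule k V}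
    {F' F : Submodule k W} (h' : ∀ v ∈ G', f v ∈ F') (h : ∀ v ∈ G, f v ∈ F) :
    PartHomology d G' G →ₗ[k] PartHomology d₁ F' F :=
  Submodule.mapQ _ _ (f.restrict (p := G ⊓ LinearMap.ker d) (q := F ⊓ LinearMap.ker d₁)
    fun v hv => ⟨h v hv.1, show d₁ (f v) = 0 by
      rw [← hf, LinearMap.mem_ker.1 hv.2, map_zero]⟩) (by
    rintro ⟨v, hv⟩ ⟨y, hy, hyv⟩
    exact ⟨f y, h' y hy, by rw [← hf, hyv]; rfl⟩)

theorem homologyMap_class (f : V →ₗ[k] W) (hf : ∀ v, f (d v) = d₁ (f v)) {G' G : Submodule k V}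
    {F' F : Submodule k W} (h' : ∀ v ∈ G', f v ∈ F') (h : ∀ v ∈ G, f v ∈ F) (z : V) (hz : z ∈ G)
    (hd : d z = 0) :
    homologyMap f hf h' h (homologyClass d G' G z hz hd) =
      homologyClass d₁ F' F (f z) (h z hz) (by rw [← hf, hd, map_zero]) := rfl

instance (G' G : Submodule k V) [FiniteDimensional k G] : FiniteDimensional k (PartHomology d G' G) :=
  haveI : FiniteDimensional k ↥(G ⊓ LinearMap.ker d) :=
    Submodule.finiteDimensional_of_le (inf_le_left)
  inferInstance

/-- Exactness at the middle term of the homology sequence of a short exact sequence. -/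
theorem homology_exact {f : V →ₗ[k] W} {g : W →ₗ[k] U} (hf : ∀ v, f (d v) = d₁ (f v))
    (hg : ∀ v, g (d₁ v) = d₂ (g v)) (hinj : Function.Injective f) (hgf : ∀ v, g (f v) = 0)
    {A' A : Submodule k V} {B' B : Submodule k W} {C' C : Submodule k U}
    (hfA' : ∀ v ∈ A', f v ∈ B') (hfA : ∀ v ∈ A, f v ∈ B) (hgB' : ∀ v ∈ B', g v ∈ C')
    (hgB : ∀ v ∈ B, g v ∈ C) (hdd : ∀ v, d₁ (d₁ v) = 0) (hdB : ∀ v ∈ B', d₁ v ∈ B)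
    (hex : ∀ b ∈ B, g b = 0 → ∃ a ∈ A, f a = b) (hsurj : ∀ c ∈ C', ∃ b ∈ B', g b = c) :
    Function.Exact (homologyMap f hf hfA' hfA) (homologyMap g hg hgB' hgB) := by
  intro y
  obtain ⟨z, hz, hdz, rfl⟩ := exists_homologyClass y
  rw [homologyMap_class, homologyClass_eq_zero]
  constructor
  · rintro ⟨c, hc, hcz⟩
    obtain ⟨b, hb, rfl⟩ := hsurj c hc
    obtain ⟨a, ha, haz⟩ := hex (z - d₁ b) (sub_mem hz (hdB b hb)) (by rw [map_sub, hg, hcz, sub_self])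
    have hda : d a = 0 := hinj (by rw [hf, haz, map_sub, hdz, hdd, sub_self, map_zero])
    refine ⟨homologyClass d A' A a ha hda, ?_⟩
    rw [homologyMap_class, homologyClass_eq]
    exact ⟨-b, neg_mem hb, by rw [haz, map_neg]; abel⟩
  · rintro ⟨x, hx⟩
    obtain ⟨a, ha, hda, rfl⟩ := exists_homologyClass x
    rw [homologyMap_class, homologyClass_eq] at hx
    obtain ⟨y, hy, hyz⟩ := hx
    refine ⟨-g y, neg_mem (hgB' y hy), ?_⟩
    rw [map_neg, ← hg, hyz, map_sub, hgf]; simp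

/-- Exactness at the other two terms of the homology sequence of a short exact sequence, expressed
by dimensions. -/
theorem homology_connecting {f : V →ₗ[k] W} {g : W →ₗ[k] U} (hf : ∀ v, f (d v) = d₁ (f v))
    (hg : ∀ v, g (d₁ v) = d₂ (g v)) (hinj : Function.Injective f) (hgf : ∀ v, g (f v) = 0)
    {A₂ A₁ : Submodule k V} {B₃ B₂ B₁ : Submodule k W} {C₃ C₂ : Submodule k U}
    (hfA₂ : ∀ v ∈ A₂, f v ∈ B₂) (hfA₁ : ∀ v ∈ A₁, f v ∈ B₁) (hgB₃ : ∀ v ∈ B₃, g v ∈ C₃)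
    (hgB₂ : ∀ v ∈ B₂, g v ∈ C₂) (hdd : ∀ v, d₁ (d₁ v) = 0)
    (hdB₃ : ∀ v ∈ B₃, d₁ v ∈ B₂) (hdB₂ : ∀ v ∈ B₂, d₁ v ∈ B₁)
    (hex₂ : ∀ b ∈ B₂, g b = 0 → ∃ a ∈ A₂, f a = b) (hex₁ : ∀ b ∈ B₁, g b = 0 → ∃ a ∈ A₁, f a = b)
    (hsurj₃ : ∀ c ∈ C₃, ∃ b ∈ B₃, g b = c) (hsurj₂ : ∀ c ∈ C₂, ∃ b ∈ B₂, g b = c)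
    [FiniteDimensional k C₂] :
    Module.finrank k (LinearMap.ker (homologyMap f hf hfA₂ hfA₁)) +
      Module.finrank k (LinearMap.range (homologyMap g hg hgB₃ hgB₂)) =
      Module.finrank k (PartHomology d₂ C₃ C₂) := by
  -- The retraction is only linear, not a chain map; it serves to write f⁻¹ ∘ d₁ as a linear map on
  -- `D`, where it does not depend on `r`.
  obtain ⟨r, hr⟩ := f.exists_leftInverse_of_injective (LinearMap.ker_eq_bot.2 hinj)
  have hr : ∀ v, r (f v) = v := fun v => LinearMap.congr_fun hr v
  -- `D` holds the lifts used in the snake lemma: u ∈ B₂ with d₁ u in f(A₁). The connecting map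
  -- sends `μ u`, the class of g u, to `ν u`, the class of f⁻¹(d₁ u).
  let D : Submodule k W := B₂ ⊓ (A₁.map f).comap d₁
  have hD : ∀ u ∈ D, ∃ a ∈ A₁, f a = d₁ u := fun u hu => hu.2
  let μ : D →ₗ[k] PartHomology d₂ C₃ C₂ := Submodule.mkQ _ ∘ₗ
    g.restrict (p := D) (q := C₂ ⊓ LinearMap.ker d₂) fun u hu => ⟨hgB₂ u hu.1, show d₂ (g u) = 0 by
      obtain ⟨a, _, ha⟩ := hD u hu
      rw [← hg, ← ha, hgf]⟩
  let ν : D →ₗ[k] PartHomology d A₂ A₁ := Submodule.mkQ _ ∘ₗ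
    (r ∘ₗ d₁).restrict (p := D) (q := A₁ ⊓ LinearMap.ker d) fun u hu => by
      obtain ⟨a, ha, hau⟩ := hD u hu
      have : (r ∘ₗ d₁) u = a := by rw [LinearMap.comp_apply, ← hau, hr]
      rw [this]
      exact ⟨ha, hinj (by rw [hf, hau, hdd, map_zero])⟩
  have hμ : ∀ u (hu : u ∈ D) (h1 : g u ∈ C₂) (h2 : d₂ (g u) = 0),
      μ ⟨u, hu⟩ = homologyClass d₂ C₃ C₂ (g u) h1 h2 := fun _ _ _ _ => rfl
  have hν : ∀ u (hu : u ∈ D) (a) (ha : a ∈ A₁) (hda : d a = 0), f a = d₁ u →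
      ν ⟨u, hu⟩ = homologyClass d A₂ A₁ a ha hda := by
    intro u hu a ha hda hau
    have h : (r ∘ₗ d₁) u = a := by rw [LinearMap.comp_apply, ← hau, hr]
    exact congrArg (Submodule.Quotient.mk) (Subtype.ext h)
  have hμs : Function.Surjective μ := by
    intro x
    obtain ⟨c, hc, hdc, rfl⟩ := exists_homologyClass x
    obtain ⟨b, hb, rfl⟩ := hsurj₂ c hc
    obtain ⟨a, ha, hab⟩ := hex₁ (d₁ b) (hdB₂ b hb) (by rw [hg, hdc])
    exact ⟨⟨b, hb, a, ha, hab⟩, hμ b _ hc hdc⟩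
  have hda : ∀ u a, f a = d₁ u → d a = 0 := fun u a hau =>
    hinj (by rw [hf, hau, hdd, map_zero])
  -- Independence of the connecting map from the chosen lift.
  have hker : LinearMap.ker μ ≤ LinearMap.ker ν := by
    rintro ⟨u, hu⟩ hx
    obtain ⟨a, ha, hau⟩ := hD u hu
    rw [LinearMap.mem_ker, hμ u hu (hgB₂ u hu.1) (by rw [← hg, ← hau, hgf]),
      homologyClass_eq_zero] at hx
    obtain ⟨c, hc, hcu⟩ := hx
    obtain ⟨b, hb, rfl⟩ := hsurj₃ c hc
    obtain ⟨a', ha', hab'⟩ := hex₂ (u - d₁ b) (sub_mem hu.1 (hdB₃ b hb))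
      (by rw [map_sub, hg, hcu, sub_self])
    rw [LinearMap.mem_ker, hν u hu a ha (hda u a hau) hau, homologyClass_eq_zero]
    exact ⟨a', ha', hinj (by rw [hf, hab', hau, map_sub, hdd, sub_zero])⟩
  let δ : PartHomology d₂ C₃ C₂ →ₗ[k] PartHomology d A₂ A₁ :=
    (LinearMap.ker μ).liftQ ν hker ∘ₗ (μ.quotKerEquivOfSurjective hμs).symm.toLinearMap
  have hδ : ∀ u, δ (μ u) = ν u := by
    intro u
    have : (μ.quotKerEquivOfSurjective hμs).symm (μ u) = Submodule.Quotient.mk u := by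
      rw [LinearEquiv.symm_apply_eq]; rfl
    simp only [δ, LinearMap.comp_apply, LinearEquiv.coe_coe, this]
    rfl
  have h1 : LinearMap.ker (homologyMap f hf hfA₂ hfA₁) = LinearMap.range δ := by
    ext x
    constructor
    · intro hx
      obtain ⟨a, ha, hda', rfl⟩ := exists_homologyClass x
      rw [LinearMap.mem_ker, homologyMap_class, homologyClass_eq_zero] at hx
      obtain ⟨u, hu, hua⟩ := hx
      have huD : u ∈ D := ⟨hu, a, ha, hua.symm⟩
      exact ⟨μ ⟨u, huD⟩, by rw [hδ, hν u huD a ha hda' hua.symm]⟩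
    · rintro ⟨y, rfl⟩
      obtain ⟨⟨u, hu⟩, rfl⟩ := hμs y
      obtain ⟨a, ha, hau⟩ := hD u hu
      rw [hδ, hν u hu a ha (hda u a hau) hau, LinearMap.mem_ker, homologyMap_class,
        homologyClass_eq_zero]
      exact ⟨u, hu.1, hau.symm⟩
  have h2 : LinearMap.range (homologyMap g hg hgB₃ hgB₂) = LinearMap.ker δ := by
    ext x
    constructor
    · rintro ⟨y, rfl⟩
      obtain ⟨b, hb, hdb, rfl⟩ := exists_homologyClass y
      have hbD : b ∈ D := ⟨hb, 0, zero_mem _, by rw [map_zero, hdb]⟩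
      rw [homologyMap_class, ← hμ b hbD, LinearMap.mem_ker, hδ,
        hν b hbD 0 (zero_mem _) (map_zero _) (by rw [map_zero, hdb]), homologyClass_eq_zero]
      exact ⟨0, zero_mem _, map_zero _⟩
    · intro hx
      obtain ⟨⟨u, hu⟩, rfl⟩ := hμs x
      obtain ⟨a, ha, hau⟩ := hD u hu
      rw [LinearMap.mem_ker, hδ, hν u hu a ha (hda u a hau) hau, homologyClass_eq_zero] at hx
      obtain ⟨a', ha', rfl⟩ := hx
      have hd0 : d₁ (u - f a') = 0 := by rw [map_sub, ← hf, hau, sub_self]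
      refine ⟨homologyClass d₁ B₃ B₂ (u - f a') (sub_mem hu.1 (hfA₂ _ ha')) hd0, ?_⟩
      rw [homologyMap_class, hμ u hu (hgB₂ u hu.1) (by rw [← hg, ← hau, hgf]), homologyClass_eq]
      exact ⟨0, zero_mem _, by rw [map_sub, hgf]; simp⟩
  rw [h1, h2, LinearMap.finrank_range_add_finrank_ker]

end Homology

/-! ### Koszul homology of graded modules -/

section KoszulHomology

variable {k : Type*} [Field k] {n : ℕ} {M : Type*} [AddCommGroup M] [Module k M]
  [Module (MvPolynomial (Fin n) k) M] [IsScalarTower k (MvPolynomial (Fin n) k) M]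
  {M₁ : Type*} [AddCommGroup M₁] [Module k M₁]
  [Module (MvPolynomial (Fin n) k) M₁] [IsScalarTower k (MvPolynomial (Fin n) k) M₁]
  {M₂ : Type*} [AddCommGroup M₂] [Module k M₂]
  [Module (MvPolynomial (Fin n) k) M₂] [IsScalarTower k (MvPolynomial (Fin n) k) M₂]

/-- The variables have degree `1` with respect to the family of subspaces `Mdeg`. -/
def IsGradedFamily (Mdeg : ℤ → Submodule k M) : Prop :=
  ∀ (m m' : ℤ) (i : Fin n), m' = m + 1 → ∀ x ∈ Mdeg m, (X i : MvPolynomial (Fin n) k) • x ∈ Mdeg m'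

theorem mem_koszulChain {Mdeg : ℤ → Submodule k M} {p q : ℤ} {f : Finset (Fin n) → M} :
    f ∈ koszulChain n Mdeg p q ↔
      ∀ s, ((s.card : ℤ) = p → f s ∈ Mdeg q) ∧ ((s.card : ℤ) ≠ p → f s = 0) := by
  rw [koszulChain, Submodule.mem_pi]
  refine ⟨fun h s => ?_, fun h s _ => ?_⟩
  · have := h s trivial
    split_ifs at this with hs
    · exact ⟨fun _ => this, fun h => absurd hs h⟩
    · exact ⟨fun h => absurd h hs, fun _ => this⟩
  · split_ifs with hs
    · exact (h s).1 hs
    · exact (h s).2 hs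

theorem koszulChain_apply_mem {Mdeg : ℤ → Submodule k M} {p q : ℤ} {f : Finset (Fin n) → M}
    (hf : f ∈ koszulChain n Mdeg p q) (s : Finset (Fin n)) : f s ∈ Mdeg q := by
  by_cases h : (s.card : ℤ) = p
  · exact ((mem_koszulChain.1 hf) s).1 h
  · rw [((mem_koszulChain.1 hf) s).2 h]; exact zero_mem _

/-- The Koszul differential as a `k`-linear map. -/
abbrev koszulDk (k : Type*) [Field k] (n : ℕ) (M : Type*) [AddCommGroup M] [Module k M]
    [Module (MvPolynomial (Fin n) k) M] [IsScalarTower k (MvPolynomial (Fin n) k) M] :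
    (Finset (Fin n) → M) →ₗ[k] (Finset (Fin n) → M) :=
  (koszulD k n M).restrictScalars k

/-- `Tor_p(M, k)_{p+q}`, computed by the Koszul complex. -/
abbrev KoszulTor (n : ℕ) {M : Type*} [AddCommGroup M] [Module k M]
    [Module (MvPolynomial (Fin n) k) M] [IsScalarTower k (MvPolynomial (Fin n) k) M]
    (Mdeg : ℤ → Submodule k M) (p q : ℤ) : Type _ :=
  PartHomology (koszulDk k n M) (koszulChain n Mdeg (p + 1) (q - 1)) (koszulChain n Mdeg p q)

theorem gradedBetti_eq (Mdeg : ℤ → Submodule k M) (p q : ℤ) :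
    gradedBetti n Mdeg p q = Module.finrank k (KoszulTor n Mdeg p q) := rfl

theorem koszulDk_koszulDk (f : Finset (Fin n) → M) : koszulDk k n M (koszulDk k n M f) = 0 :=
  koszulD_comp k n M f

theorem koszulD_mem_chain {Mdeg : ℤ → Submodule k M} (hM : IsGradedFamily (n := n) Mdeg)
    {p q p' q' : ℤ} (hp : p = p' + 1) (hq : q' = q + 1) {f : Finset (Fin n) → M}
    (hf : f ∈ koszulChain n Mdeg p q) : koszulDk k n M f ∈ koszulChain n Mdeg p' q' := by
  rw [mem_koszulChain]
  intro s
  change (_ → koszulD k n M f s ∈ _) ∧ (_ → koszulD k n M f s = _)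
  rw [koszulD_apply]
  refine ⟨fun _ => ?_, fun hs => ?_⟩
  · refine sum_mem fun i _ => zsmul_mem (hM q q' i hq _ (koszulChain_apply_mem hf _)) _
  · refine Finset.sum_eq_zero fun i hi => ?_
    rw [(mem_koszulChain.1 hf _).2, smul_zero, smul_zero]
    rw [Finset.card_insert_of_notMem (Finset.mem_compl.1 hi)]
    push_cast
    omega

theorem koszulChain_finite {Mdeg : ℤ → Submodule k M} {q : ℤ} [FiniteDimensional k (Mdeg q)]
    (p : ℤ) : FiniteDimensional k (koszulChain n Mdeg p q) := by
  let φ : koszulChain n Mdeg p q →ₗ[k] (Finset (Fin n) → Mdeg q) :=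
    { toFun := fun f s => ⟨f.1 s, koszulChain_apply_mem f.2 s⟩
      map_add' := fun _ _ => rfl
      map_smul' := fun _ _ => rfl }
  refine Module.Finite.of_injective φ fun f g h => Subtype.ext (_root_.funext fun s => ?_)
  exact congrArg Subtype.val (congrFun h s)

instance (Mdeg : ℤ → Submodule k M) [∀ q, FiniteDimensional k (Mdeg q)] (p q : ℤ) :
    FiniteDimensional k (koszulChain n Mdeg p q) := koszulChain_finite p

/-- The map that a linear map induces on the Koszul complex. -/
def koszulMap (φ : M →ₗ[MvPolynomial (Fin n) k] M₁) :
    (Finset (Fin n) → M) →ₗ[k] (Finset (Fin n) → M₁) :=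
  (φ.compLeft (Finset (Fin n))).restrictScalars k

theorem koszulMap_apply (φ : M →ₗ[MvPolynomial (Fin n) k] M₁) (f : Finset (Fin n) → M)
    (s : Finset (Fin n)) : koszulMap φ f s = φ (f s) := rfl

theorem koszulMap_comm (φ : M →ₗ[MvPolynomial (Fin n) k] M₁) (f : Finset (Fin n) → M) :
    koszulMap φ (koszulDk k n M f) = koszulDk k n M₁ (koszulMap φ f) := by
  funext s
  change φ (koszulD k n M f s) = koszulD k n M₁ (koszulMap φ f) s
  rw [koszulD_apply, koszulD_apply, map_sum]
  exact Finset.sum_congr rfl fun i _ => by rw [map_zsmul, map_smul]; rfl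

/-- `φ` maps elements of degree `m` to elements of degree `m + c`. -/
def IsHomogeneousMap (Mdeg : ℤ → Submodule k M) (M₁deg : ℤ → Submodule k M₁) (c : ℤ)
    (φ : M →ₗ[MvPolynomial (Fin n) k] M₁) : Prop :=
  ∀ m m' : ℤ, m' = m + c → ∀ x ∈ Mdeg m, φ x ∈ M₁deg m'

variable {Mdeg : ℤ → Submodule k M} {M₁deg : ℤ → Submodule k M₁} {M₂deg : ℤ → Submodule k M₂}

theorem IsHomogeneousMap.koszulMap_mem {c : ℤ} {φ : M →ₗ[MvPolynomial (Fin n) k] M₁}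
    (h : IsHomogeneousMap Mdeg M₁deg c φ) {p q q' : ℤ} (hq : q' = q + c) (f : Finset (Fin n) → M)
    (hf : f ∈ koszulChain n Mdeg p q) : koszulMap φ f ∈ koszulChain n M₁deg p q' := by
  rw [mem_koszulChain] at hf ⊢
  intro s
  rw [koszulMap_apply]
  exact ⟨fun hs => h q q' hq _ ((hf s).1 hs), fun hs => by rw [(hf s).2 hs, map_zero]⟩

/-- The map that a homogeneous map of degree `c` induces on `Tor`. -/
def torMap {c : ℤ} {φ : M →ₗ[MvPolynomial (Fin n) k] M₁} (h : IsHomogeneousMap Mdeg M₁deg c φ)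
    (p : ℤ) {q q' : ℤ} (hq : q' = q + c) : KoszulTor n Mdeg p q →ₗ[k] KoszulTor n M₁deg p q' :=
  homologyMap (koszulMap φ) (koszulMap_comm φ) (h.koszulMap_mem (by omega)) (h.koszulMap_mem hq)

theorem torMap_class {c : ℤ} {φ : M →ₗ[MvPolynomial (Fin n) k] M₁}
    (h : IsHomogeneousMap Mdeg M₁deg c φ) (p : ℤ) {q q' : ℤ} (hq : q' = q + c)
    (z : Finset (Fin n) → M) (hz : z ∈ koszulChain n Mdeg p q) (hd : koszulDk k n M z = 0) :
    torMap h p hq (homologyClass (koszulDk k n M) _ _ z hz hd) =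
      homologyClass (koszulDk k n M₁) _ _ (koszulMap φ z) (h.koszulMap_mem hq z hz)
        (by rw [← koszulMap_comm, hd, map_zero]) := rfl

/-- Intermediate degrees are variables tied by equations, so squares commute without casts between
Tor groups in propositionally equal degrees. -/
theorem torMap_torMap {c c₁ c₂ c₃ : ℤ} {M₃ : Type*} [AddCommGroup M₃] [Module k M₃]
    [Module (MvPolynomial (Fin n) k) M₃] [IsScalarTower k (MvPolynomial (Fin n) k) M₃]
    {M₃deg : ℤ → Submodule k M₃}
    {φ : M →ₗ[MvPolynomial (Fin n) k] M₁} {ψ : M₁ →ₗ[MvPolynomial (Fin n) k] M₂}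
    {φ' : M →ₗ[MvPolynomial (Fin n) k] M₃} {ψ' : M₃ →ₗ[MvPolynomial (Fin n) k] M₂}
    (hφ : IsHomogeneousMap Mdeg M₁deg c φ) (hψ : IsHomogeneousMap M₁deg M₂deg c₁ ψ)
    (hφ' : IsHomogeneousMap Mdeg M₃deg c₂ φ') (hψ' : IsHomogeneousMap M₃deg M₂deg c₃ ψ')
    (h : ∀ x, ψ (φ x) = ψ' (φ' x)) (p : ℤ) {q q₁ q₂ q₃ : ℤ} (hq₁ : q₁ = q + c) (hq₂ : q₂ = q₁ + c₁)
    (hq₃ : q₃ = q + c₂) (hq₄ : q₂ = q₃ + c₃) (x : KoszulTor n Mdeg p q) :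
    torMap hψ p hq₂ (torMap hφ p hq₁ x) = torMap hψ' p hq₄ (torMap hφ' p hq₃ x) := by
  obtain ⟨z, hz, hd, rfl⟩ := exists_homologyClass x
  simp only [torMap_class]
  congr 1
  funext s
  exact h (z s)

theorem subsingleton_tor_of_deg_eq_bot {p q : ℤ} (h : Mdeg q = ⊥) :
    Subsingleton (KoszulTor n Mdeg p q) := by
  refine subsingleton_of_forall_eq 0 fun x => ?_
  obtain ⟨z, hz, hd, rfl⟩ := exists_homologyClass x
  rw [homologyClass_eq_zero]
  refine ⟨0, zero_mem _, ?_⟩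
  rw [map_zero]
  funext s
  have := koszulChain_apply_mem hz s
  rw [h, Submodule.mem_bot] at this
  exact this.symm

theorem subsingleton_tor_of_neg {p q : ℤ} (h : p < 0) : Subsingleton (KoszulTor n Mdeg p q) := by
  refine subsingleton_of_forall_eq 0 fun x => ?_
  obtain ⟨z, hz, hd, rfl⟩ := exists_homologyClass x
  rw [homologyClass_eq_zero]
  refine ⟨0, zero_mem _, ?_⟩
  rw [map_zero]
  funext s
  exact ((mem_koszulChain.1 hz s).2 (by omega)).symm

/-- In the lowest degree, a homogeneous map that is injective in that degree is injective on
`Tor`. -/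
theorem torMap_injective_of_lowest {c : ℤ} {φ : M →ₗ[MvPolynomial (Fin n) k] M₁}
    (h : IsHomogeneousMap Mdeg M₁deg c φ) (p : ℤ) {q q' : ℤ} (hq : q' = q + c)
    (hlow : M₁deg (q' - 1) = ⊥) (hinj : ∀ x ∈ Mdeg q, φ x = 0 → x = 0) :
    Function.Injective (torMap h p hq) := by
  rw [injective_iff_map_eq_zero]
  intro x hx
  obtain ⟨z, hz, hd, rfl⟩ := exists_homologyClass x
  rw [torMap_class, homologyClass_eq_zero] at hx
  obtain ⟨y, hy, hyz⟩ := hx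
  have hy0 : y = 0 := by
    funext s
    have := koszulChain_apply_mem hy s
    rwa [hlow, Submodule.mem_bot] at this
  rw [hy0, map_zero] at hyz
  rw [homologyClass_eq_zero]
  refine ⟨0, zero_mem _, ?_⟩
  rw [map_zero]
  funext s
  exact (hinj _ (koszulChain_apply_mem hz s) (congrFun hyz s).symm).symm

/-- A short exact sequence of graded modules, the first map of degree `c` and the second of
degree `0`. -/
structure GradedShortExact (Mdeg : ℤ → Submodule k M) (M₁deg : ℤ → Submodule k M₁)
    (M₂deg : ℤ → Submodule k M₂) (c : ℤ) (φ : M →ₗ[MvPolynomial (Fin n) k] M₁)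
    (ψ : M₁ →ₗ[MvPolynomial (Fin n) k] M₂) : Prop where
  graded : IsGradedFamily (n := n) M₁deg
  hom₁ : IsHomogeneousMap Mdeg M₁deg c φ
  hom₂ : IsHomogeneousMap M₁deg M₂deg 0 ψ
  inj : Function.Injective φ
  comp : ∀ x, ψ (φ x) = 0
  exact : ∀ m m' : ℤ, m' = m + c → ∀ y ∈ M₁deg m', ψ y = 0 → ∃ x ∈ Mdeg m, φ x = y
  surj : ∀ m, ∀ z ∈ M₂deg m, ∃ y ∈ M₁deg m, ψ y = z

namespace GradedShortExact

variable {c : ℤ} {φ : M →ₗ[MvPolynomial (Fin n) k] M₁} {ψ : M₁ →ₗ[MvPolynomial (Fin n) k] M₂}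
  (h : GradedShortExact Mdeg M₁deg M₂deg c φ ψ)

include h

theorem chain_exact {p q q' : ℤ} (hq : q' = q + c) (b : Finset (Fin n) → M₁)
    (hb : b ∈ koszulChain n M₁deg p q') (h0 : koszulMap ψ b = 0) :
    ∃ a ∈ koszulChain n Mdeg p q, koszulMap φ a = b := by
  have := fun s => h.exact q q' hq (b s) (koszulChain_apply_mem hb s) (congrFun h0 s)
  choose a ha hab using this
  refine ⟨a, mem_koszulChain.2 fun s => ⟨fun _ => ha s, fun hs => h.inj ?_⟩, _root_.funext hab⟩
  rw [hab, map_zero, (mem_koszulChain.1 hb s).2 hs]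

theorem chain_surj {p q : ℤ} (z : Finset (Fin n) → M₂)
    (hz : z ∈ koszulChain n M₂deg p q) : ∃ b ∈ koszulChain n M₁deg p q, koszulMap ψ b = z := by
  have := fun s => h.surj q (z s) (koszulChain_apply_mem hz s)
  choose b hb hbz using this
  -- A chosen lift of 0 need not be 0, so the components outside homological degree p are reset.
  refine ⟨fun s => if (s.card : ℤ) = p then b s else 0, mem_koszulChain.2 fun s => ?_,
    _root_.funext fun s => ?_⟩
  · exact ⟨fun hs => by simpa [hs] using hb s, fun hs => by simp [hs]⟩
  · rw [koszulMap_apply]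
    by_cases hs : (s.card : ℤ) = p
    · simp [hs, hbz]
    · simp [hs, (mem_koszulChain.1 hz s).2 hs]

theorem koszulMap_injective : Function.Injective (koszulMap φ) :=
  fun _ _ hab => _root_.funext fun s => h.inj (congrFun hab s)

theorem koszulMap_koszulMap (v : Finset (Fin n) → M) : koszulMap ψ (koszulMap φ v) = 0 :=
  _root_.funext fun s => h.comp (v s)

theorem tor_exact (p : ℤ) {q q' : ℤ} (hq : q' = q + c) :
    Function.Exact (torMap h.hom₁ p hq) (torMap h.hom₂ p (add_zero q').symm) := by
  unfold torMap
  apply homology_exact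
  · exact h.koszulMap_injective
  · exact h.koszulMap_koszulMap
  · exact koszulDk_koszulDk
  · exact fun _ hv => koszulD_mem_chain h.graded rfl (by omega) hv
  · exact h.chain_exact hq
  · exact h.chain_surj

/-- The connecting map Tor_p(M₂)_q → Tor_{p-1}(M) lowers p and raises q by one before the shift by
c. Its image is the kernel of the next map and its kernel the image of the previous one, so rank
plus nullity records exactness at two places at once. -/
theorem tor_connecting [∀ q, FiniteDimensional k (M₂deg q)] {p p' : ℤ} (hp : p = p' + 1)
    {q q₁ q' : ℤ} (hq' : q₁ = q' + c) (hq : q₁ = q + 1) :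
    Module.finrank k (LinearMap.ker (torMap h.hom₁ p' hq')) +
      Module.finrank k (LinearMap.range (torMap h.hom₂ p (add_zero q).symm)) =
      Module.finrank k (KoszulTor n M₂deg p q) := by
  subst hp
  obtain rfl : q = q₁ - 1 := by omega
  unfold torMap
  apply homology_connecting
  · exact h.koszulMap_injective
  · exact h.koszulMap_koszulMap
  · exact koszulDk_koszulDk
  · exact fun _ hv => koszulD_mem_chain h.graded rfl (by omega) hv
  · exact fun _ hv => koszulD_mem_chain h.graded rfl (by omega) hv
  · exact h.chain_exact (by omega)
  · exact h.chain_exact hq'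
  · exact h.chain_surj
  · exact h.chain_surj

theorem torMap_injective [∀ q, FiniteDimensional k (M₂deg q)] [∀ q, FiniteDimensional k (Mdeg q)]
    {p p' : ℤ} (hp : p = p' + 1) {q q₁ q' : ℤ} (hq' : q₁ = q' + c) (hq : q₁ = q + 1)
    (h0 : Subsingleton (KoszulTor n M₂deg p q)) : Function.Injective (torMap h.hom₁ p' hq') := by
  have := h.tor_connecting hp hq' hq
  rw [Module.finrank_zero_of_subsingleton (M := KoszulTor n M₂deg p q), Nat.add_eq_zero_iff] at this
  exact LinearMap.ker_eq_bot.1 (Submodule.finrank_eq_zero.1 this.1)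

theorem torMap_surjective [∀ q, FiniteDimensional k (M₂deg q)] {p p' : ℤ} (hp : p = p' + 1)
    {q q' : ℤ} (hq : q + 1 = q' + c) (h0 : Subsingleton (KoszulTor n Mdeg p' q')) :
    Function.Surjective (torMap h.hom₂ p (add_zero q).symm) := by
  have := h.tor_connecting hp hq rfl
  rw [Module.finrank_zero_of_subsingleton, zero_add] at this
  exact LinearMap.range_eq_top.1 (Submodule.eq_top_of_finrank_eq this)

end GradedShortExact

end KoszulHomology

/-! ### The elimination mapping cone -/

section FinsetSucc

variable {n : ℕ}

/-- The shifted set `{i + 1 : i ∈ s}`. -/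
def succSet (s : Finset (Fin n)) : Finset (Fin (n + 1)) := s.map (Fin.succEmb n)

/-- The set of all `i` with `i + 1 ∈ t`. -/
def predSet (t : Finset (Fin (n + 1))) : Finset (Fin n) := Finset.univ.filter fun i => i.succ ∈ t

@[simp] theorem mem_predSet {t : Finset (Fin (n + 1))} {i : Fin n} :
    i ∈ predSet t ↔ i.succ ∈ t := by simp [predSet]

@[simp] theorem succ_mem_succSet {s : Finset (Fin n)} {i : Fin n} :
    i.succ ∈ succSet s ↔ i ∈ s := by simp [succSet]

@[simp] theorem zero_notMem_succSet (s : Finset (Fin n)) : (0 : Fin (n + 1)) ∉ succSet s := by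
  simp [succSet, Fin.succ_ne_zero]

@[simp] theorem card_succSet (s : Finset (Fin n)) : (succSet s).card = s.card := by simp [succSet]

@[simp] theorem predSet_succSet (s : Finset (Fin n)) : predSet (succSet s) = s := by
  ext i; simp

@[simp] theorem predSet_insert_zero (t : Finset (Fin (n + 1))) :
    predSet (insert 0 t) = predSet t := by
  ext i; simp [Fin.succ_ne_zero]

theorem succSet_predSet {t : Finset (Fin (n + 1))} (h : 0 ∉ t) : succSet (predSet t) = t := by
  ext i
  refine Fin.cases ?_ (fun i => ?_) i <;> simp [h]

theorem insert_succSet_predSet {t : Finset (Fin (n + 1))} (h : 0 ∈ t) :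
    insert 0 (succSet (predSet t)) = t := by
  ext i
  refine Fin.cases ?_ (fun i => ?_) i <;> simp [h, Fin.succ_ne_zero]

theorem succSet_insert (i : Fin n) (s : Finset (Fin n)) :
    succSet (insert i s) = insert i.succ (succSet s) := by
  simp [succSet]

theorem koszulSign_succSet (i : Fin n) (s : Finset (Fin n)) :
    koszulSign i.succ (succSet s) = koszulSign i s := by
  rw [koszulSign, koszulSign, succSet, Finset.filter_map, Finset.card_map]
  congr 3
  ext j
  simp

theorem koszulSign_zero (t : Finset (Fin (n + 1))) : koszulSign 0 t = 1 := by
  simp [koszulSign]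

end FinsetSucc

section Cone

variable {k : Type*} [Field k] {n : ℕ} {M : Type*} [AddCommGroup M] [Module k M]
  [Module (MvPolynomial (Fin (n + 1)) k) M] [IsScalarTower k (MvPolynomial (Fin (n + 1)) k) M]
  {E : Type*} [AddCommGroup E] [Module k E]
  [Module (MvPolynomial (Fin n) k) E] [IsScalarTower k (MvPolynomial (Fin n) k) E]

/-- The components `e_s`, `0 ∉ s`, of an element of the Koszul complex. -/
def coneFst (χ : M ≃ₗ[k] E) (f : Finset (Fin (n + 1)) → M) (s : Finset (Fin n)) : E :=
  χ (f (succSet s))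

/-- The components `e_s`, `0 ∈ s`, of an element of the Koszul complex. -/
def coneSnd (χ : M ≃ₗ[k] E) (f : Finset (Fin (n + 1)) → M) (s : Finset (Fin n)) : E :=
  χ (f (insert 0 (succSet s)))

/-- The element of the Koszul complex with given components. -/
def coneMk (χ : M ≃ₗ[k] E) (u v : Finset (Fin n) → E) (t : Finset (Fin (n + 1))) : M :=
  if 0 ∈ t then χ.symm (v (predSet t)) else χ.symm (u (predSet t))

variable {χ : M ≃ₗ[k] E}

@[simp] theorem coneFst_coneMk (u v : Finset (Fin n) → E) : coneFst χ (coneMk χ u v) = u := by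
  funext s; simp [coneFst, coneMk]

@[simp] theorem coneSnd_coneMk (u v : Finset (Fin n) → E) : coneSnd χ (coneMk χ u v) = v := by
  funext s; simp [coneSnd, coneMk]

theorem cone_ext {f g : Finset (Fin (n + 1)) → M} (h0 : coneFst χ f = coneFst χ g)
    (h1 : coneSnd χ f = coneSnd χ g) : f = g := by
  funext t
  by_cases ht : 0 ∈ t
  · have := congrFun h1 (predSet t)
    rwa [coneSnd, coneSnd, insert_succSet_predSet ht, χ.injective.eq_iff] at this
  · have := congrFun h0 (predSet t)
    rwa [coneFst, coneFst, succSet_predSet ht, χ.injective.eq_iff] at this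

variable {ξ : E →ₗ[MvPolynomial (Fin n) k] E}

/-- As 0 is the least index, contraction with it has sign +1 and feeds the components containing 0
into those without. With `coneSnd_koszulD` the differential is triangular with diagonal entries d
and -d, that is, a mapping cone of ξ. -/
theorem coneFst_koszulD (h0 : ∀ x, χ ((X 0 : MvPolynomial (Fin (n + 1)) k) • x) = ξ (χ x))
    (hs : ∀ i : Fin n, ∀ x, χ ((X i.succ : MvPolynomial (Fin (n + 1)) k) • x) =
      (X i : MvPolynomial (Fin n) k) • χ x) (f : Finset (Fin (n + 1)) → M) :
    coneFst χ (koszulDk k (n + 1) M f) =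
      koszulDk k n E (coneFst χ f) + koszulMap ξ (coneSnd χ f) := by
  funext s
  change χ (koszulD k (n + 1) M f _) = koszulD k n E (coneFst χ f) s + ξ (coneSnd χ f s)
  rw [koszulD_eq_sum, koszulD_eq_sum, Finset.sum_apply, Finset.sum_apply, Fin.sum_univ_succ,
    map_add, map_sum, add_comm]
  congr 1
  · refine Finset.sum_congr rfl fun i _ => ?_
    rw [Pi.smul_apply, hs, Pi.smul_apply, koszulContract_apply, koszulContract_apply]
    congr 1
    by_cases hi : i ∈ s
    · simp [hi]
    · simp [hi, koszulSign_succSet, coneFst, succSet_insert]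
  · rw [Pi.smul_apply, h0, koszulContract_apply]
    simp [koszulSign_zero, coneSnd]

/-- The sign arises because contraction with a positive index passes the basis vector e_0. -/
theorem coneSnd_koszulD
    (hs : ∀ i : Fin n, ∀ x, χ ((X i.succ : MvPolynomial (Fin (n + 1)) k) • x) =
      (X i : MvPolynomial (Fin n) k) • χ x) (f : Finset (Fin (n + 1)) → M) :
    coneSnd χ (koszulDk k (n + 1) M f) = -koszulDk k n E (coneSnd χ f) := by
  funext s
  change χ (koszulD k (n + 1) M f _) = -koszulD k n E (coneSnd χ f) s
  rw [koszulD_eq_sum, koszulD_eq_sum, Finset.sum_apply, Finset.sum_apply, Fin.sum_univ_succ,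
    map_add, map_sum, ← Finset.sum_neg_distrib]
  rw [Pi.smul_apply, koszulContract_apply]
  simp only [Finset.mem_insert_self, if_true, smul_zero, map_zero, zero_add]
  refine Finset.sum_congr rfl fun i _ => ?_
  rw [Pi.smul_apply, hs, Pi.smul_apply, koszulContract_apply, koszulContract_apply, ← smul_neg]
  congr 1
  by_cases hi : i ∈ s
  · simp [hi]
  · simp [hi, koszulSign_insert, koszulSign_succSet, coneSnd, succSet_insert, Fin.succ_ne_zero,
      Finset.insert_comm i.succ 0]

theorem coneMk_mem_chain {Mdeg : ℤ → Submodule k M} {Edeg : ℤ → Submodule k E}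
    (hdeg : ∀ m x, χ x ∈ Edeg m ↔ x ∈ Mdeg m) {p p' q : ℤ} (hp : p = p' + 1)
    {u v : Finset (Fin n) → E} :
    coneMk χ u v ∈ koszulChain (n + 1) Mdeg p q ↔
      u ∈ koszulChain n Edeg p q ∧ v ∈ koszulChain n Edeg p' q := by
  simp only [mem_koszulChain]
  constructor
  · intro h
    refine ⟨fun s => ?_, fun s => ?_⟩
    · have := h (succSet s)
      simp only [coneMk, zero_notMem_succSet, if_false, predSet_succSet, card_succSet,
        ← hdeg, χ.apply_symm_apply, LinearEquiv.map_eq_zero_iff] at this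
      exact this
    · have := h (insert 0 (succSet s))
      simp only [coneMk, Finset.mem_insert_self, if_true, predSet_insert_zero, predSet_succSet,
        Finset.card_insert_of_notMem (zero_notMem_succSet s), card_succSet,
        ← hdeg, χ.apply_symm_apply, LinearEquiv.map_eq_zero_iff] at this
      exact ⟨fun hs => this.1 (by push_cast; omega), fun hs => this.2 (by push_cast; omega)⟩
  · rintro ⟨h0, h1⟩ t
    by_cases ht : 0 ∈ t
    · have hc : t.card = (predSet t).card + 1 := by
        conv_lhs => rw [← insert_succSet_predSet ht]
        rw [Finset.card_insert_of_notMem (zero_notMem_succSet _), card_succSet]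
      have := h1 (predSet t)
      simp only [coneMk, ht, if_true, ← hdeg, χ.apply_symm_apply, LinearEquiv.map_eq_zero_iff]
      exact ⟨fun hs => this.1 (by omega), fun hs => this.2 (by omega)⟩
    · have hc : t.card = (predSet t).card := by
        conv_lhs => rw [← succSet_predSet ht]
        rw [card_succSet]
      have := h0 (predSet t)
      simp only [coneMk, ht, if_false, ← hdeg, χ.apply_symm_apply, LinearEquiv.map_eq_zero_iff, hc]
      exact this

theorem coneMk_fst_snd (f : Finset (Fin (n + 1)) → M) :
    coneMk χ (coneFst χ f) (coneSnd χ f) = f :=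
  cone_ext (χ := χ) (by simp) (by simp)

/-- The inclusion of the subcomplex of the mapping cone. -/
def coneInl (χ : M ≃ₗ[k] E) : (Finset (Fin n) → E) →ₗ[k] (Finset (Fin (n + 1)) → M) where
  toFun u := coneMk χ u 0
  map_add' u v := by funext t; by_cases h : 0 ∈ t <;> simp [coneMk, h]
  map_smul' a u := by funext t; by_cases h : 0 ∈ t <;> simp [coneMk, h]

/-- The projection of the mapping cone to the quotient complex. -/
def coneProj (χ : M ≃ₗ[k] E) : (Finset (Fin (n + 1)) → M) →ₗ[k] (Finset (Fin n) → E) where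
  -- The sign absorbs the -d of `coneSnd_koszulD` and makes the projection a chain map.
  toFun f s := (-1 : ℤ) ^ s.card • coneSnd χ f s
  map_add' u v := by funext t; simp [coneSnd]
  map_smul' a u := by
    funext t
    simp only [coneSnd, Pi.smul_apply, map_smul, RingHom.id_apply]
    rw [smul_comm]

theorem coneProj_apply (f : Finset (Fin (n + 1)) → M) (s : Finset (Fin n)) :
    coneProj χ f s = (-1 : ℤ) ^ s.card • coneSnd χ f s := rfl

/-- Let `M` be a graded module over `k[x_0, …, x_n]` and `E` the same module, considered over
`k[x_1, …, x_n]`, with the multiplication `ξ` by `x_0`. Then there are short exact sequences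
`0 → coker (ξ on Tor_p(E)) → Tor_p(M) → ker (ξ on Tor_{p-1}(E)) → 0`. -/
theorem finrank_tor_cone {Mdeg : ℤ → Submodule k M} {Edeg : ℤ → Submodule k E}
    [∀ q, FiniteDimensional k (Mdeg q)] [∀ q, FiniteDimensional k (Edeg q)]
    (hM : IsGradedFamily (n := n + 1) Mdeg)
    (h0 : ∀ x, χ ((X 0 : MvPolynomial (Fin (n + 1)) k) • x) = ξ (χ x))
    (hs : ∀ i : Fin n, ∀ x, χ ((X i.succ : MvPolynomial (Fin (n + 1)) k) • x) =
      (X i : MvPolynomial (Fin n) k) • χ x) (hdeg : ∀ m x, χ x ∈ Edeg m ↔ x ∈ Mdeg m)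
    (hξ : IsHomogeneousMap Edeg Edeg 1 ξ) {p p' : ℤ} (hp : p = p' + 1) {q q₀ q₁ : ℤ}
    (hq : q = q₀ + 1) (hq₁ : q₁ = q + 1) :
    Module.finrank k (KoszulTor (n + 1) Mdeg p q) +
      Module.finrank k (LinearMap.range (torMap hξ p hq)) =
      Module.finrank k (KoszulTor n Edeg p q) +
        Module.finrank k (LinearMap.ker (torMap hξ p' hq₁)) := by
  subst hp
  have hD0 := coneFst_koszulD (χ := χ) h0 hs
  have hD1 := coneSnd_koszulD (χ := χ) hs
  have hfst : ∀ {f p'' q}, f ∈ koszulChain (n + 1) Mdeg (p'' + 1) q →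
      coneFst χ f ∈ koszulChain n Edeg (p'' + 1) q := fun {f p'' q} hf =>
    ((coneMk_mem_chain hdeg rfl).1 (by rwa [coneMk_fst_snd])).1
  have hsnd : ∀ {f p'' q}, f ∈ koszulChain (n + 1) Mdeg (p'' + 1) q →
      coneSnd χ f ∈ koszulChain n Edeg p'' q := fun {f p'' q} hf =>
    ((coneMk_mem_chain hdeg rfl).1 (by rwa [coneMk_fst_snd])).2
  have hinlD : ∀ u, coneInl χ (koszulDk k n E u) = koszulDk k (n + 1) M (coneInl χ u) := by
    intro u
    refine cone_ext (χ := χ) ?_ ?_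
    · rw [hD0]; simp [coneInl]
    · rw [hD1]; simp [coneInl]
  have hinl : ∀ (p'' q : ℤ), ∀ u ∈ koszulChain n Edeg (p'' + 1) q,
      coneInl χ u ∈ koszulChain (n + 1) Mdeg (p'' + 1) q :=
    fun p'' q u hu => (coneMk_mem_chain hdeg rfl).2 ⟨hu, zero_mem _⟩
  have hprojD : ∀ f, coneProj χ (koszulDk k (n + 1) M f) = koszulDk k n E (coneProj χ f) := by
    intro f
    funext s
    change _ = koszulD k n E (coneProj χ f) s
    rw [coneProj_apply, hD1, Pi.neg_apply]
    change _ • -koszulD k n E (coneSnd χ f) s = _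
    rw [koszulD_apply, koszulD_apply, smul_neg, Finset.smul_sum, ← Finset.sum_neg_distrib]
    refine Finset.sum_congr rfl fun i hi => ?_
    rw [coneProj_apply, Finset.card_insert_of_notMem (Finset.mem_compl.1 hi), smul_comm (X i) _ _,
      smul_smul, smul_smul, ← neg_smul]
    congr 1
    ring
  have hproj : ∀ (p'' q : ℤ), ∀ f ∈ koszulChain (n + 1) Mdeg (p'' + 1) q,
      coneProj χ f ∈ koszulChain n Edeg p'' q := by
    intro p'' q f hf
    have := mem_koszulChain.1 (hsnd hf)
    exact mem_koszulChain.2 fun s => ⟨fun h => zsmul_mem ((this s).1 h) _,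
      fun h => by rw [coneProj_apply, (this s).2 h, smul_zero]⟩
  have hinlinj : Function.Injective (coneInl (n := n) χ) := fun u v huv => by
    have := congrArg (coneFst χ) huv
    change coneFst χ (coneMk χ u 0) = coneFst χ (coneMk χ v 0) at this
    rwa [coneFst_coneMk (n := n), coneFst_coneMk (n := n)] at this
  have hpi : ∀ u : Finset (Fin n) → E, coneProj (n := n) χ (coneInl (n := n) χ u) = 0 := by
    intro u; funext s; rw [coneProj_apply]; simp [coneInl]
  let F := homologyMap (coneInl χ) hinlD (hinl (p' + 1) (q - 1)) (hinl p' q)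
  let G := homologyMap (coneProj χ) hprojD (hproj (p' + 1) (q - 1)) (hproj p' q)
  have hex : Function.Exact F G := by
    apply homology_exact
    · exact hinlinj
    · exact hpi
    · exact koszulDk_koszulDk
    · exact fun _ hv => koszulD_mem_chain hM rfl (by omega) hv
    · intro f hf hf0
      have h1 : coneSnd χ f = 0 := by
        funext s
        have := congrFun hf0 s
        rw [coneProj_apply] at this
        rcases neg_one_pow_eq_or ℤ s.card with h | h <;> simpa [h] using this
      exact ⟨coneFst χ f, hfst hf, by rw [coneInl]; change coneMk χ _ 0 = f
                                      rw [← h1, coneMk_fst_snd]⟩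
    · intro c hc
      refine ⟨coneMk χ 0 (fun s => (-1 : ℤ) ^ s.card • c s),
        (coneMk_mem_chain hdeg rfl).2 ⟨zero_mem _, ?_⟩, ?_⟩
      · have := mem_koszulChain.1 hc
        exact mem_koszulChain.2 fun s => ⟨fun h => zsmul_mem ((this s).1 h) _,
          fun h => by rw [(this s).2 h, smul_zero]⟩
      · funext s
        rw [coneProj_apply, coneSnd_coneMk, smul_smul, ← mul_pow]
        simp
  -- A class of E dies in the cone exactly when its cycle is d u + ξ v with v a cycle, so the kernel
  -- is the image of ξ.
  have hF : LinearMap.ker F = LinearMap.range (torMap hξ (p' + 1) hq) := by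
    ext x
    constructor
    · intro hx
      obtain ⟨z, hz, hd, rfl⟩ := exists_homologyClass x
      rw [LinearMap.mem_ker, homologyMap_class, homologyClass_eq_zero] at hx
      obtain ⟨y, hy, hyz⟩ := hx
      have e0 : koszulDk k n E (coneFst χ y) + koszulMap ξ (coneSnd χ y) = z := by
        rw [← hD0, hyz]; simp [coneInl]
      have e1 : koszulDk k n E (coneSnd χ y) = 0 := by
        rw [← neg_eq_zero, ← hD1, hyz]; simp [coneInl]
      have hq0 : q - 1 = q₀ := by omega
      refine ⟨homologyClass _ _ _ (coneSnd χ y) (hq0 ▸ hsnd hy) e1, ?_⟩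
      rw [torMap_class, homologyClass_eq]
      exact ⟨-coneFst χ y, neg_mem (hfst hy), by rw [map_neg, ← e0]; abel⟩
    · rintro ⟨w, rfl⟩
      obtain ⟨z, hz, hd, rfl⟩ := exists_homologyClass w
      rw [torMap_class, LinearMap.mem_ker, homologyMap_class, homologyClass_eq_zero]
      have hq0 : q₀ = q - 1 := by omega
      refine ⟨coneMk χ 0 z, (coneMk_mem_chain hdeg rfl).2 ⟨zero_mem _, hq0 ▸ hz⟩, ?_⟩
      refine cone_ext (χ := χ) ?_ ?_
      · rw [hD0]; simp [coneInl]
      · rw [hD1]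
        simp only [coneSnd_coneMk, hd]
        simp [coneInl]
  -- A cycle z of E completes to a cycle (u, z) of the cone exactly when ξ z is a boundary.
  have hG : LinearMap.range G = LinearMap.ker (torMap hξ p' hq₁) := by
    ext x
    constructor
    · rintro ⟨y, rfl⟩
      obtain ⟨z, hz, hd, rfl⟩ := exists_homologyClass y
      rw [homologyMap_class, LinearMap.mem_ker, torMap_class, homologyClass_eq_zero]
      have e0 : koszulDk k n E (coneFst χ z) + koszulMap ξ (coneSnd χ z) = 0 := by
        rw [← hD0, hd]; funext s; simp [coneFst]
      have hq0 : q = q₁ - 1 := by omega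
      have hc := mem_koszulChain.1 (hsnd hz)
      have hz' := mem_koszulChain.1 (koszulD_mem_chain hM rfl hq₁ hz)
      -- On sets of cardinality p' the sign of `coneProj` is the constant (-1)^{p'}; elsewhere the
      -- chain is zero, so the value of `toNat` at a negative p' is irrelevant.
      refine ⟨(-(-1 : ℤ) ^ p'.toNat) • coneFst χ z, zsmul_mem (hq0 ▸ hfst hz) _, ?_⟩
      rw [map_zsmul, eq_neg_of_add_eq_zero_left e0, smul_neg, neg_smul, neg_neg]
      funext s
      rw [Pi.smul_apply, koszulMap_apply, koszulMap_apply, coneProj_apply, map_zsmul]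
      by_cases hs : (s.card : ℤ) = p'
      · congr 2; omega
      · rw [(hc s).2 hs]; simp
    · intro hx
      obtain ⟨z, hz, hd, rfl⟩ := exists_homologyClass x
      rw [LinearMap.mem_ker, torMap_class, homologyClass_eq_zero] at hx
      obtain ⟨u, hu, huz⟩ := hx
      have hq0 : q₁ - 1 = q := by omega
      let ε : ℤ := (-1 : ℤ) ^ p'.toNat
      refine ⟨homologyClass _ _ _ (coneMk χ (-ε • u) (ε • z))
        ((coneMk_mem_chain hdeg rfl).2 ⟨zsmul_mem (hq0 ▸ hu) _, zsmul_mem hz _⟩) ?_, ?_⟩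
      · refine cone_ext (χ := χ) ?_ ?_
        · rw [hD0, coneFst_coneMk, coneSnd_coneMk, map_zsmul, map_zsmul, huz]
          funext s
          simp [coneFst]
        · rw [hD1, coneSnd_coneMk, map_zsmul, hd]
          funext s
          simp [coneSnd]
      · rw [homologyMap_class]
        congr 1
        funext s
        rw [coneProj_apply, coneSnd_coneMk, Pi.smul_apply, smul_smul]
        by_cases hs : (s.card : ℤ) = p'
        · have : s.card = p'.toNat := by omega
          rw [this, ← mul_pow]; simp
        · rw [(mem_koszulChain.1 hz s).2 hs, smul_zero]
  have h1 := LinearMap.finrank_range_add_finrank_ker F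
  have h2 := LinearMap.finrank_range_add_finrank_ker G
  have h3 : LinearMap.ker G = LinearMap.range F := hex.linearMap_ker_eq
  rw [hF] at h1
  rw [hG, h3] at h2
  linarith

end Cone

/-! ### Linear coordinate changes -/

section LinSub

variable {k : Type*} [Field k] {n : ℕ}

/-- The linear substitution `x_i ↦ ∑_j a_{ij} x_j`. -/
def linSub (A : Matrix (Fin n) (Fin n) k) :
    MvPolynomial (Fin n) k →ₐ[k] MvPolynomial (Fin n) k :=
  aeval fun i => ∑ j, C (A i j) * X j

theorem linSub_X (A : Matrix (Fin n) (Fin n) k) (i : Fin n) :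
    linSub A (X i) = ∑ j, C (A i j) * X j := by rw [linSub, aeval_X]

theorem linSub_comp (A B : Matrix (Fin n) (Fin n) k) :
    (linSub B).comp (linSub A) = linSub (A * B) := by
  refine algHom_ext fun i => ?_
  simp only [AlgHom.comp_apply, linSub_X, map_sum, map_mul, Matrix.mul_apply, algHom_C,
    MvPolynomial.algebraMap_eq, Finset.mul_sum, Finset.sum_mul]
  rw [Finset.sum_comm]
  simp only [mul_assoc]

theorem linSub_one : linSub (1 : Matrix (Fin n) (Fin n) k) = AlgHom.id k _ := by
  refine algHom_ext fun i => ?_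
  rw [linSub_X, Finset.sum_eq_single i]
  · simp
  · intro j _ hj; simp [Matrix.one_apply_ne' hj]
  · simp

theorem linSub_linSub (A B : Matrix (Fin n) (Fin n) k) (f : MvPolynomial (Fin n) k) :
    linSub B (linSub A f) = linSub (A * B) f := by
  rw [← linSub_comp]; rfl

/-- The linear substitution with an invertible matrix as an automorphism. -/
def linSubEquiv (A : Matrix (Fin n) (Fin n) k) (hA : A.det ≠ 0) :
    MvPolynomial (Fin n) k ≃ₐ[k] MvPolynomial (Fin n) k :=
  AlgEquiv.ofAlgHom (linSub A) (linSub A⁻¹)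
    (by rw [linSub_comp, Matrix.nonsing_inv_mul _ (isUnit_iff_ne_zero.2 hA), linSub_one])
    (by rw [linSub_comp, Matrix.mul_nonsing_inv _ (isUnit_iff_ne_zero.2 hA), linSub_one])

theorem linSub_isHomogeneous (A : Matrix (Fin n) (Fin n) k) {f : MvPolynomial (Fin n) k} {m : ℕ}
    (hf : f.IsHomogeneous m) : (linSub A f).IsHomogeneous m := by
  have := hf.aeval (fun i => ∑ j, C (A i j) * X j) (n := 1)
    fun i => IsHomogeneous.sum _ _ _ fun j _ => isHomogeneous_C_mul_X _ _
  rwa [one_mul] at this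

theorem mem_homPart {m : ℤ} {f : MvPolynomial (Fin n) k} :
    f ∈ homPart k n m ↔ (0 ≤ m → f.IsHomogeneous m.toNat) ∧ (m < 0 → f = 0) := by
  rw [homPart]
  split_ifs with h
  · rw [mem_homogeneousSubmodule]
    exact ⟨fun h' => ⟨fun _ => h', fun h'' => absurd h (not_le.2 h'')⟩, fun h' => h'.1 h⟩
  · rw [Submodule.mem_bot]
    exact ⟨fun h' => ⟨fun h'' => absurd h'' h, fun _ => h'⟩, fun h' => h'.2 (not_le.1 h)⟩

theorem mem_homPart_natCast {m : ℕ} {f : MvPolynomial (Fin n) k} :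
    f ∈ homPart k n m ↔ f.IsHomogeneous m := by
  simp [homPart]

theorem linSub_mem_homPart (A : Matrix (Fin n) (Fin n) k) {f : MvPolynomial (Fin n) k} {m : ℤ}
    (hf : f ∈ homPart k n m) : linSub A f ∈ homPart k n m := by
  rw [mem_homPart] at hf ⊢
  exact ⟨fun h => linSub_isHomogeneous A (hf.1 h), fun h => by rw [hf.2 h, map_zero]⟩

theorem changeCoords_eq {N : ℕ} (g : GL (Fin (N + 1)) k) (I : Ideal (MvPolynomial (Fin (N + 1)) k)) :
    changeCoords g I = I.map (linSub g.val) := rfl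

end LinSub

/-! ### Koszul homology under elementary linear substitutions -/

section CoordinateInvariance

variable {k : Type*} [Field k] {n : ℕ} {M : Type*} [AddCommGroup M] [Module k M]
  [Module (MvPolynomial (Fin n) k) M] [IsScalarTower k (MvPolynomial (Fin n) k) M]
  {M' : Type*} [AddCommGroup M'] [Module k M']
  [Module (MvPolynomial (Fin n) k) M'] [IsScalarTower k (MvPolynomial (Fin n) k) M']

/-- The isomorphism of complexes need not come from a map of modules: a coordinate change also has
to move the basis vectors e_s. -/
theorem gradedBetti_eq_of_chain_equiv {Mdeg : ℤ → Submodule k M} {M'deg : ℤ → Submodule k M'}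
    (Ψ : (Finset (Fin n) → M) ≃ₗ[k] (Finset (Fin n) → M'))
    (hΨ : ∀ f, Ψ (koszulDk k n M f) = koszulDk k n M' (Ψ f))
    (h : ∀ p q, ∀ f ∈ koszulChain n Mdeg p q, Ψ f ∈ koszulChain n M'deg p q)
    (h' : ∀ p q, ∀ f ∈ koszulChain n M'deg p q, Ψ.symm f ∈ koszulChain n Mdeg p q) (p q : ℤ) :
    gradedBetti n Mdeg p q = gradedBetti n M'deg p q := by
  have hΨ' : ∀ f, Ψ.symm (koszulDk k n M' f) = koszulDk k n M (Ψ.symm f) := by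
    intro f
    rw [LinearEquiv.symm_apply_eq, hΨ, Ψ.apply_symm_apply]
  rw [gradedBetti_eq, gradedBetti_eq]
  refine LinearEquiv.finrank_eq (LinearEquiv.ofLinearMap
    (homologyMap Ψ.toLinearMap hΨ (h _ _) (h _ _))
    (homologyMap Ψ.symm.toLinearMap hΨ' (h' _ _) (h' _ _)) ?_ ?_)
  · refine LinearMap.ext fun x => ?_
    obtain ⟨z, hz, hd, rfl⟩ := exists_homologyClass x
    rw [LinearMap.comp_apply, homologyMap_class, homologyMap_class]
    congr 1
    exact Ψ.apply_symm_apply z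
  · refine LinearMap.ext fun x => ?_
    obtain ⟨z, hz, hd, rfl⟩ := exists_homologyClass x
    rw [LinearMap.comp_apply, homologyMap_class, homologyMap_class]
    congr 1
    exact Ψ.symm_apply_apply z

/-- The operator `1 + c e_j ι_i` on the Koszul complex. -/
def koszulTransvection (i j : Fin n) (c : k) : (Finset (Fin n) → M) →ₗ[k] (Finset (Fin n) → M) :=
  LinearMap.id + c • (koszulWedge k M j ∘ₗ koszulContract k M i).restrictScalars k

theorem koszulTransvection_apply (i j : Fin n) (c : k) (f : Finset (Fin n) → M) :
    koszulTransvection i j c f = f + c • koszulWedge k M j (koszulContract k M i f) := rfl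

theorem koszulContract_contract_self (i : Fin n) (f : Finset (Fin n) → M) :
    koszulContract k M i (koszulContract k M i f) = 0 := by
  funext s
  simp [koszulContract_apply]

/-- For i ≠ j the operator e_j ι_i squares to zero, because ι_i anticommutes with e_j and ι_i² = 0.
-/
theorem koszulTransvection_neg {i j : Fin n} (hij : i ≠ j) (c : k) (f : Finset (Fin n) → M) :
    koszulTransvection i j (-c) (koszulTransvection i j c f) = f := by
  have : koszulContract k M i (koszulWedge k M j (koszulContract k M i f)) = 0 := by
    rw [koszulContract_wedge hij, koszulContract_contract_self, map_zero, neg_zero]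
  simp only [koszulTransvection_apply, map_add, LinearMap.map_smul_of_tower, this, smul_zero,
    map_zero, add_zero, neg_smul]
  abel

theorem koszulWedge_contract_mem_chain {Mdeg : ℤ → Submodule k M} {p q : ℤ} (i j : Fin n)
    {f : Finset (Fin n) → M} (hf : f ∈ koszulChain n Mdeg p q) :
    koszulWedge k M j (koszulContract k M i f) ∈ koszulChain n Mdeg p q := by
  rw [mem_koszulChain] at hf ⊢
  intro s
  rw [koszulWedge_apply, koszulContract_apply]
  by_cases hj : j ∈ s <;> by_cases hi : i ∈ s.erase j <;>
    simp only [hj, hi, if_true, if_false, smul_zero, zero_mem, implies_true, and_self]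
  have hc : (insert i (s.erase j)).card = s.card := by
    rw [Finset.card_insert_of_notMem hi, Finset.card_erase_add_one hj]
  have := hf (insert i (s.erase j))
  rw [hc] at this
  exact ⟨fun hs => zsmul_mem (zsmul_mem (this.1 hs) _) _, fun hs => by
    rw [this.2 hs, smul_zero, smul_zero]⟩

theorem koszulTransvection_mem_chain {Mdeg : ℤ → Submodule k M} {p q : ℤ} (i j : Fin n) (c : k)
    {f : Finset (Fin n) → M} (hf : f ∈ koszulChain n Mdeg p q) :
    koszulTransvection i j c f ∈ koszulChain n Mdeg p q :=
  add_mem hf (Submodule.smul_mem _ c (koszulWedge_contract_mem_chain i j hf))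

theorem koszulContract_compLeft (φ : M →ₗ[k] M') (i : Fin n) (f : Finset (Fin n) → M) :
    φ.compLeft _ (koszulContract k M i f) = koszulContract k M' i (φ.compLeft _ f) := by
  funext s
  simp only [LinearMap.compLeft_apply, Function.comp_apply, koszulContract_apply]
  split_ifs
  · exact map_zero _
  · exact map_zsmul _ _ _

/-- The map φ carries d to d + c x_j ι_i. The commutator of d with e_j ι_i is x_j ι_i by
`koszulD_wedge` and `koszulD_contract`, and ι_i² = 0, so composing with 1 + c e_j ι_i removes the
extra term. -/
theorem koszulD_transvection {φ : M →ₗ[k] M'} {i j : Fin n} (c : k)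
    (hφ : ∀ a, a ≠ i → ∀ x, φ ((X a : MvPolynomial (Fin n) k) • x) =
      (X a : MvPolynomial (Fin n) k) • φ x)
    (hφi : ∀ x, φ ((X i : MvPolynomial (Fin n) k) • x) =
      (X i : MvPolynomial (Fin n) k) • φ x + c • (X j : MvPolynomial (Fin n) k) • φ x)
    (f : Finset (Fin n) → M) :
    koszulTransvection i j c (φ.compLeft _ (koszulD k n M f)) =
      koszulD k n M' (koszulTransvection i j c (φ.compLeft _ f)) := by
  have h1 : φ.compLeft _ (koszulD k n M f) = koszulD k n M' (φ.compLeft _ f) +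
      c • (X j : MvPolynomial (Fin n) k) • koszulContract k M' i (φ.compLeft _ f) := by
    rw [koszulD_eq_sum, koszulD_eq_sum, map_sum, ← Finset.add_sum_erase _ _ (Finset.mem_univ i),
      ← Finset.add_sum_erase (Finset.univ) (fun i => (X i : MvPolynomial (Fin n) k) • _)
        (Finset.mem_univ i), add_right_comm]
    congr 1
    · rw [← koszulContract_compLeft]
      funext s
      exact hφi _
    · refine Finset.sum_congr rfl fun a ha => ?_
      rw [← koszulContract_compLeft]
      funext s
      exact hφ a (Finset.ne_of_mem_erase ha) _
  generalize φ.compLeft _ f = u at h1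
  rw [h1]
  simp only [koszulTransvection_apply, map_add, LinearMap.map_smul_of_tower, map_smul,
    koszulContract_contract_self, smul_zero, map_zero, add_zero, koszulD_wedge, koszulD_contract,
    map_neg, sub_neg_eq_add, smul_add]
  abel

theorem gradedBetti_transvection {Mdeg : ℤ → Submodule k M} {M'deg : ℤ → Submodule k M'}
    (φ : M ≃ₗ[k] M') (hdeg : ∀ m x, φ x ∈ M'deg m ↔ x ∈ Mdeg m) {i j : Fin n} (hij : i ≠ j) (c : k)
    (hφ : ∀ a, a ≠ i → ∀ x, φ ((X a : MvPolynomial (Fin n) k) • x) =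
      (X a : MvPolynomial (Fin n) k) • φ x)
    (hφi : ∀ x, φ ((X i : MvPolynomial (Fin n) k) • x) =
      (X i : MvPolynomial (Fin n) k) • φ x + c • (X j : MvPolynomial (Fin n) k) • φ x) (p q : ℤ) :
    gradedBetti n Mdeg p q = gradedBetti n M'deg p q := by
  let Ψ : (Finset (Fin n) → M) ≃ₗ[k] (Finset (Fin n) → M') := LinearEquiv.ofLinearMap
    (koszulTransvection i j c ∘ₗ φ.toLinearMap.compLeft _)
    (φ.symm.toLinearMap.compLeft _ ∘ₗ koszulTransvection i j (-c))
    (by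
      refine LinearMap.ext fun f => ?_
      have : ∀ u, φ.toLinearMap.compLeft (Finset (Fin n)) (φ.symm.toLinearMap.compLeft _ u) = u :=
        fun u => _root_.funext fun s => φ.apply_symm_apply _
      simp only [LinearMap.comp_apply, this, LinearMap.id_apply]
      have h := koszulTransvection_neg (M := M') hij (-c) f
      rwa [neg_neg] at h)
    (by
      refine LinearMap.ext fun f => ?_
      have : ∀ u, φ.symm.toLinearMap.compLeft (Finset (Fin n)) (φ.toLinearMap.compLeft _ u) = u :=
        fun u => _root_.funext fun s => φ.symm_apply_apply _
      simp only [LinearMap.comp_apply, koszulTransvection_neg hij, this, LinearMap.id_apply])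
  refine gradedBetti_eq_of_chain_equiv Ψ (koszulD_transvection c hφ hφi) ?_ ?_ p q
  · intro p q f hf
    refine koszulTransvection_mem_chain i j c ?_
    rw [mem_koszulChain] at hf ⊢
    exact fun s => ⟨fun hs => (hdeg _ _).2 ((hf s).1 hs),
      fun hs => (map_eq_zero_iff φ φ.injective).2 ((hf s).2 hs)⟩
  · intro p q f hf
    have := koszulTransvection_mem_chain i j (-c) hf
    rw [mem_koszulChain] at this ⊢
    exact fun s => ⟨fun hs => (hdeg _ _).1 (by
        change φ (φ.symm _) ∈ _; rw [φ.apply_symm_apply]; exact (this s).1 hs),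
      fun hs => (map_eq_zero_iff φ.symm φ.symm.injective).2 ((this s).2 hs)⟩

/-- Rescaling e_s by the product of the c_a with a ∈ s compensates the rescaling of the variables.
-/
theorem gradedBetti_diagonal {Mdeg : ℤ → Submodule k M} {M'deg : ℤ → Submodule k M'}
    (φ : M ≃ₗ[k] M') (hdeg : ∀ m x, φ x ∈ M'deg m ↔ x ∈ Mdeg m) (c : Fin n → k)
    (hc : ∀ i, c i ≠ 0)
    (hφ : ∀ a x, φ ((X a : MvPolynomial (Fin n) k) • x) =
      c a • (X a : MvPolynomial (Fin n) k) • φ x) (p q : ℤ) :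
    gradedBetti n Mdeg p q = gradedBetti n M'deg p q := by
  have hP : ∀ s : Finset (Fin n), ∏ a ∈ s, c a ≠ 0 := fun s => Finset.prod_ne_zero_iff.2 fun a _ => hc a
  let Ψ : (Finset (Fin n) → M) ≃ₗ[k] (Finset (Fin n) → M') :=
    LinearEquiv.piCongrRight fun s =>
      φ.trans (LinearEquiv.smulOfUnit (Units.mk0 (∏ a ∈ s, c a) (hP s)))
  have hΨ : ∀ f s, Ψ f s = (∏ a ∈ s, c a) • φ (f s) := fun f s => rfl
  have hdeg' : ∀ f s q, Ψ f s ∈ M'deg q ↔ f s ∈ Mdeg q := fun f s q => by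
    rw [hΨ, Submodule.smul_mem_iff _ (hP s), hdeg]
  have hzero : ∀ f s, Ψ f s = 0 ↔ f s = 0 := fun f s => by
    rw [hΨ, smul_eq_zero_iff_right (hP s), map_eq_zero_iff φ φ.injective]
  have hmem : ∀ p q f, Ψ f ∈ koszulChain n M'deg p q ↔ f ∈ koszulChain n Mdeg p q := fun p q f => by
    simp only [mem_koszulChain, hdeg', hzero]
  refine gradedBetti_eq_of_chain_equiv Ψ ?_ (fun p q f hf => (hmem p q f).2 hf)
    (fun p q f hf => (hmem p q _).1 (by rwa [Ψ.apply_symm_apply])) p q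
  intro f
  funext s
  rw [hΨ]
  change _ • φ (koszulD k n M f s) = koszulD k n M' (Ψ f) s
  rw [koszulD_apply, koszulD_apply, map_sum, Finset.smul_sum]
  refine Finset.sum_congr rfl fun i hi => ?_
  rw [map_zsmul, hφ, hΨ, Finset.prod_insert (Finset.mem_compl.1 hi), smul_comm _ ((-1 : ℤ) ^ _),
    smul_smul, mul_comm, ← smul_comm (_ : k) (X i : MvPolynomial (Fin n) k)]

end CoordinateInvariance

/-! ### Betti numbers of quotient rings under invertible substitutions -/

section IdealInvariance

variable {k : Type*} [Field k] {n : ℕ}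

/-- The graded pieces of `A / I`. -/
abbrev quotDeg (I : Ideal (MvPolynomial (Fin n) k)) (m : ℤ) :
    Submodule k (MvPolynomial (Fin n) k ⧸ I) :=
  (homPart k n m).map (Ideal.Quotient.mkₐ k I).toLinearMap

theorem quotientEquiv_linSub (A : Matrix (Fin n) (Fin n) k) (hA : A.det ≠ 0)
    (I : Ideal (MvPolynomial (Fin n) k)) :
    ∃ φ : (MvPolynomial (Fin n) k ⧸ I) ≃ₗ[k] (MvPolynomial (Fin n) k ⧸ I.map (linSub A)),
      (∀ m x, φ x ∈ quotDeg (I.map (linSub A)) m ↔ x ∈ quotDeg I m) ∧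
      ∀ f : MvPolynomial (Fin n) k, ∀ x, φ (f • x) = linSub A f • φ x := by
  let φ := Ideal.quotientEquivAlg I (I.map (linSub A)) (linSubEquiv A hA) rfl
  have h1 : ∀ f, φ (Ideal.Quotient.mk I f) = Ideal.Quotient.mk _ (linSub A f) := fun f => rfl
  have h2 : ∀ f, φ.symm (Ideal.Quotient.mk _ f) = Ideal.Quotient.mk _ (linSub A⁻¹ f) := fun f => rfl
  refine ⟨φ.toLinearEquiv, fun m x => ⟨?_, ?_⟩, ?_⟩
  · rintro ⟨f, hf, hfx⟩
    refine ⟨linSub A⁻¹ f, linSub_mem_homPart _ hf, ?_⟩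
    have := congrArg φ.symm hfx
    rw [AlgEquiv.toLinearEquiv_apply, AlgEquiv.symm_apply_apply] at this
    rw [← this]
    rfl
  · rintro ⟨f, hf, rfl⟩
    exact ⟨linSub A f, linSub_mem_homPart _ hf, rfl⟩
  · intro f x
    obtain ⟨g, rfl⟩ := Ideal.Quotient.mk_surjective x
    change φ (Ideal.Quotient.mk I (f * g)) = Ideal.Quotient.mk _ (linSub A f * linSub A g)
    rw [h1, map_mul]

/-- The graded Betti numbers do not depend on the coordinates. -/
theorem bettiQuot_map_linSub (A : Matrix (Fin n) (Fin n) k) (hA : A.det ≠ 0)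
    (I : Ideal (MvPolynomial (Fin n) k)) (p q : ℤ) :
    bettiQuot (I.map (linSub A)) p q = bettiQuot I p q := by
  revert I
  -- Invertible matrices are products of diagonal matrices and transvections. The claim is kept for
  -- all ideals because in a product the second factor acts on the image ideal.
  refine Matrix.diagonal_transvection_induction_of_det_ne_zero
    (fun A => ∀ I : Ideal (MvPolynomial (Fin n) k),
      bettiQuot (I.map (linSub A)) p q = bettiQuot I p q) A hA ?_ ?_ ?_
  · intro D hD I
    obtain ⟨φ, hdeg, hφ⟩ := quotientEquiv_linSub _ hD I
    rw [Matrix.det_diagonal] at hD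
    refine (gradedBetti_diagonal φ hdeg D (fun i hi => hD (Finset.prod_eq_zero (Finset.mem_univ i) hi))
      (fun a x => ?_) p q).symm
    rw [hφ, linSub_X, Finset.sum_eq_single a]
    · rw [Matrix.diagonal_apply_eq, ← smul_eq_C_mul, smul_assoc]
    · intro b _ hb; simp [Matrix.diagonal_apply_ne' _ hb]
    · simp
  · intro t I
    have hdet : t.toMatrix.det ≠ 0 := by simp
    obtain ⟨φ, hdeg, hφ⟩ := quotientEquiv_linSub _ hdet I
    have key : ∀ a, linSub t.toMatrix (X a) = X a + if a = t.i then C t.c * X t.j else 0 := by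
      intro a
      rw [linSub_X]
      simp only [Matrix.TransvectionStruct.toMatrix, Matrix.transvection, Matrix.add_apply, map_add,
        add_mul, Finset.sum_add_distrib]
      congr 1
      · rw [Finset.sum_eq_single a]
        · simp
        · intro b _ hb; simp [Matrix.one_apply_ne' hb]
        · simp
      · rw [Finset.sum_eq_single t.j]
        · by_cases h : a = t.i <;> simp [h, eq_comm]
        · intro b _ hb; simp [hb.symm]
        · simp
    refine (gradedBetti_transvection φ hdeg t.hij t.c (fun a ha x => ?_) (fun x => ?_) p q).symm
    · rw [hφ, key, if_neg ha, add_zero]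
    · rw [hφ, key, if_pos rfl, add_smul, ← smul_eq_C_mul, smul_assoc]
  · intro A B _ _ hA hB I
    rw [← linSub_comp, ← hA I, ← hB (I.map (linSub A)), Ideal.map_mapₐ]

end IdealInvariance

/-! ### Projections to graded pieces -/

section GradedProjections

variable {k : Type*} [Field k] {n : ℕ} {M : Type*} [AddCommGroup M] [Module k M]
  [Module (MvPolynomial (Fin n) k) M] [IsScalarTower k (MvPolynomial (Fin n) k) M]

/-- `π q` is the projection to the degree `q` part. -/
structure IsGradedProjection (Mdeg : ℤ → Submodule k M) (π : ℤ → M →ₗ[k] M) : Prop where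
  mem : ∀ q x, π q x ∈ Mdeg q
  self : ∀ q, ∀ x ∈ Mdeg q, π q x = x
  ne : ∀ q q', q ≠ q' → ∀ x ∈ Mdeg q', π q x = 0
  smul : ∀ q (i : Fin n) x, π (q + 1) ((X i : MvPolynomial (Fin n) k) • x) =
    (X i : MvPolynomial (Fin n) k) • π q x

/-- The projection of the Koszul complex to a graded piece. -/
def chainProj (π : ℤ → M →ₗ[k] M) (p q : ℤ) : (Finset (Fin n) → M) →ₗ[k] (Finset (Fin n) → M) where
  toFun f s := if (s.card : ℤ) = p then π q (f s) else 0
  map_add' f g := by funext s; by_cases h : (s.card : ℤ) = p <;> simp [h]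
  map_smul' a f := by funext s; by_cases h : (s.card : ℤ) = p <;> simp [h]

theorem chainProj_apply (π : ℤ → M →ₗ[k] M) (p q : ℤ) (f : Finset (Fin n) → M)
    (s : Finset (Fin n)) : chainProj π p q f s = if (s.card : ℤ) = p then π q (f s) else 0 := rfl

namespace IsGradedProjection

variable {Mdeg : ℤ → Submodule k M} {π : ℤ → M →ₗ[k] M} (h : IsGradedProjection (n := n) Mdeg π)

include h

theorem chainProj_mem (p q : ℤ) (f : Finset (Fin n) → M) :
    chainProj π p q f ∈ koszulChain n Mdeg p q := by
  rw [mem_koszulChain]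
  intro s
  rw [chainProj_apply]
  exact ⟨fun hs => by rw [if_pos hs]; exact h.mem _ _, fun hs => if_neg hs⟩

theorem chainProj_self {p q : ℤ} {f : Finset (Fin n) → M} (hf : f ∈ koszulChain n Mdeg p q) :
    chainProj π p q f = f := by
  rw [mem_koszulChain] at hf
  funext s
  rw [chainProj_apply]
  split_ifs with hs
  · exact h.self _ _ ((hf s).1 hs)
  · exact ((hf s).2 hs).symm

theorem chainProj_ne {p p' q q' : ℤ} (hq : q ≠ q') {f : Finset (Fin n) → M}
    (hf : f ∈ koszulChain n Mdeg p' q') : chainProj π p q f = 0 := by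
  funext s
  rw [chainProj_apply, h.ne q q' hq _ (koszulChain_apply_mem hf s), ite_self, Pi.zero_apply]

theorem koszulD_chainProj {p p' q q' : ℤ} (hp : p = p' + 1) (hq : q' = q + 1)
    (f : Finset (Fin n) → M) :
    koszulDk k n M (chainProj π p q f) = chainProj π p' q' (koszulDk k n M f) := by
  subst hp hq
  funext s
  change koszulD k n M _ s = if _ then π (q + 1) (koszulD k n M f s) else 0
  rw [koszulD_apply, koszulD_apply]
  split_ifs with hs
  · rw [map_sum]
    refine Finset.sum_congr rfl fun i hi => ?_
    rw [map_zsmul, h.smul, chainProj_apply, if_pos]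
    rw [Finset.card_insert_of_notMem (Finset.mem_compl.1 hi)]
    push_cast; omega
  · refine Finset.sum_eq_zero fun i hi => ?_
    rw [chainProj_apply, if_neg, smul_zero, smul_zero]
    rw [Finset.card_insert_of_notMem (Finset.mem_compl.1 hi)]
    push_cast; omega

/-- The Koszul homology of a Noetherian graded module vanishes in large degrees. -/
theorem tor_eventually_zero [IsNoetherian (MvPolynomial (Fin n) k) M] (p : ℤ) :
    ∃ m : ℕ, ∀ q : ℤ, m < q → Subsingleton (KoszulTor n Mdeg p q) := by
  -- Cycles whose (p, q) component is a boundary. They form a submodule over the polynomial ring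
  -- because each variable acts as zero on Koszul homology.
  let Y : ℤ → Submodule (MvPolynomial (Fin n) k) (Finset (Fin n) → M) := fun q =>
    { carrier := {z | koszulDk k n M z = 0 ∧ ∃ y ∈ koszulChain n Mdeg (p + 1) (q - 1),
        koszulDk k n M y = chainProj π p q z}
      add_mem' := by
        rintro z z' ⟨hz, y, hy, hyz⟩ ⟨hz', y', hy', hyz'⟩
        exact ⟨by rw [map_add, hz, hz', add_zero], y + y', add_mem hy hy', by
          rw [map_add, map_add, hyz, hyz']⟩
      zero_mem' := ⟨map_zero _, 0, zero_mem _, by rw [map_zero, map_zero]⟩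
      smul_mem' := by
        rintro a z ⟨hz, y, hy, hyz⟩
        have hcyc : ∀ a : MvPolynomial (Fin n) k, koszulDk k n M (a • z) = 0 := fun a => by
          change koszulD k n M (a • z) = 0
          rw [map_smul]
          change a • koszulDk k n M z = 0
          rw [hz, smul_zero]
        refine ⟨hcyc a, ?_⟩
        induction a using MvPolynomial.induction_on with
        | C c =>
          refine ⟨c • y, Submodule.smul_mem _ _ hy, ?_⟩
          rw [map_smul, hyz, ← map_smul]
          congr 1
          funext s
          rw [Pi.smul_apply, Pi.smul_apply, ← algebraMap_eq, algebraMap_smul]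
        | add a b ha hb =>
          obtain ⟨y₁, hy₁, h₁⟩ := ha
          obtain ⟨y₂, hy₂, h₂⟩ := hb
          exact ⟨y₁ + y₂, add_mem hy₁ hy₂, by rw [map_add, h₁, h₂, add_smul, map_add]⟩
        | mul_X a i _ =>
          refine ⟨chainProj π (p + 1) (q - 1) (koszulWedge k M i (a • z)),
            h.chainProj_mem _ _ _, ?_⟩
          rw [h.koszulD_chainProj rfl (sub_add_cancel q 1).symm]
          congr 1
          -- For a cycle w the homotopy gives x_i w = d(e_i w).
          have h1 := koszulD_wedge (k := k) i (a • z)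
          rw [show koszulD k n M (a • z) = 0 from hcyc a, map_zero, sub_zero, smul_smul,
            mul_comm] at h1
          exact h1 }
  -- Submodules generated by the homogeneous cycles of degree at most m. Once this chain is
  -- stationary, a cycle of degree q > m is a combination of cycles of lower degree, each with zero
  -- (p, q) component and hence in `Y q`.
  let Z : ℕ →o Submodule (MvPolynomial (Fin n) k) (Finset (Fin n) → M) :=
    { toFun := fun m => Submodule.span _ {z | koszulDk k n M z = 0 ∧
        ∃ q : ℤ, q ≤ m ∧ z ∈ koszulChain n Mdeg p q}
      monotone' := fun a b hab => Submodule.span_mono (by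
        rintro z ⟨hz, q, hq, hzq⟩
        exact ⟨hz, q, by omega, hzq⟩) }
  obtain ⟨m, hm⟩ := monotone_stabilizes_iff_noetherian.2
    (inferInstance : IsNoetherian (MvPolynomial (Fin n) k) (Finset (Fin n) → M)) Z
  refine ⟨m, fun q hq => subsingleton_of_forall_eq 0 fun x => ?_⟩
  obtain ⟨z, hz, hd, rfl⟩ := exists_homologyClass x
  have h1 : z ∈ Z q.toNat := Submodule.subset_span ⟨hd, q, by omega, hz⟩
  have h2 : Z m ≤ Y q := by
    refine Submodule.span_le.2 ?_
    rintro w ⟨hw, q', hq', hwq⟩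
    exact ⟨hw, 0, zero_mem _, by rw [map_zero, h.chainProj_ne (by omega) hwq]⟩
  rw [← hm q.toNat (by omega)] at h1
  obtain ⟨_, y, hy, hyz⟩ := h2 h1
  rw [homologyClass_eq_zero]
  exact ⟨y, hy, by rw [hyz, h.chainProj_self hz]⟩

end IsGradedProjection

/-- The component of degree `m` of a polynomial, for any integer `m`. -/
def homProj (k : Type*) [Field k] (n : ℕ) (m : ℤ) :
    MvPolynomial (Fin n) k →ₗ[k] MvPolynomial (Fin n) k :=
  if 0 ≤ m then homogeneousComponent m.toNat else 0

theorem coeff_homProj (m : ℤ) (f : MvPolynomial (Fin n) k) (d : Fin n →₀ ℕ) :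
    coeff d (homProj k n m f) = if (d.degree : ℤ) = m then coeff d f else 0 := by
  rw [homProj]
  split_ifs with h1 h2 h2
  · rw [coeff_homogeneousComponent, if_pos (by omega)]
  · rw [coeff_homogeneousComponent, if_neg (by omega)]
  · omega
  · simp

theorem mem_homPart_iff_coeff {m : ℤ} {f : MvPolynomial (Fin n) k} :
    f ∈ homPart k n m ↔ ∀ d, coeff d f ≠ 0 → (d.degree : ℤ) = m := by
  rw [mem_homPart]
  constructor
  · rintro ⟨h1, h2⟩ d hd
    by_cases hm : 0 ≤ m
    · by_contra hne
      exact hd ((h1 hm).coeff_eq_zero (by omega))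
    · exact absurd (by rw [h2 (not_le.1 hm), coeff_zero]) hd
  · intro h
    refine ⟨fun hm d hd => ?_, fun hm => ?_⟩
    · have := h d hd
      have hw : Finsupp.weight 1 d = d.degree := by
        rw [Finsupp.degree_eq_weight_one]; rfl
      rw [hw]
      omega
    · ext d
      by_contra hd
      have := h d hd
      omega

theorem homProj_mem (m : ℤ) (f : MvPolynomial (Fin n) k) : homProj k n m f ∈ homPart k n m := by
  rw [mem_homPart_iff_coeff]
  intro d hd
  rw [coeff_homProj] at hd
  by_contra h
  exact hd (if_neg h)

theorem homProj_self {m : ℤ} {f : MvPolynomial (Fin n) k} (hf : f ∈ homPart k n m) :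
    homProj k n m f = f := by
  ext d
  rw [coeff_homProj]
  split_ifs with h
  · rfl
  · by_contra hd
    exact h (mem_homPart_iff_coeff.1 hf d (Ne.symm hd))

theorem homProj_ne {m m' : ℤ} (h : m ≠ m') {f : MvPolynomial (Fin n) k}
    (hf : f ∈ homPart k n m') : homProj k n m f = 0 := by
  ext d
  rw [coeff_homProj, coeff_zero]
  split_ifs with h1
  · by_contra hd
    exact h (h1 ▸ mem_homPart_iff_coeff.1 hf d hd)
  · rfl

theorem homProj_X_mul (m : ℤ) (i : Fin n) (f : MvPolynomial (Fin n) k) :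
    homProj k n (m + 1) (X i * f) = X i * homProj k n m f := by
  ext d
  rw [coeff_homProj, coeff_X_mul', coeff_X_mul']
  by_cases hi : i ∈ d.support
  · rw [if_pos hi, if_pos hi, coeff_homProj]
    have : d.degree = (d - Finsupp.single i 1).degree + 1 := by
      conv_lhs => rw [← tsub_add_cancel_of_le (b := d) (a := Finsupp.single i 1)
        (Finsupp.single_le_iff.2 (Nat.one_le_iff_ne_zero.2 (Finsupp.mem_support_iff.1 hi)))]
      rw [map_add, Finsupp.degree_single]
    congr 1
    rw [this]
    push_cast
    simp
  · rw [if_neg hi, if_neg hi, ite_self]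

theorem homProj_mem_ideal {I : Ideal (MvPolynomial (Fin n) k)}
    (hI : I.IsHomogeneous (homogeneousSubmodule (Fin n) k)) (m : ℤ) {f : MvPolynomial (Fin n) k}
    (hf : f ∈ I) : homProj k n m f ∈ I := by
  rw [homProj]
  split_ifs
  · exact homogeneousComponent_mem_of_mem hI hf _
  · exact zero_mem _

theorem X_mul_mem_homPart {m m' : ℤ} (h : m' = m + 1) (i : Fin n) {f : MvPolynomial (Fin n) k}
    (hf : f ∈ homPart k n m) : X i * f ∈ homPart k n m' := by
  rw [h, ← homProj_self hf, ← homProj_X_mul]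
  exact homProj_mem _ _

theorem isGradedFamily_homPart : IsGradedFamily (n := n) (homPart k n) :=
  fun _ _ i h _ hx => X_mul_mem_homPart h i hx

theorem isGradedProjection_homPart : IsGradedProjection (n := n) (homPart k n) (homProj k n) where
  mem := homProj_mem
  self _ _ := homProj_self
  ne _ _ h _ := homProj_ne h
  smul := homProj_X_mul

theorem isGradedFamily_quotDeg (I : Ideal (MvPolynomial (Fin n) k)) :
    IsGradedFamily (n := n) (quotDeg I) := by
  rintro m m' i h _ ⟨f, hf, rfl⟩
  exact ⟨X i * f, X_mul_mem_homPart h i hf, rfl⟩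

/-- The projection to the degree `m` part of `A / I`. -/
def quotProj (I : Ideal (MvPolynomial (Fin n) k))
    (hI : I.IsHomogeneous (homogeneousSubmodule (Fin n) k)) (m : ℤ) :
    (MvPolynomial (Fin n) k ⧸ I) →ₗ[k] (MvPolynomial (Fin n) k ⧸ I) :=
  (Submodule.Quotient.restrictScalarsEquiv k I).toLinearMap ∘ₗ
    Submodule.mapQ (I.restrictScalars k) (I.restrictScalars k) (homProj k n m)
      (fun _ hf => homProj_mem_ideal hI m hf) ∘ₗ
    (Submodule.Quotient.restrictScalarsEquiv k I).symm.toLinearMap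

theorem quotProj_mk (I : Ideal (MvPolynomial (Fin n) k))
    (hI : I.IsHomogeneous (homogeneousSubmodule (Fin n) k)) (m : ℤ) (f : MvPolynomial (Fin n) k) :
    quotProj I hI m (Ideal.Quotient.mk I f) = Ideal.Quotient.mk I (homProj k n m f) := rfl

theorem isGradedProjection_quotDeg (I : Ideal (MvPolynomial (Fin n) k))
    (hI : I.IsHomogeneous (homogeneousSubmodule (Fin n) k)) :
    IsGradedProjection (n := n) (quotDeg I) (quotProj I hI) where
  mem q x := by
    obtain ⟨f, rfl⟩ := Ideal.Quotient.mk_surjective x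
    exact ⟨homProj k n q f, homProj_mem q f, rfl⟩
  self q x hx := by
    obtain ⟨f, hf, rfl⟩ := hx
    change quotProj I hI q (Ideal.Quotient.mk I f) = Ideal.Quotient.mk I f
    rw [quotProj_mk, homProj_self hf]
  ne q q' h x hx := by
    obtain ⟨f, hf, rfl⟩ := hx
    change quotProj I hI q (Ideal.Quotient.mk I f) = 0
    rw [quotProj_mk, homProj_ne h hf, map_zero]
  smul q i x := by
    obtain ⟨f, rfl⟩ := Ideal.Quotient.mk_surjective x
    change quotProj I hI (q + 1) (Ideal.Quotient.mk I (X i * f)) =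
      Ideal.Quotient.mk I (X i * homProj k n q f)
    rw [quotProj_mk, homProj_X_mul]

instance (m : ℤ) : FiniteDimensional k (homPart k n m) := by
  refine Module.Finite.iff_fg.2 ?_
  rw [homPart]
  split_ifs
  · exact homogeneousSubmodule_fg _ _ _
  · exact Submodule.fg_bot

theorem tor_quotient_eventually_zero (I : Ideal (MvPolynomial (Fin n) k))
    (hI : I.IsHomogeneous (homogeneousSubmodule (Fin n) k)) (p : ℤ) :
    ∃ m : ℕ, ∀ q : ℤ, m < q → Subsingleton (KoszulTor n (quotDeg I) p q) :=
  (isGradedProjection_quotDeg I hI).tor_eventually_zero p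

/-- In positive degree there is no constant term, so `koszul_resolves` applies. The primitive it
yields need not be homogeneous; its component of the right bidegree is again a primitive. -/
theorem subsingleton_tor_homPart {p q : ℤ} (hq : 1 ≤ q) :
    Subsingleton (KoszulTor n (homPart k n) p q) := by
  refine subsingleton_of_forall_eq 0 fun x => ?_
  obtain ⟨z, hz, hd, rfl⟩ := exists_homologyClass x
  rw [homologyClass_eq_zero]
  obtain ⟨h, hh⟩ := koszul_resolves z hd (by
    by_contra hne
    have := mem_homPart_iff_coeff.1 (koszulChain_apply_mem hz ∅) 0 hne
    simp at this
    omega)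
  have hπ := isGradedProjection_homPart (k := k) (n := n)
  refine ⟨chainProj (homProj k n) (p + 1) (q - 1) h, hπ.chainProj_mem _ _ _, ?_⟩
  rw [hπ.koszulD_chainProj rfl (sub_add_cancel q 1).symm]
  change chainProj _ p q (koszulD k n _ h) = z
  rw [hh, hπ.chainProj_self hz]

theorem isHomogeneousMap_mk (I : Ideal (MvPolynomial (Fin n) k)) :
    IsHomogeneousMap (homPart k n) (quotDeg I) 0 (Submodule.mkQ I) := by
  rintro m m' h f hf
  obtain rfl : m' = m := by omega
  exact ⟨f, hf, rfl⟩

/-- The graded pieces of an ideal. -/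
abbrev idealDeg (I : Ideal (MvPolynomial (Fin n) k)) (m : ℤ) : Submodule k I :=
  (homPart k n m).comap (I.subtype.restrictScalars k)

instance (I : Ideal (MvPolynomial (Fin n) k)) (m : ℤ) : FiniteDimensional k (idealDeg I m) :=
  Module.Finite.of_injective (((I.subtype.restrictScalars k).restrict
    (p := idealDeg I m) (q := homPart k n m) fun _ h => h)) fun x y h => by
      have h' : ((x : I) : MvPolynomial (Fin n) k) = (y : I) :=
        congrArg (fun z : homPart k n m => (z : MvPolynomial (Fin n) k)) h
      exact Subtype.ext (Subtype.ext h')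

theorem gradedShortExact_ideal (I : Ideal (MvPolynomial (Fin n) k)) :
    GradedShortExact (idealDeg I) (homPart k n) (quotDeg I) 0 I.subtype (Submodule.mkQ I) where
  graded := isGradedFamily_homPart
  hom₁ m m' h x hx := by
    obtain rfl : m' = m := by omega
    exact hx
  hom₂ := isHomogeneousMap_mk I
  inj := Subtype.val_injective
  comp x := (Submodule.Quotient.mk_eq_zero I).2 x.2
  exact m m' h y hy h0 := by
    obtain rfl : m' = m := by omega
    exact ⟨⟨y, (Submodule.Quotient.mk_eq_zero I).1 h0⟩, hy, rfl⟩
  surj m z hz := by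
    obtain ⟨f, hf, rfl⟩ := hz
    exact ⟨f, hf, rfl⟩

theorem finrank_range_eq_zero_of_subsingleton {V W : Type*} [AddCommGroup V] [Module k V]
    [AddCommGroup W] [Module k W] (f : V →ₗ[k] W) (h : Subsingleton V) :
    Module.finrank k (LinearMap.range f) = 0 := by
  have : LinearMap.range f = ⊥ := by
    rw [eq_bot_iff]
    rintro _ ⟨x, rfl⟩
    rw [Subsingleton.elim x 0, map_zero]; exact zero_mem _
  rw [this, finrank_bot]

/-- `Tor_p(A / I) → Tor_{p-1}(I)` is injective in the degrees in which `Tor_p(A)` is zero. -/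
theorem bettiQuot_le_bettiIdeal (I : Ideal (MvPolynomial (Fin n) k)) {p p' q q' : ℤ}
    (hp : p = p' + 1) (hq : q' = q + 1) (hq1 : 1 ≤ q) :
    bettiQuot I p q ≤ bettiIdeal I p' q' := by
  have h := (gradedShortExact_ideal I).tor_connecting hp (add_zero q').symm hq
  rw [finrank_range_eq_zero_of_subsingleton _ (subsingleton_tor_homPart hq1), add_zero] at h
  change Module.finrank k (KoszulTor n (quotDeg I) p q) ≤
    Module.finrank k (KoszulTor n (idealDeg I) p' q')
  rw [← h]
  exact Submodule.finrank_le _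

theorem bettiIdeal_of_neg (I : Ideal (MvPolynomial (Fin n) k)) {p q : ℤ} (hp : p < 0) :
    bettiIdeal I p q = 0 :=
  haveI := subsingleton_tor_of_neg (n := n) (Mdeg := idealDeg I) (q := q) hp
  Module.finrank_zero_of_subsingleton (M := KoszulTor n (idealDeg I) p q)

theorem bettiQuot_zero_left (I : Ideal (MvPolynomial (Fin n) k)) {q : ℤ} (hq : 1 ≤ q) :
    bettiQuot I 0 q = 0 := by
  have := bettiQuot_le_bettiIdeal I (p := 0) (p' := -1) (by norm_num) rfl hq
  rwa [bettiIdeal_of_neg I (by norm_num), Nat.le_zero] at this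

theorem subsingleton_tor_of_bettiQuot {I : Ideal (MvPolynomial (Fin n) k)} {p q : ℤ}
    (h : bettiQuot I p q = 0) : Subsingleton (KoszulTor n (quotDeg I) p q) :=
  (Module.finrank_zero_iff (R := k) (M := KoszulTor n (quotDeg I) p q)).1 h

end GradedProjections

/-! ### Ideals generated by linear forms -/

section LinearForms

variable {k : Type*} [Field k] {n : ℕ}

/-- The linear form with given coefficients. -/
def linForm (c : Fin n → k) : MvPolynomial (Fin n) k := ∑ i, C (c i) * X i

theorem linForm_eq (c : Fin n → k) :
    linForm c = Fintype.linearCombination k (fun i => (X i : MvPolynomial (Fin n) k)) c := by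
  simp [linForm, Fintype.linearCombination_apply, smul_eq_C_mul]

theorem linForm_isHomogeneous (c : Fin n → k) : (linForm c).IsHomogeneous 1 :=
  IsHomogeneous.sum _ _ _ fun _ _ => isHomogeneous_C_mul_X _ _

theorem coeff_linForm (c : Fin n → k) (i : Fin n) :
    coeff (Finsupp.single i 1) (linForm c) = c i := by
  rw [linForm, coeff_sum, Finset.sum_eq_single i]
  · simp
  · intro j _ hj
    rw [coeff_C_mul, coeff_X, if_neg, mul_zero]
    intro h
    exact hj (Finsupp.single_left_injective one_ne_zero h)
  · simp

theorem exists_linForm {f : MvPolynomial (Fin n) k} (hf : f.IsHomogeneous 1) :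
    ∃ c, f = linForm c := by
  have : f ∈ homogeneousSubmodule (Fin n) k 1 := hf
  rw [homogeneousSubmodule_one_eq_span_X] at this
  obtain ⟨c, rfl⟩ := (Submodule.mem_span_range_iff_exists_fun k).1 this
  exact ⟨c, by simp [linForm, smul_eq_C_mul]⟩

theorem linForm_add (c c' : Fin n → k) : linForm (c + c') = linForm c + linForm c' := by
  simp [linForm_eq]

theorem linForm_smul (a : k) (c : Fin n → k) : linForm (a • c) = a • linForm c := by
  simp [linForm_eq]

theorem linForm_single (i : Fin n) : linForm (Pi.single i (1 : k)) = X i := by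
  rw [linForm_eq, Fintype.linearCombination_apply_single, one_smul]

theorem linSub_linForm (A : Matrix (Fin n) (Fin n) k) (c : Fin n → k) :
    linSub A (linForm c) = linForm (Matrix.vecMul c A) := by
  simp only [linForm, map_sum, map_mul, algHom_C, MvPolynomial.algebraMap_eq, linSub_X,
    Finset.mul_sum, Matrix.vecMul, dotProduct, Finset.sum_mul]
  rw [Finset.sum_comm]
  simp only [mul_assoc]

/-- The coefficient vectors of the linear forms in an ideal. -/
def linCoeffs (K : Ideal (MvPolynomial (Fin n) k)) : Submodule k (Fin n → k) where
  carrier := {c | linForm c ∈ K}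
  add_mem' ha hb := by
    rw [Set.mem_ofPred_eq, linForm_add]; exact add_mem ha hb
  zero_mem' := by simp [linForm_eq]
  smul_mem' a c hc := by
    rw [Set.mem_ofPred_eq, linForm_smul, smul_eq_C_mul]; exact K.mul_mem_left _ hc

theorem mem_linCoeffs {K : Ideal (MvPolynomial (Fin n) k)} {c : Fin n → k} :
    c ∈ linCoeffs K ↔ linForm c ∈ K := Iff.rfl

theorem finrank_linCoeffs (K : Ideal (MvPolynomial (Fin n) k)) :
    Module.finrank k (linCoeffs K) = numLinearForms K := by
  let φ : linCoeffs K →ₗ[k] ↥(K.restrictScalars k ⊓ homogeneousSubmodule (Fin n) k 1) :=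
    { toFun := fun c => ⟨linForm c.1, c.2, linForm_isHomogeneous _⟩
      map_add' := fun a b => Subtype.ext (linForm_add _ _)
      map_smul' := fun a b => Subtype.ext (linForm_smul _ _) }
  refine LinearEquiv.finrank_eq (LinearEquiv.ofBijective φ ⟨fun a b hab => ?_, fun f => ?_⟩)
  · refine Subtype.ext (_root_.funext fun i => ?_)
    rw [← coeff_linForm a.1, ← coeff_linForm b.1]
    exact congrArg (fun f => coeff _ f.1) hab
  · obtain ⟨c, hc⟩ := exists_linForm f.2.2
    exact ⟨⟨c, by rw [mem_linCoeffs, ← hc]; exact f.2.1⟩, Subtype.ext hc.symm⟩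

/-- The linear forms in `K` are the linear combinations of the variables `x_i` with `i ∈ T`. -/
def HasLinearForms (K : Ideal (MvPolynomial (Fin n) k)) (T : Finset (Fin n)) : Prop :=
  ∀ c, linForm c ∈ K ↔ ∀ i ∉ T, c i = 0

theorem HasLinearForms.X_mem {K : Ideal (MvPolynomial (Fin n) k)} {T : Finset (Fin n)}
    (h : HasLinearForms K T) {i : Fin n} (hi : i ∈ T) : X i ∈ K := by
  rw [← linForm_single, h]
  intro j hj
  exact Pi.single_eq_of_ne (by rintro rfl; exact hj hi) _

theorem mem_map_linSub {A : Matrix (Fin n) (Fin n) k} (hA : A.det ≠ 0)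
    {K : Ideal (MvPolynomial (Fin n) k)} {f : MvPolynomial (Fin n) k} :
    f ∈ K.map (linSub A) ↔ linSub A⁻¹ f ∈ K := by
  change f ∈ K.map (linSubEquiv A hA : MvPolynomial (Fin n) k →+* MvPolynomial (Fin n) k) ↔
    (linSubEquiv A hA).symm f ∈ K
  have := Ideal.mem_map_of_equiv (linSubEquiv A hA).toRingEquiv (I := K) f
  refine Iff.trans this ⟨?_, fun h => ⟨_, h, (linSubEquiv A hA).apply_symm_apply f⟩⟩
  rintro ⟨x, hx, rfl⟩
  change (linSubEquiv A hA).symm (linSubEquiv A hA x) ∈ K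
  rwa [AlgEquiv.symm_apply_apply]

/-- After a coordinate change, the linear forms in an ideal are generated by variables. -/
theorem exists_hasLinearForms (K : Ideal (MvPolynomial (Fin n) k)) :
    ∃ (A : Matrix (Fin n) (Fin n) k) (T : Finset (Fin n)), A.det ≠ 0 ∧
      T.card = numLinearForms K ∧ HasLinearForms (K.map (linSub A)) T := by
  classical
  obtain ⟨W, hW⟩ := Submodule.exists_isCompl (linCoeffs K)
  -- A basis adapted to the coefficient vectors of linear forms in K and a complement. Its vectors
  -- are the rows of `B`, so substituting `B⁻¹` turns the corresponding linear forms into variables,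
  -- with `T` indexing the first block.
  let b₀ := (Module.finBasis k (linCoeffs K)).prod (Module.finBasis k W)
  let b₁ := b₀.map (Submodule.prodEquivOfIsCompl _ _ hW)
  have hcard : Fintype.card (Fin (Module.finrank k (linCoeffs K)) ⊕ Fin (Module.finrank k W)) =
      Fintype.card (Fin n) := by
    rw [← Module.finrank_eq_card_basis b₁]; simp
  let e := Fintype.equivOfCardEq hcard
  let b := b₁.reindex e
  let T : Finset (Fin n) := Finset.univ.map (Function.Embedding.inl.trans e.toEmbedding)
  have hT : ∀ i, i ∈ T ↔ ∃ a, e (Sum.inl a) = i := by simp [T]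
  let B : Matrix (Fin n) (Fin n) k := Matrix.of fun i => b i
  have hB : IsUnit B.det := by
    have h1 : B = ((Pi.basisFun k (Fin n)).toMatrix b).transpose := by
      ext i j; simp [B, Module.Basis.toMatrix_apply]
    rw [h1, Matrix.det_transpose]
    exact (Module.Basis.isUnit_det _ b)
  have hB0 : B⁻¹.det ≠ 0 := by
    rw [Matrix.det_nonsing_inv, Ring.inverse_eq_inv']
    exact inv_ne_zero hB.ne_zero
  refine ⟨B⁻¹, T, hB0, ?_, fun c => ?_⟩
  · rw [← finrank_linCoeffs, Finset.card_map, Finset.card_univ, Fintype.card_fin]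
  · rw [mem_map_linSub hB0, Matrix.nonsing_inv_nonsing_inv _ hB, linSub_linForm, ← mem_linCoeffs]
    have h1 : Matrix.vecMul c B = ∑ i, c i • b i := by
      ext j
      simp [Matrix.vecMul, dotProduct, B]
    have hrepr : b.repr (∑ i, c i • b i) = Finsupp.equivFunOnFinite.symm c := by
      ext i
      rw [Module.Basis.repr_sum_self]; rfl
    have key : ∀ v : Fin n → k, v ∈ linCoeffs K ↔ ∀ i ∉ T, b.repr v i = 0 := by
      intro v
      obtain ⟨⟨u, w⟩, rfl⟩ := (Submodule.prodEquivOfIsCompl _ _ hW).surjective v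
      have hr : ∀ x, b.repr (Submodule.prodEquivOfIsCompl _ _ hW (u, w)) (e x) =
          b₀.repr (u, w) x := by
        intro x
        simp [b, b₁]
      have hw : (Submodule.prodEquivOfIsCompl _ _ hW (u, w)) ∈ linCoeffs K ↔ w = 0 := by
        rw [Submodule.coe_prodEquivOfIsCompl']
        rw [(linCoeffs K).add_mem_iff_right u.2]
        constructor
        · intro h
          have : (w : Fin n → k) ∈ linCoeffs K ⊓ W := ⟨h, w.2⟩
          rw [hW.inf_eq_bot, Submodule.mem_bot] at this
          exact Subtype.ext this
        · rintro rfl; exact zero_mem _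
      rw [hw]
      constructor
      · rintro rfl i hi
        obtain ⟨x, rfl⟩ := e.surjective i
        rw [hr]
        rcases x with a | a
        · exact absurd ((hT _).2 ⟨a, rfl⟩) hi
        · simp [b₀]
      · intro h
        refine (Module.finBasis k W).ext_elem fun a => ?_
        have := h (e (Sum.inr a)) (by
          rw [hT]; rintro ⟨a', ha'⟩; exact absurd (e.injective ha') (by simp))
        rw [hr] at this
        simpa [b₀] using this
    rw [h1, key, hrepr]
    rfl

theorem quotDeg_eq_bot (K : Ideal (MvPolynomial (Fin n) k)) {m : ℤ} (hm : m < 0) :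
    quotDeg K m = ⊥ := by
  rw [quotDeg, homPart, if_neg (not_le.2 hm), Submodule.map_bot]

/-- The differential of a chain of constants has linear forms as components, so such a chain is a
cycle in A/K exactly when certain linear forms lie in K. -/
theorem linForm_eq_sum_filter {s : Finset (Fin n)} {K : Ideal (MvPolynomial (Fin n) k)}
    (a : Finset (Fin n) → k) :
    koszulD k n (MvPolynomial (Fin n) k ⧸ K) (fun s => Ideal.Quotient.mk K (C (a s))) s =
      Ideal.Quotient.mk K (linForm fun i =>
        if i ∈ s then 0 else (koszulSign i s : k) * a (insert i s)) := by
  rw [koszulD_eq_sum, Finset.sum_apply, linForm, map_sum]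
  refine Finset.sum_congr rfl fun i _ => ?_
  rw [Pi.smul_apply, koszulContract_apply]
  split_ifs with hi
  · simp
  · have : koszulSign i s • Ideal.Quotient.mk K (C (a (insert i s))) =
        Ideal.Quotient.mk K (C ((koszulSign i s : k) * a (insert i s))) := by
      rw [map_mul, map_mul, map_intCast, map_intCast, zsmul_eq_mul]
    rw [this]
    change Ideal.Quotient.mk K (X i * C _) = _
    rw [mul_comm]

/-- The linear strand of `A / K` is the Koszul complex on the linear forms in `K`. -/
theorem bettiQuot_zero_right_of_hasLinearForms {K : Ideal (MvPolynomial (Fin n) k)} (hK : K ≠ ⊤)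
    {T : Finset (Fin n)} (hT : HasLinearForms K T) (p : ℕ) :
    bettiQuot K p 0 = T.card.choose p := by
  classical
  have hC : ∀ a : k, Ideal.Quotient.mk K (C a) = 0 → a = 0 := by
    intro a ha
    by_contra hne
    rw [Ideal.Quotient.eq_zero_iff_mem] at ha
    exact hK (Ideal.eq_top_of_isUnit_mem _ ha ((isUnit_iff_ne_zero.2 hne).map C))
  let ext : (T.powersetCard p → k) → Finset (Fin n) → k := fun a s =>
    if h : s ∈ T.powersetCard p then a ⟨s, h⟩ else 0
  have hpos : ∀ a s (h : s ∈ T.powersetCard p), ext a s = a ⟨s, h⟩ := fun a s h => dif_pos h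
  have hneg : ∀ a s, s ∉ T.powersetCard p → ext a s = 0 := fun a s h => dif_neg h
  have hmem : ∀ a, (fun s => Ideal.Quotient.mk K (C (ext a s))) ∈ koszulChain n (quotDeg K) p 0 := by
    intro a
    rw [mem_koszulChain]
    intro s
    refine ⟨fun _ => ⟨C (ext a s), ?_, rfl⟩, fun hs => ?_⟩
    · exact mem_homPart_natCast.2 (isHomogeneous_C _ _)
    · have : s ∉ T.powersetCard p := fun h => hs (by
        exact_mod_cast (Finset.mem_powersetCard.1 h).2)
      rw [hneg a s this, map_zero, map_zero]
  have hcyc : ∀ a, koszulDk k n _ (fun s => Ideal.Quotient.mk K (C (ext a s))) = 0 := by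
    intro a
    funext s
    change koszulD k n _ _ s = 0
    rw [linForm_eq_sum_filter, Ideal.Quotient.eq_zero_iff_mem, hT]
    intro i hi
    split_ifs with his
    · rfl
    · have : insert i s ∉ T.powersetCard p := fun h =>
        hi ((Finset.mem_powersetCard.1 h).1 (Finset.mem_insert_self _ _))
      rw [hneg a _ this, mul_zero]
  -- In q = 0 there are no boundaries, since A/K has no elements of degree -1. The homology is thus
  -- the space of constant cycles, and these are the chains supported on p-subsets of `T`.
  let Φ : (T.powersetCard p → k) →ₗ[k] KoszulTor n (quotDeg K) p 0 :=
    { toFun := fun a => homologyClass _ _ _ _ (hmem a) (hcyc a)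
      map_add' := fun a b => by
        refine congrArg Submodule.Quotient.mk (Subtype.ext (_root_.funext fun s => ?_))
        change Ideal.Quotient.mk K (C (ext (a + b) s)) =
          Ideal.Quotient.mk K (C (ext a s)) + Ideal.Quotient.mk K (C (ext b s))
        rw [← map_add, ← map_add]
        congr 2
        by_cases h : s ∈ T.powersetCard p
        · rw [hpos _ _ h, hpos _ _ h, hpos _ _ h]; rfl
        · rw [hneg _ _ h, hneg _ _ h, hneg _ _ h, add_zero]
      map_smul' := fun c a => by
        refine congrArg Submodule.Quotient.mk (Subtype.ext (_root_.funext fun s => ?_))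
        change Ideal.Quotient.mk K (C (ext (c • a) s)) = c • Ideal.Quotient.mk K (C (ext a s))
        have : ext (c • a) s = c * ext a s := by
          by_cases h : s ∈ T.powersetCard p
          · rw [hpos _ _ h, hpos _ _ h]; rfl
          · rw [hneg _ _ h, hneg _ _ h, mul_zero]
        rw [this, map_mul, ← smul_eq_C_mul]
        rfl }
  have hbound : ∀ y ∈ koszulChain n (quotDeg K) ((p : ℤ) + 1) (0 - 1), y = 0 := by
    intro y hy
    funext s
    have := koszulChain_apply_mem hy s
    rwa [quotDeg_eq_bot K (by norm_num), Submodule.mem_bot] at this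
  have hΦ : Function.Bijective Φ := by
    constructor
    · rw [injective_iff_map_eq_zero]
      intro a ha
      obtain ⟨y, hy, hya⟩ := (homologyClass_eq_zero (hz := hmem a) (hd := hcyc a)).1 ha
      rw [hbound y hy, map_zero] at hya
      funext s
      have := hC _ (congrFun hya s.1).symm
      rwa [hpos a s.1 s.2] at this
    · intro x
      obtain ⟨z, hz, hd, rfl⟩ := exists_homologyClass x
      have hz0 : ∀ s, ∃ a : k, z s = Ideal.Quotient.mk K (C a) := by
        intro s
        obtain ⟨f, hf, hfz⟩ := koszulChain_apply_mem hz s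
        have hf0 : f.IsHomogeneous 0 := mem_homPart_natCast.1 hf
        rw [← totalDegree_zero_iff_isHomogeneous, totalDegree_eq_zero_iff_eq_C] at hf0
        exact ⟨coeff 0 f, by rw [← hf0]; exact hfz.symm⟩
      choose a ha using hz0
      have hcard : ∀ s, s.card ≠ p → a s = 0 := fun s hs => hC _ (by
        rw [← ha]; exact (mem_koszulChain.1 hz s).2 (by exact_mod_cast hs))
      -- If i ∈ s, then in the component of dz at s \ {i} the coefficient of x_i is ±a(s); it must
      -- vanish for i ∉ T.
      have hsub : ∀ s, a s ≠ 0 → s ⊆ T := by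
        intro s hs i his
        by_contra hi
        have h1 := congrFun hd (s.erase i)
        rw [show z = fun s => Ideal.Quotient.mk K (C (a s)) from _root_.funext ha] at h1
        change koszulD k n _ _ _ = 0 at h1
        rw [linForm_eq_sum_filter, Ideal.Quotient.eq_zero_iff_mem, hT] at h1
        have h2 := h1 i hi
        rw [if_neg (Finset.notMem_erase i s), Finset.insert_erase his] at h2
        rcases mul_eq_zero.1 h2 with h3 | h3
        · have := koszulSign_mul_self i (s.erase i)
          have := congrArg (Int.cast (R := k)) this
          rw [Int.cast_mul, h3] at this
          simp at this
        · exact hs h3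
      refine ⟨fun s => a s, ?_⟩
      refine congrArg Submodule.Quotient.mk (Subtype.ext (_root_.funext fun s => ?_))
      change Ideal.Quotient.mk K (C (ext (fun s => a s) s)) = z s
      rw [ha]
      congr 2
      by_cases h : s ∈ T.powersetCard p
      · exact hpos (fun s => a s) s h
      · refine (hneg (fun s => a s) s h).trans ?_
        by_contra hne
        exact h (Finset.mem_powersetCard.2 ⟨hsub s (Ne.symm hne), by
          by_contra hc; exact hne (hcard s hc).symm⟩)
  change Module.finrank k (KoszulTor n (quotDeg K) p 0) = _
  rw [← (LinearEquiv.ofBijective Φ hΦ).finrank_eq, Module.finrank_fintype_fun_eq_card,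
    Fintype.card_coe, Finset.card_powersetCard]

theorem map_linSub_ne_top {A : Matrix (Fin n) (Fin n) k} (hA : A.det ≠ 0)
    {K : Ideal (MvPolynomial (Fin n) k)} (hK : K ≠ ⊤) : K.map (linSub A) ≠ ⊤ := by
  rw [Ideal.ne_top_iff_one, mem_map_linSub hA, map_one]
  exact (Ideal.ne_top_iff_one K).1 hK

theorem bettiQuot_zero_right {K : Ideal (MvPolynomial (Fin n) k)} (hK : K ≠ ⊤) (p : ℕ) :
    bettiQuot K p 0 = (numLinearForms K).choose p := by
  obtain ⟨A, T, hA, hT, h⟩ := exists_hasLinearForms K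
  rw [← bettiQuot_map_linSub A hA, ← hT]
  exact bettiQuot_zero_right_of_hasLinearForms (map_linSub_ne_top hA hK) h p

/-- Multiplication with `x_j` on `A / I_T` for an ideal `I_T` generated by other variables. -/
theorem gradedShortExact_variables (T : Finset (Fin n)) {j : Fin n} (hj : j ∉ T) :
    GradedShortExact (quotDeg (k := k) (Ideal.span (X '' (T : Set (Fin n)))))
      (quotDeg (Ideal.span (X '' (T : Set (Fin n)))))
      (quotDeg (Ideal.span (X '' ((insert j T : Finset (Fin n)) : Set (Fin n))))) 1
      (LinearMap.lsmul (MvPolynomial (Fin n) k) _ (X j))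
      (Submodule.factor (Ideal.span_mono (Set.image_mono (by simp)))) where
  graded := isGradedFamily_quotDeg _
  hom₁ m m' h x hx := by
    obtain ⟨f, hf, rfl⟩ := hx
    exact ⟨X j * f, X_mul_mem_homPart h j hf, rfl⟩
  hom₂ m m' h x hx := by
    obtain ⟨f, hf, rfl⟩ := hx
    obtain rfl : m' = m := by omega
    exact ⟨f, hf, rfl⟩
  inj := by
    rw [injective_iff_map_eq_zero]
    intro x hx
    obtain ⟨f, rfl⟩ := Ideal.Quotient.mk_surjective x
    change Ideal.Quotient.mk _ (X j * f) = 0 at hx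
    rw [Ideal.Quotient.eq_zero_iff_mem, mem_ideal_span_X_image] at hx ⊢
    intro m hm
    obtain ⟨i, hi, him⟩ := hx (Finsupp.single j 1 + m) (by
      rw [mem_support_iff, coeff_X_mul]; exact mem_support_iff.1 hm)
    refine ⟨i, hi, ?_⟩
    have hij : i ≠ j := by rintro rfl; exact hj hi
    simpa [Finsupp.single_apply, hij.symm] using him
  comp x := by
    obtain ⟨f, rfl⟩ := Ideal.Quotient.mk_surjective x
    change Ideal.Quotient.mk _ (X j * f) = 0
    rw [Ideal.Quotient.eq_zero_iff_mem]
    exact Ideal.mul_mem_right _ _ (Ideal.subset_span ⟨j, by simp, rfl⟩)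
  exact m m' h y hy h0 := by
    obtain ⟨f, hf, rfl⟩ := hy
    change Ideal.Quotient.mk _ f = 0 at h0
    rw [Ideal.Quotient.eq_zero_iff_mem, mem_ideal_span_X_image] at h0
    -- Division by x_j: the monomials of the remainder avoid x_j, so they can lie in the larger
    -- ideal only through a variable of `T`.
    refine ⟨Ideal.Quotient.mk _ (f.divMonomial (Finsupp.single j 1)), ⟨_, ?_, rfl⟩, ?_⟩
    · rw [SetLike.mem_coe, mem_homPart_iff_coeff] at hf ⊢
      intro d hd
      rw [coeff_divMonomial] at hd
      have := hf _ hd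
      rw [map_add, Finsupp.degree_single] at this
      push_cast at this
      omega
    · change Ideal.Quotient.mk _ (X j * _) = Ideal.Quotient.mk _ f
      rw [Ideal.Quotient.eq]
      have h1 := divMonomial_add_modMonomial_single f j
      rw [show X j * (f.divMonomial (Finsupp.single j 1)) - f = -(f.modMonomial (Finsupp.single j 1)) by
        linear_combination h1]
      refine neg_mem (mem_ideal_span_X_image.2 fun d hd => ?_)
      rw [mem_support_iff] at hd
      by_cases hle : Finsupp.single j 1 ≤ d
      · exact absurd (coeff_modMonomial_of_le f hle) hd
      · rw [coeff_modMonomial_of_not_le f hle] at hd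
        obtain ⟨i, hi, hid⟩ := h0 d (mem_support_iff.2 hd)
        refine ⟨i, ?_, hid⟩
        rcases Finset.mem_insert.1 (Finset.mem_coe.1 hi) with rfl | h'
        · exact absurd (Finsupp.single_le_iff.2 (Nat.one_le_iff_ne_zero.2 hid)) hle
        · exact h'
  surj m z hz := by
    obtain ⟨f, hf, rfl⟩ := hz
    exact ⟨Ideal.Quotient.mk _ f, ⟨f, hf, rfl⟩, rfl⟩

theorem bettiQuot_bot {p q : ℤ} (hq : 1 ≤ q) :
    bettiQuot (⊥ : Ideal (MvPolynomial (Fin n) k)) p q = 0 := by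
  have h : gradedBetti n (homPart k n) p q = 0 :=
    haveI := subsingleton_tor_homPart (k := k) (n := n) (p := p) hq
    Module.finrank_zero_of_subsingleton (M := KoszulTor n (homPart k n) p q)
  rw [← h]
  let φ : MvPolynomial (Fin n) k ≃ₗ[k] MvPolynomial (Fin n) k ⧸ (⊥ : Ideal (MvPolynomial (Fin n) k)) :=
    (AlgEquiv.quotientBot k _).symm.toLinearEquiv
  refine (gradedBetti_diagonal φ (fun m x => ⟨?_, fun hx => Submodule.mem_map.2 ⟨x, hx, rfl⟩⟩) 1
    (fun _ => one_ne_zero) (fun a x => ?_) p q).symm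
  · rintro ⟨f, hf, hfx⟩
    have : f = x := φ.injective hfx
    rwa [← this]
  · rw [Pi.one_apply, one_smul]; rfl

/-- Induction on T: in the sequence of multiplication by the nonzerodivisor x_j, Tor_p(·)_q of the
new quotient sits between Tor_p(·)_q and Tor_{p-1}(·)_q of the old one, both zero. -/
theorem bettiQuot_variables (T : Finset (Fin n)) (p q : ℤ) (hq : 1 ≤ q) :
    bettiQuot (Ideal.span (X '' (T : Set (Fin n))) : Ideal (MvPolynomial (Fin n) k)) p q = 0 := by
  induction T using Finset.induction_on generalizing p with
  | empty => simp [bettiQuot_bot hq]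
  | insert j T hj ih =>
    have hses := gradedShortExact_variables (k := k) T hj
    have h := hses.tor_connecting (p := p) (p' := p - 1) (by omega) (q := q) (q' := q) rfl rfl
    have h1 := subsingleton_tor_of_bettiQuot (ih p)
    have h2 := subsingleton_tor_of_bettiQuot (ih (p - 1))
    rw [finrank_range_eq_zero_of_subsingleton _ h1, add_zero,
      Module.finrank_zero_of_subsingleton] at h
    exact h.symm

/-- `A / K` has a linear resolution if `K` is generated by linear forms. -/
theorem bettiQuot_of_span_linearForms {K : Ideal (MvPolynomial (Fin n) k)}
    (hK : K = Ideal.span {f | f ∈ K ∧ f.IsHomogeneous 1}) (p q : ℤ) (hq : 1 ≤ q) :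
    bettiQuot K p q = 0 := by
  obtain ⟨A, T, hA, -, h⟩ := exists_hasLinearForms K
  rw [← bettiQuot_map_linSub A hA, ← bettiQuot_variables (k := k) T p q hq]
  congr 1
  apply le_antisymm
  · conv_lhs => rw [hK]
    rw [Ideal.map_span, Ideal.span_le]
    rintro _ ⟨f, ⟨hf, hf1⟩, rfl⟩
    obtain ⟨c, hc⟩ := exists_linForm (linSub_isHomogeneous A hf1)
    have hcK : linForm c ∈ K.map (linSub A) := by
      rw [← hc]; exact Ideal.mem_map_of_mem _ hf
    rw [h] at hcK
    change linSub A f ∈ _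
    rw [hc]
    refine sum_mem fun i _ => ?_
    by_cases hi : i ∈ T
    · exact Ideal.mul_mem_left _ _ (Ideal.subset_span ⟨i, hi, rfl⟩)
    · rw [hcK i hi]; simp
  · rw [Ideal.span_le]
    rintro _ ⟨i, hi, rfl⟩
    exact h.X_mem hi

end LinearForms

/-! ### The elimination modules -/

section Elimination

variable {k : Type*} [Field k] {N : ℕ}

/-- The polynomials of degree `m` in `k[x_1, …, x_N][x_0]`, with respect to all variables. -/
def polyDeg (k : Type*) [Field k] (N : ℕ) (m : ℤ) :
    Submodule k (Polynomial (MvPolynomial (Fin N) k)) :=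
  (homPart k (N + 1) m).map (finSuccEquiv k N).toLinearMap

theorem degree_cons (a : ℕ) (d : Fin N →₀ ℕ) : (Finsupp.cons a d).degree = a + d.degree := by
  rw [Finsupp.degree_eq_sum, Finsupp.degree_eq_sum, Fin.sum_univ_succ]
  simp

theorem coeff_finSuccEquiv_homProj (m : ℤ) (f : MvPolynomial (Fin (N + 1)) k) (i : ℕ) :
    (finSuccEquiv k N (homProj k (N + 1) m f)).coeff i =
      homProj k N (m - i) ((finSuccEquiv k N f).coeff i) := by
  ext d
  rw [finSuccEquiv_coeff_coeff, coeff_homProj, coeff_homProj, finSuccEquiv_coeff_coeff, degree_cons]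
  refine if_congr ?_ rfl rfl
  push_cast
  constructor <;> intro h <;> linarith

theorem mem_polyDeg {m : ℤ} {F : Polynomial (MvPolynomial (Fin N) k)} :
    F ∈ polyDeg k N m ↔ ∀ i : ℕ, F.coeff i ∈ homPart k N (m - i) := by
  constructor
  · rintro ⟨f, hf, rfl⟩ i
    change (finSuccEquiv k N f).coeff i ∈ _
    rw [← homProj_self hf, coeff_finSuccEquiv_homProj]
    exact homProj_mem _ _
  · intro h
    refine ⟨(finSuccEquiv k N).symm F, ?_, (finSuccEquiv k N).apply_symm_apply F⟩
    have : homProj k (N + 1) m ((finSuccEquiv k N).symm F) = (finSuccEquiv k N).symm F := by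
      apply (finSuccEquiv k N).injective
      ext1 i
      rw [coeff_finSuccEquiv_homProj, AlgEquiv.apply_symm_apply, homProj_self (h i)]
    rw [← this]
    exact homProj_mem _ _

instance (m : ℤ) : FiniteDimensional k (polyDeg k N m) := by unfold polyDeg; infer_instance

/-- The submodule of `S[x_0]` generated over `S` by the ideal `𝔞` and `1, …, x_0^{j-1}`. -/
def elimSub (𝔞 : Ideal (Polynomial (MvPolynomial (Fin N) k))) (j : ℕ) :
    Submodule (MvPolynomial (Fin N) k) (Polynomial (MvPolynomial (Fin N) k)) :=
  𝔞.restrictScalars (MvPolynomial (Fin N) k) ⊔ Polynomial.degreeLT (MvPolynomial (Fin N) k) j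

variable {𝔞 : Ideal (Polynomial (MvPolynomial (Fin N) k))}

theorem mem_degreeLT_iff_coeff {R : Type*} [CommRing R] {j : ℕ} {F : Polynomial R} :
    F ∈ Polynomial.degreeLT R j ↔ ∀ i, j ≤ i → F.coeff i = 0 := by
  rw [Polynomial.mem_degreeLT, Polynomial.degree_lt_iff_coeff_zero]

/-- Modulo 1, …, x_0^{j-1} only the coefficients of x_0^i with i ≥ j matter. -/
theorem mem_elimSub {j : ℕ} {F : Polynomial (MvPolynomial (Fin N) k)} :
    F ∈ elimSub 𝔞 j ↔ ∃ G ∈ 𝔞, ∀ i, j ≤ i → F.coeff i = G.coeff i := by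
  rw [elimSub, Submodule.mem_sup]
  constructor
  · rintro ⟨G, hG, H, hH, rfl⟩
    exact ⟨G, hG, fun i hi => by rw [Polynomial.coeff_add, mem_degreeLT_iff_coeff.1 hH i hi, add_zero]⟩
  · rintro ⟨G, hG, h⟩
    refine ⟨G, hG, F - G, mem_degreeLT_iff_coeff.2 fun i hi => ?_, by abel⟩
    rw [Polynomial.coeff_sub, h i hi, sub_self]

theorem mem_elimSub_zero {F : Polynomial (MvPolynomial (Fin N) k)} :
    F ∈ elimSub 𝔞 0 ↔ F ∈ 𝔞 := by
  rw [mem_elimSub]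
  constructor
  · rintro ⟨G, hG, h⟩
    have : F = G := Polynomial.ext fun i => h i (Nat.zero_le i)
    rwa [this]
  · exact fun h => ⟨F, h, fun _ _ => rfl⟩

theorem mem_leadingCoeffNth_iff {j : ℕ} {s : MvPolynomial (Fin N) k} :
    s ∈ 𝔞.leadingCoeffNth j ↔ ∃ G ∈ 𝔞, G.coeff j = s ∧ ∀ i, j < i → G.coeff i = 0 := by
  rw [Ideal.leadingCoeffNth, Submodule.mem_map]
  simp only [Polynomial.lcoeff_apply]
  constructor
  · rintro ⟨G, ⟨hd, hG⟩, rfl⟩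
    exact ⟨G, hG, rfl, fun i hi => Polynomial.coeff_eq_zero_of_degree_lt
      ((Polynomial.mem_degreeLE.1 hd).trans_lt (by exact_mod_cast hi))⟩
  · rintro ⟨G, hG, rfl, h⟩
    refine ⟨G, ⟨Polynomial.mem_degreeLE.2 ((Polynomial.degree_le_iff_coeff_zero _ _).2
      fun i hi => h i ?_), hG⟩, rfl⟩
    exact_mod_cast hi

/-- This identifies the kernel of s ↦ s x_0^j into E_j with the partial elimination ideal, and is
the reason for truncating from below. -/
theorem monomial_mem_elimSub {j : ℕ} {s : MvPolynomial (Fin N) k} :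
    Polynomial.monomial j s ∈ elimSub 𝔞 j ↔ s ∈ 𝔞.leadingCoeffNth j := by
  rw [mem_elimSub, mem_leadingCoeffNth_iff]
  refine exists_congr fun G => and_congr_right fun hG => ?_
  constructor
  · intro h
    refine ⟨by rw [← h j le_rfl, Polynomial.coeff_monomial, if_pos rfl], fun i hi => ?_⟩
    rw [← h i hi.le, Polynomial.coeff_monomial, if_neg hi.ne]
  · rintro ⟨h, h'⟩ i hi
    rcases hi.eq_or_lt with rfl | hi
    · rw [h, Polynomial.coeff_monomial, if_pos rfl]
    · rw [h' i hi, Polynomial.coeff_monomial, if_neg hi.ne]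

/-- The graded pieces of `S[x_0] / (𝔞 + ⟨1, …, x_0^{j-1}⟩)`. -/
def elimDeg (𝔞 : Ideal (Polynomial (MvPolynomial (Fin N) k))) (j : ℕ) (m : ℤ) :
    Submodule k (Polynomial (MvPolynomial (Fin N) k) ⧸ elimSub 𝔞 j) :=
  (polyDeg k N m).map ((elimSub 𝔞 j).mkQ.restrictScalars k)

instance (j : ℕ) (m : ℤ) : FiniteDimensional k (elimDeg 𝔞 j m) := by
  unfold elimDeg; infer_instance

theorem isGradedFamily_elimDeg (j : ℕ) : IsGradedFamily (n := N) (elimDeg 𝔞 j) := by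
  rintro m m' i h _ ⟨F, hF, rfl⟩
  refine ⟨(X i : MvPolynomial (Fin N) k) • F, ?_, rfl⟩
  rw [SetLike.mem_coe, mem_polyDeg] at hF ⊢
  intro l
  rw [Polynomial.coeff_smul]
  exact X_mul_mem_homPart (by omega) i (hF l)

/-- `S / K_j → S[x_0] / (𝔞 + ⟨1, …, x_0^{j-1}⟩)`, `s ↦ s x_0^j`. -/
def elimIncl (𝔞 : Ideal (Polynomial (MvPolynomial (Fin N) k))) (j : ℕ) :
    (MvPolynomial (Fin N) k ⧸ 𝔞.leadingCoeffNth j) →ₗ[MvPolynomial (Fin N) k]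
      Polynomial (MvPolynomial (Fin N) k) ⧸ elimSub 𝔞 j :=
  Submodule.mapQ (𝔞.leadingCoeffNth j) (elimSub 𝔞 j) (Polynomial.monomial j) fun _ hs =>
    monomial_mem_elimSub.2 hs

/-- Multiplication by `x_0^a` between the elimination modules. -/
def elimMap (𝔞 : Ideal (Polynomial (MvPolynomial (Fin N) k))) (a i j : ℕ) (h : i = 0 ∨ i + a ≤ j) :
    (Polynomial (MvPolynomial (Fin N) k) ⧸ elimSub 𝔞 i) →ₗ[MvPolynomial (Fin N) k]
      Polynomial (MvPolynomial (Fin N) k) ⧸ elimSub 𝔞 j :=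
  -- For i = 0 the submodule is the ideal itself, stable under x_0^a and contained in every `elimSub
  -- 𝔞 j`. For i > 0 the truncation has to move up by at least a.
  Submodule.mapQ _ _ (LinearMap.mulLeft (MvPolynomial (Fin N) k) (Polynomial.X ^ a)) fun F hF => by
    rw [Submodule.mem_comap, LinearMap.mulLeft_apply, mem_elimSub]
    obtain ⟨G, hG, hFG⟩ := mem_elimSub.1 hF
    refine ⟨Polynomial.X ^ a * G, Ideal.mul_mem_left _ _ hG, fun l hl => ?_⟩
    rw [Polynomial.coeff_X_pow_mul', Polynomial.coeff_X_pow_mul']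
    split_ifs
    · exact hFG _ (by omega)
    · rfl

theorem elimMap_mk (a i j : ℕ) (h : i = 0 ∨ i + a ≤ j) (F : Polynomial (MvPolynomial (Fin N) k)) :
    elimMap 𝔞 a i j h (Submodule.Quotient.mk F) = Submodule.Quotient.mk (Polynomial.X ^ a * F) := rfl

theorem elimMap_elimMap {a b i j l a' b' j' : ℕ} (h : i = 0 ∨ i + a ≤ j) (h₁ : j = 0 ∨ j + b ≤ l)
    (h' : i = 0 ∨ i + a' ≤ j') (h₁' : j' = 0 ∨ j' + b' ≤ l) (hab : a + b = a' + b')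
    (x : Polynomial (MvPolynomial (Fin N) k) ⧸ elimSub 𝔞 i) :
    elimMap 𝔞 b j l h₁ (elimMap 𝔞 a i j h x) = elimMap 𝔞 b' j' l h₁' (elimMap 𝔞 a' i j' h' x) := by
  obtain ⟨F, rfl⟩ := Submodule.Quotient.mk_surjective _ x
  simp only [elimMap_mk, ← mul_assoc, ← pow_add]
  rw [add_comm b, add_comm b', hab]

theorem elimMap_isHomogeneous (a i j : ℕ) (h : i = 0 ∨ i + a ≤ j) :
    IsHomogeneousMap (elimDeg 𝔞 i) (elimDeg 𝔞 j) a (elimMap 𝔞 a i j h) := by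
  rintro m m' hm _ ⟨F, hF, rfl⟩
  refine ⟨Polynomial.X ^ a * F, ?_, rfl⟩
  rw [SetLike.mem_coe, mem_polyDeg] at hF ⊢
  intro l
  rw [Polynomial.coeff_X_pow_mul']
  split_ifs with hl
  · have := hF (l - a)
    rwa [Nat.cast_sub hl, show m - ((l : ℤ) - a) = m' - l by omega] at this
  · exact zero_mem _

/-- A homogeneous element of degree below j involves only powers x_0^i with i < j. -/
theorem elimDeg_eq_bot {j : ℕ} {m : ℤ} (h : m < j) : elimDeg 𝔞 j m = ⊥ := by
  rw [eq_bot_iff]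
  rintro _ ⟨F, hF, rfl⟩
  refine (Submodule.Quotient.mk_eq_zero _).2 (mem_elimSub.2 ⟨0, zero_mem _, fun i hi => ?_⟩)
  exact (mem_homPart.1 (mem_polyDeg.1 hF i)).2 (by omega)

theorem eq_C_of_mem_homPart {n : ℕ} {f : MvPolynomial (Fin n) k} (hf : f ∈ homPart k n 0) :
    f = C (coeff 0 f) := by
  ext d
  rw [coeff_C]
  split_ifs with h
  · rw [h]
  · by_contra hne
    have := mem_homPart_iff_coeff.1 hf d hne
    exact h ((Finsupp.degree_eq_zero_iff d).1 (by exact_mod_cast this)).symm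

/-- The lowest degree part of the elimination module is spanned by `x_0^j`. -/
theorem elimMap_injective_lowest {a j l : ℕ} (hl : l = j + a) (hK : 𝔞.leadingCoeffNth l ≠ ⊤)
    {m : ℤ} (hm : m = j)
    {x : Polynomial (MvPolynomial (Fin N) k) ⧸ elimSub 𝔞 j} (hx : x ∈ elimDeg 𝔞 j m)
    (h0 : elimMap 𝔞 a j l (Or.inr hl.ge) x = 0) : x = 0 := by
  obtain ⟨F, hF, rfl⟩ := hx
  rw [SetLike.mem_coe, mem_polyDeg] at hF
  obtain ⟨G, hG, hFG⟩ := mem_elimSub.1 ((Submodule.Quotient.mk_eq_zero _).1 h0)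
  simp only [LinearMap.mulLeft_apply, Polynomial.coeff_X_pow_mul'] at hFG
  have hF0 : ∀ i, j < i → F.coeff i = 0 := fun i hi => (mem_homPart.1 (hF i)).2 (by omega)
  have hmem : F.coeff j ∈ 𝔞.leadingCoeffNth l := by
    refine mem_leadingCoeffNth_iff.2 ⟨G, hG, ?_, fun i hi => ?_⟩
    · rw [← hFG l le_rfl, if_pos (by omega), show l - a = j by omega]
    · rw [← hFG i hi.le, if_pos (by omega), hF0 _ (by omega)]
  have hj := hF j
  rw [hm, sub_self] at hj
  rw [eq_C_of_mem_homPart hj] at hmem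
  have hc : coeff 0 (F.coeff j) = 0 := by
    by_contra hne
    exact hK (Ideal.eq_top_of_isUnit_mem _ hmem ((isUnit_iff_ne_zero.2 hne).map C))
  refine (Submodule.Quotient.mk_eq_zero _).2 (mem_elimSub.2 ⟨0, zero_mem _, fun i hi => ?_⟩)
  rcases hi.eq_or_lt with rfl | hi
  · rw [eq_C_of_mem_homPart hj, hc, map_zero, Polynomial.coeff_zero]
  · rw [hF0 i hi, Polynomial.coeff_zero]

variable {I : Ideal (MvPolynomial (Fin (N + 1)) k)}

/-- The ideal of `k[x_1, …, x_N][x_0]` that corresponds to an ideal of `k[x_0, …, x_N]`. -/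
abbrev polyIdeal (I : Ideal (MvPolynomial (Fin (N + 1)) k)) :
    Ideal (Polynomial (MvPolynomial (Fin N) k)) :=
  I.map (finSuccEquiv k N : MvPolynomial (Fin (N + 1)) k →ₐ[k] Polynomial (MvPolynomial (Fin N) k))

theorem mem_polyIdeal {F : Polynomial (MvPolynomial (Fin N) k)} :
    F ∈ polyIdeal I ↔ (finSuccEquiv k N).symm F ∈ I := by
  constructor
  · intro h
    obtain ⟨f, hf, rfl⟩ := (Ideal.mem_map_iff_of_surjective _ (finSuccEquiv k N).surjective).1 h
    exact ((finSuccEquiv k N).symm_apply_apply f).symm ▸ hf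
  · intro h
    have := Ideal.mem_map_of_mem (finSuccEquiv k N : MvPolynomial (Fin (N + 1)) k →ₐ[k]
      Polynomial (MvPolynomial (Fin N) k)) h
    change finSuccEquiv k N ((finSuccEquiv k N).symm F) ∈ _ at this
    rwa [AlgEquiv.apply_symm_apply] at this

/-- Homogeneous components of elements of `polyIdeal I`. -/
theorem exists_homogeneous_polyIdeal (hI : I.IsHomogeneous (homogeneousSubmodule (Fin (N + 1)) k))
    {G : Polynomial (MvPolynomial (Fin N) k)} (hG : G ∈ polyIdeal I) (m : ℤ) :
    ∃ H ∈ polyIdeal I, H ∈ polyDeg k N m ∧ ∀ i : ℕ, H.coeff i = homProj k N (m - i) (G.coeff i) := by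
  have hG' := mem_polyIdeal.1 hG
  refine ⟨finSuccEquiv k N (homProj k (N + 1) m ((finSuccEquiv k N).symm G)), ?_, ?_, fun i => ?_⟩
  · rw [mem_polyIdeal, AlgEquiv.symm_apply_apply]
    exact homProj_mem_ideal hI m hG'
  · exact ⟨_, homProj_mem _ _, rfl⟩
  · rw [coeff_finSuccEquiv_homProj, AlgEquiv.apply_symm_apply]

/-- Passing from E_j to E_{j+1} kills exactly the multiples of x_0^j, which form a copy of S/K_j
shifted by j. All comparisons between R/I and the partial elimination ideals rest on these
sequences. -/
theorem gradedShortExact_elim (hI : I.IsHomogeneous (homogeneousSubmodule (Fin (N + 1)) k)) (j : ℕ) :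
    GradedShortExact (quotDeg ((polyIdeal I).leadingCoeffNth j)) (elimDeg (polyIdeal I) j)
      (elimDeg (polyIdeal I) (j + 1)) j (elimIncl (polyIdeal I) j)
      (elimMap (polyIdeal I) 0 j (j + 1) (Or.inr (Nat.le_succ j))) where
  graded := isGradedFamily_elimDeg j
  hom₁ := by
    rintro m m' h _ ⟨s, hs, rfl⟩
    refine ⟨Polynomial.monomial j s, ?_, rfl⟩
    rw [SetLike.mem_coe, mem_polyDeg]
    intro i
    rw [Polynomial.coeff_monomial]
    split_ifs with hi
    · rwa [show m' - i = m by omega]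
    · exact zero_mem _
  hom₂ := elimMap_isHomogeneous 0 _ _ _
  inj := by
    rw [injective_iff_map_eq_zero]
    intro x hx
    obtain ⟨s, rfl⟩ := Submodule.Quotient.mk_surjective _ x
    exact (Submodule.Quotient.mk_eq_zero _).2
      (monomial_mem_elimSub.1 ((Submodule.Quotient.mk_eq_zero _).1 hx))
  comp x := by
    obtain ⟨s, rfl⟩ := Submodule.Quotient.mk_surjective _ x
    refine (Submodule.Quotient.mk_eq_zero _).2 (mem_elimSub.2 ⟨0, zero_mem _, fun i hi => ?_⟩)
    change (Polynomial.X ^ 0 * Polynomial.monomial j s).coeff i = _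
    rw [pow_zero, one_mul, Polynomial.coeff_monomial, if_neg (by omega), Polynomial.coeff_zero]
  exact := by
    rintro m m' h _ ⟨F, hF, rfl⟩ h0
    obtain ⟨G, hG, hFG⟩ := mem_elimSub.1 ((Submodule.Quotient.mk_eq_zero _).1 h0)
    simp only [LinearMap.mulLeft_apply, pow_zero, one_mul] at hFG
    -- The element of I comparing F with zero may be inhomogeneous; its component in the degree of F
    -- does the same job and gives a homogeneous preimage.
    obtain ⟨H, hH, hHd, hHG⟩ := exists_homogeneous_polyIdeal hI hG m'
    rw [SetLike.mem_coe] at hF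
    refine ⟨Submodule.Quotient.mk (F.coeff j - H.coeff j), ⟨_, ?_, rfl⟩, ?_⟩
    · have h1 := mem_polyDeg.1 (sub_mem hF hHd) j
      rwa [Polynomial.coeff_sub, show m' - j = m by omega] at h1
    · refine (Submodule.Quotient.eq _).2 (mem_elimSub.2 ⟨-H, neg_mem hH, fun i hi => ?_⟩)
      rw [Polynomial.coeff_sub, Polynomial.coeff_monomial, Polynomial.coeff_neg]
      rcases hi.eq_or_lt with rfl | hi
      · rw [if_pos rfl]; abel
      · rw [if_neg hi.ne, zero_sub, hHG i, ← hFG i hi, homProj_self (mem_polyDeg.1 hF i)]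
  surj := by
    rintro m _ ⟨F, hF, rfl⟩
    refine ⟨Submodule.Quotient.mk F, ⟨F, hF, rfl⟩, ?_⟩
    rw [elimMap_mk, pow_zero, one_mul]
    rfl

/-- `R / I` as the elimination module of index `0`. -/
def quotientElimEquiv (I : Ideal (MvPolynomial (Fin (N + 1)) k)) :
    (MvPolynomial (Fin (N + 1)) k ⧸ I) ≃ₗ[k]
      Polynomial (MvPolynomial (Fin N) k) ⧸ elimSub (polyIdeal I) 0 :=
  LinearEquiv.ofBijective
    (Submodule.mapQ (I.restrictScalars k) ((elimSub (polyIdeal I) 0).restrictScalars k)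
      (finSuccEquiv k N).toLinearMap fun f hf => by
        refine mem_elimSub_zero.2 (mem_polyIdeal.2 ?_)
        change (finSuccEquiv k N).symm (finSuccEquiv k N f) ∈ I
        rwa [AlgEquiv.symm_apply_apply])
    ⟨by
      rw [injective_iff_map_eq_zero]
      intro x hx
      obtain ⟨f, rfl⟩ := Submodule.Quotient.mk_surjective _ x
      have := mem_polyIdeal.1 (mem_elimSub_zero.1 ((Submodule.Quotient.mk_eq_zero _).1 hx))
      change (finSuccEquiv k N).symm (finSuccEquiv k N f) ∈ I at this
      rw [AlgEquiv.symm_apply_apply] at this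
      exact (Submodule.Quotient.mk_eq_zero I).2 this,
    fun y => by
      obtain ⟨F, rfl⟩ := Submodule.Quotient.mk_surjective _ y
      refine ⟨Submodule.Quotient.mk ((finSuccEquiv k N).symm F), ?_⟩
      change Submodule.Quotient.mk (finSuccEquiv k N ((finSuccEquiv k N).symm F)) = _
      rw [AlgEquiv.apply_symm_apply]⟩

theorem quotientElimEquiv_mk (f : MvPolynomial (Fin (N + 1)) k) :
    quotientElimEquiv I (Ideal.Quotient.mk I f) = Submodule.Quotient.mk (finSuccEquiv k N f) := rfl

theorem quotientElimEquiv_X_zero_smul (x : MvPolynomial (Fin (N + 1)) k ⧸ I) :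
    quotientElimEquiv I ((X 0 : MvPolynomial (Fin (N + 1)) k) • x) =
      elimMap (polyIdeal I) 1 0 0 (Or.inl rfl) (quotientElimEquiv I x) := by
  obtain ⟨f, rfl⟩ := Ideal.Quotient.mk_surjective x
  change quotientElimEquiv I (Ideal.Quotient.mk I (X 0 * f)) = _
  rw [quotientElimEquiv_mk, quotientElimEquiv_mk, map_mul, finSuccEquiv_X_zero, elimMap_mk, pow_one]

theorem quotientElimEquiv_X_succ_smul (i : Fin N) (x : MvPolynomial (Fin (N + 1)) k ⧸ I) :
    quotientElimEquiv I ((X i.succ : MvPolynomial (Fin (N + 1)) k) • x) =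
      (X i : MvPolynomial (Fin N) k) • quotientElimEquiv I x := by
  obtain ⟨f, rfl⟩ := Ideal.Quotient.mk_surjective x
  change quotientElimEquiv I (Ideal.Quotient.mk I (X i.succ * f)) = _
  rw [quotientElimEquiv_mk, quotientElimEquiv_mk, map_mul, finSuccEquiv_X_succ,
    ← Polynomial.smul_eq_C_mul]
  rfl

theorem quotientElimEquiv_mem (m : ℤ) (x : MvPolynomial (Fin (N + 1)) k ⧸ I) :
    quotientElimEquiv I x ∈ elimDeg (polyIdeal I) 0 m ↔ x ∈ quotDeg I m := by
  constructor
  · rintro ⟨F, ⟨f, hf, rfl⟩, hx⟩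
    refine ⟨f, hf, (quotientElimEquiv I).injective ?_⟩
    rw [← hx]
    rfl
  · rintro ⟨f, hf, rfl⟩
    exact ⟨finSuccEquiv k N f, ⟨f, hf, rfl⟩, rfl⟩

theorem finSuccEquiv_symm_C (s : MvPolynomial (Fin N) k) :
    (finSuccEquiv k N).symm (Polynomial.C s) = rename Fin.succ s := by
  rw [AlgEquiv.symm_apply_eq]
  induction s using MvPolynomial.induction_on with
  | C a => rw [rename_C, finSuccEquiv_apply]; simp
  | add p q hp hq => rw [map_add, hp, hq, map_add, map_add]
  | mul_X p i hp => rw [map_mul, hp, map_mul, map_mul, rename_X, finSuccEquiv_X_succ]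

theorem leadingCoeffNth_zero_polyIdeal : (polyIdeal I).leadingCoeffNth 0 = projIdeal I := by
  ext s
  rw [Ideal.mem_leadingCoeffNth_zero, mem_polyIdeal, finSuccEquiv_symm_C]
  rfl

theorem leadingCoeffNth_isHomogeneous
    (hI : I.IsHomogeneous (homogeneousSubmodule (Fin (N + 1)) k)) (j : ℕ) :
    ((polyIdeal I).leadingCoeffNth j).IsHomogeneous (homogeneousSubmodule (Fin N) k) := by
  intro m s hs
  obtain ⟨G, hG, rfl, hG0⟩ := mem_leadingCoeffNth_iff.1 hs
  obtain ⟨H, hH, -, hHG⟩ := exists_homogeneous_polyIdeal hI hG (m + j)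
  rw [show (DirectSum.decompose (homogeneousSubmodule (Fin N) k) (G.coeff j) m :
    MvPolynomial (Fin N) k) = homogeneousComponent m (G.coeff j) from
    decomposition.decompose'_apply _ _]
  refine mem_leadingCoeffNth_iff.2 ⟨H, hH, ?_, fun i hi => by rw [hHG, hG0 i hi, map_zero]⟩
  rw [hHG, add_sub_cancel_right]
  simp [homProj]

/-- If all elements of `I` vanish at `(1 : 0 : … : 0)`, then all partial elimination ideals are
proper. -/
theorem leadingCoeffNth_ne_top (hI : I.IsHomogeneous (homogeneousSubmodule (Fin (N + 1)) k))
    (hq : ∀ f ∈ I, eval (Pi.single 0 1) f = 0) (j : ℕ) : (polyIdeal I).leadingCoeffNth j ≠ ⊤ := by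
  intro h
  obtain ⟨G, hG, hG1, hG0⟩ := mem_leadingCoeffNth_iff.1
    (h ▸ Submodule.mem_top (x := (1 : MvPolynomial (Fin N) k)))
  obtain ⟨H, hH, hHd, hHG⟩ := exists_homogeneous_polyIdeal hI hG j
  -- At x_1 = … = x_N = 0 all coefficients of positive degree vanish, so H becomes x_0^j, which is
  -- nonzero at (1 : 0 : … : 0).
  have hH' : H.map (eval (0 : Fin N → k)) = Polynomial.X ^ j := by
    ext i
    rw [Polynomial.coeff_map, Polynomial.coeff_X_pow]
    rcases lt_trichotomy i j with hi | rfl | hi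
    · have h1 := mem_polyDeg.1 hHd i
      rw [← Nat.cast_sub hi.le, mem_homPart_natCast] at h1
      rw [if_neg hi.ne, eval_zero, constantCoeff_eq, h1.coeff_eq_zero]
      rw [map_zero]
      omega
    · rw [hHG, hG1, sub_self, homProj_self, map_one, if_pos rfl]
      rw [show (0 : ℤ) = ((0 : ℕ) : ℤ) from rfl, mem_homPart_natCast]
      exact isHomogeneous_one _ _
    · rw [hHG, hG0 i hi, map_zero, map_zero, if_neg hi.ne']
  have key := hq _ (mem_polyIdeal.1 hH)
  have hcons : (Pi.single 0 1 : Fin (N + 1) → k) = Fin.cons 1 0 := by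
    funext i
    refine Fin.cases ?_ (fun i => ?_) i <;> simp
  rw [hcons, eval_eq_eval_mv_eval', AlgEquiv.apply_symm_apply, hH', Polynomial.eval_pow,
    Polynomial.eval_X, one_pow] at key
  exact one_ne_zero key

end Elimination

/-! ### Linear syzygies and elimination -/

section LinearAlgebra

variable {k U V W U' : Type*} [Field k] [AddCommGroup U] [Module k U] [AddCommGroup V] [Module k V]
  [AddCommGroup W] [Module k W] [AddCommGroup U'] [Module k U']

theorem finrank_add_finrank_range_of_exact [FiniteDimensional k V] {f : U →ₗ[k] V} {g : V →ₗ[k] W}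
    (hf : Function.Injective f) (h : ∀ x, g x = 0 ↔ ∃ y, f y = x) :
    Module.finrank k U + Module.finrank k (LinearMap.range g) = Module.finrank k V := by
  have hker : LinearMap.ker g = LinearMap.range f := Submodule.ext h
  have := LinearMap.finrank_range_add_finrank_ker g
  rw [hker, LinearMap.finrank_range_of_inj hf] at this
  omega

/-- Since ker g lies in the image of the injective map f, it is a copy of ker (g ∘ f). -/
theorem finrank_ker_add_finrank_range_comp [FiniteDimensional k U] {f : U →ₗ[k] V} {g : V →ₗ[k] W}
    (hf : Function.Injective f) (h : ∀ x, g x = 0 → ∃ y, f y = x) :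
    Module.finrank k (LinearMap.ker g) + Module.finrank k (LinearMap.range (g ∘ₗ f)) =
      Module.finrank k U := by
  have hker : LinearMap.ker g = (LinearMap.ker (g ∘ₗ f)).map f := by
    rw [LinearMap.ker_comp, Submodule.map_comap_eq, right_eq_inf]
    exact fun x hx => h x hx
  rw [hker, ← (Submodule.equivMapOfInjective f hf _).finrank_eq, add_comm]
  exact LinearMap.finrank_range_add_finrank_ker _

/-- The map g sends the range of ρ into the range of f', with kernel inside the range of f. Thus
rank ρ ≤ rank f + dim U', and rank-nullity for f finishes. -/
theorem finrank_ker_add_finrank_range_le {U₁ : Type*} [AddCommGroup U₁] [Module k U₁]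
    [FiniteDimensional k U] [FiniteDimensional k V] [FiniteDimensional k U'] {f : U →ₗ[k] V}
    {g : V →ₗ[k] W} {f' : U' →ₗ[k] W} {ρ : U₁ →ₗ[k] V} (h : ∀ x, g x = 0 → ∃ y, f y = x)
    (h' : ∀ y, ∃ z, f' z = g (ρ y)) :
    Module.finrank k (LinearMap.ker f) + Module.finrank k (LinearMap.range ρ) ≤
      Module.finrank k U + Module.finrank k U' := by
  have h1 := LinearMap.finrank_range_add_finrank_ker f
  have h2 := LinearMap.finrank_range_add_finrank_ker (g.domRestrict (LinearMap.range ρ))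
  have h3 : Module.finrank k (LinearMap.range (g.domRestrict (LinearMap.range ρ))) ≤
      Module.finrank k U' := by
    refine le_trans (Submodule.finrank_mono ?_) (LinearMap.finrank_range_le f')
    rintro _ ⟨⟨_, y, rfl⟩, rfl⟩
    exact h' y
  have h4 : Module.finrank k (LinearMap.ker (g.domRestrict (LinearMap.range ρ))) ≤
      Module.finrank k (LinearMap.range f) := by
    rw [← Submodule.finrank_map_subtype_eq]
    refine Submodule.finrank_mono ?_
    rintro _ ⟨x, hx, rfl⟩
    exact h _ hx
  omega

end LinearAlgebra

/-! ### Tor sequences of the elimination modules and the linear strand -/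

section EliminationTor

variable {k : Type*} [Field k] {N : ℕ}

/-- `Tor` of `S / K_j`, where `K_j` is the partial elimination ideal. -/
abbrev CoeffTor (I : Ideal (MvPolynomial (Fin (N + 1)) k)) (j : ℕ) (p q : ℤ) : Type _ :=
  KoszulTor N (quotDeg ((polyIdeal I).leadingCoeffNth j)) p q

/-- `Tor` of the elimination module of index `j`. -/
abbrev ElimTor (I : Ideal (MvPolynomial (Fin (N + 1)) k)) (j : ℕ) (p q : ℤ) : Type _ :=
  KoszulTor N (elimDeg (polyIdeal I) j) p q

/-- Multiplication by `x_0^a` on `Tor` of the elimination modules. -/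
def torShift (I : Ideal (MvPolynomial (Fin (N + 1)) k)) (a i j : ℕ) (h : i = 0 ∨ i + a ≤ j) (p : ℤ)
    {q q' : ℤ} (hq : q' = q + a) : ElimTor I i p q →ₗ[k] ElimTor I j p q' :=
  torMap (elimMap_isHomogeneous a i j h) p hq

variable {I : Ideal (MvPolynomial (Fin (N + 1)) k)}

theorem torShift_torShift {a b i j l a' b' j' : ℕ} (h : i = 0 ∨ i + a ≤ j)
    (h₁ : j = 0 ∨ j + b ≤ l) (h' : i = 0 ∨ i + a' ≤ j') (h₁' : j' = 0 ∨ j' + b' ≤ l)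
    (hab : a + b = a' + b') (p : ℤ) {q q₁ q₂ q₃ : ℤ} (hq₁ : q₁ = q + a) (hq₂ : q₂ = q₁ + b)
    (hq₃ : q₃ = q + a') (hq₄ : q₂ = q₃ + b') (x : ElimTor I i p q) :
    torShift I b j l h₁ p hq₂ (torShift I a i j h p hq₁ x) =
      torShift I b' j' l h₁' p hq₄ (torShift I a' i j' h' p hq₃ x) :=
  torMap_torMap _ _ _ _ (elimMap_elimMap h h₁ h' h₁' hab) p _ _ _ _ x

theorem torShift_zero_self (i : ℕ) (p q : ℤ) (hq : q = q + (0 : ℕ)) (h : i = 0 ∨ i + 0 ≤ i)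
    (x : ElimTor I i p q) : torShift I 0 i i h p hq x = x := by
  obtain ⟨z, hz, hd, rfl⟩ := exists_homologyClass x
  rw [torShift, torMap_class]
  congr 1
  funext s
  rw [koszulMap_apply]
  obtain ⟨F, hF⟩ := Submodule.Quotient.mk_surjective _ (z s)
  rw [← hF, elimMap_mk, pow_zero, one_mul]

theorem torShift_comp {a b c i j l : ℕ} (h : i = 0 ∨ i + a ≤ j)
    (h₁ : j = 0 ∨ j + b ≤ l) (h₂ : i = 0 ∨ i + c ≤ l) (hc : c = a + b) (p : ℤ) {q q₁ q₂ : ℤ}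
    (hq₁ : q₁ = q + a) (hq₂ : q₂ = q₁ + b) (hq₃ : q₂ = q + c) (x : ElimTor I i p q) :
    torShift I b j l h₁ p hq₂ (torShift I a i j h p hq₁ x) = torShift I c i l h₂ p hq₃ x := by
  rw [torShift_torShift (b' := 0) h h₁ h₂ (Or.inr le_rfl) (by omega) p hq₁ hq₂ hq₃ (by simp),
    torShift_zero_self]

theorem subsingleton_elimTor {j : ℕ} {p q : ℤ} (h : q < j) : Subsingleton (ElimTor I j p q) :=
  subsingleton_tor_of_deg_eq_bot (elimDeg_eq_bot h)

/-- The map on `Tor` that is induced by `S / K_j → S[x_0] / (I + ⟨1, …, x_0^{j-1}⟩)`. -/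
def torIncl (hI : I.IsHomogeneous (homogeneousSubmodule (Fin (N + 1)) k)) (j : ℕ) (p : ℤ)
    {q q' : ℤ} (hq : q' = q + j) : CoeffTor I j p q →ₗ[k] ElimTor I j p q' :=
  torMap (gradedShortExact_elim hI j).hom₁ p hq

variable (hI : I.IsHomogeneous (homogeneousSubmodule (Fin (N + 1)) k))

include hI

theorem torShift_eq_zero_iff {j l : ℕ} (hl : l = j + 1) {p q q' : ℤ} (hq : q' = q + j)
    {h : j = 0 ∨ j + 0 ≤ l} {hq' : q' = q' + (0 : ℕ)} (x : ElimTor I j p q') :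
    torShift I 0 j l h p hq' x = 0 ↔ ∃ y, torIncl hI j p hq y = x := by
  subst hl
  exact (gradedShortExact_elim hI j).tor_exact p hq x

theorem torShift_torIncl {j l : ℕ} (hl : l = j + 1) {p q q' : ℤ} (hq : q' = q + j)
    {h : j = 0 ∨ j + 0 ≤ l} {hq' : q' = q' + (0 : ℕ)} (y : CoeffTor I j p q) :
    torShift I 0 j l h p hq' (torIncl hI j p hq y) = 0 :=
  (torShift_eq_zero_iff hI hl hq _).2 ⟨y, rfl⟩

theorem finrank_ker_torIncl {j l : ℕ} (hl : l = j + 1) {p p' q q' q₁ : ℤ} (hp : p = p' + 1)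
    (hq : q₁ = q' + j) (hq₁ : q₁ = q + 1) {h : j = 0 ∨ j + 0 ≤ l} {hq' : q = q + (0 : ℕ)} :
    Module.finrank k (LinearMap.ker (torIncl hI j p' hq)) + Module.finrank k
      (LinearMap.range (torShift I 0 j l h p hq')) = Module.finrank k (ElimTor I l p q) := by
  subst hl
  exact (gradedShortExact_elim hI j).tor_connecting hp hq hq₁

theorem torShift_injective {j l : ℕ} (hl : l = j + 1) {p q q' : ℤ} (hq : q' = q + j)
    (h0 : Subsingleton (CoeffTor I j p q)) {h : j = 0 ∨ j + 0 ≤ l} {hq' : q' = q' + (0 : ℕ)} :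
    Function.Injective (torShift I 0 j l h p hq') := by
  rw [injective_iff_map_eq_zero]
  intro x hx
  obtain ⟨y, rfl⟩ := (torShift_eq_zero_iff hI hl hq x).1 hx
  rw [Subsingleton.elim y 0, map_zero]

theorem torShift_surjective {j l : ℕ} (hl : l = j + 1) {p p' q q' : ℤ} (hp : p = p' + 1)
    (hq : q + 1 = q' + j) (h0 : Subsingleton (CoeffTor I j p' q')) {h : j = 0 ∨ j + 0 ≤ l}
    {hq' : q = q + (0 : ℕ)} : Function.Surjective (torShift I 0 j l h p hq') := by
  subst hl
  exact (gradedShortExact_elim hI j).torMap_surjective hp hq h0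

/-- The connecting map into this group starts at Tor_{p+1}(E_{j+1}) in degree q' - 1 < j + 1, where
E_{j+1} is zero. -/
theorem torIncl_injective {j : ℕ} {p q q' : ℤ} (hq : q' = q + j) (h : q' ≤ j + 1) :
    Function.Injective (torIncl hI j p hq) :=
  (gradedShortExact_elim hI j).torMap_injective (p := p + 1) rfl hq (sub_add_cancel q' 1).symm
    (subsingleton_elimTor (by push_cast; omega))

/-- The mapping cone count for R/I = E_0 with ξ = x_0. It is the only passage from Tor over R to Tor
over S. -/
theorem finrank_tor_quotient {p p' q q₀ q₁ : ℤ} (hp : p = p' + 1) (hq : q = q₀ + (1 : ℕ))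
    (hq₁ : q₁ = q + (1 : ℕ)) :
    bettiQuot I p q + Module.finrank k (LinearMap.range (torShift I 1 0 0 (Or.inl rfl) p hq)) =
      Module.finrank k (ElimTor I 0 p q) +
        Module.finrank k (LinearMap.ker (torShift I 1 0 0 (Or.inl rfl) p' hq₁)) :=
  finrank_tor_cone (χ := quotientElimEquiv I) (ξ := elimMap (polyIdeal I) 1 0 0 (Or.inl rfl))
    (isGradedFamily_quotDeg I) quotientElimEquiv_X_zero_smul quotientElimEquiv_X_succ_smul
    quotientElimEquiv_mem (elimMap_isHomogeneous 1 0 0 (Or.inl rfl)) hp hq hq₁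

/-- The cokernel of x_0 on Tor_p(E_0) embeds into Tor_p(R/I), and the latter maps onto the kernel of
x_0 on Tor_{p-1}(E_0); the second fact gives `torShift_injective_of_bettiQuot`. -/
theorem torShift_surjective_of_bettiQuot {p q q₀ : ℤ} (hq : q = q₀ + (1 : ℕ))
    (h : bettiQuot I p q = 0) :
    Function.Surjective (torShift I 1 0 0 (Or.inl rfl) p hq) := by
  have := finrank_tor_quotient hI (sub_add_cancel p 1).symm hq rfl
  have hle := Submodule.finrank_le (LinearMap.range (torShift I 1 0 0 (Or.inl rfl) p hq))
  rw [h, zero_add] at this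
  exact LinearMap.range_eq_top.1 (Submodule.eq_top_of_finrank_eq (by omega))

theorem torShift_injective_of_bettiQuot {p p' q q₁ : ℤ} (hp : p = p' + 1) (hq₁ : q₁ = q + (1 : ℕ))
    (h : bettiQuot I p q = 0) :
    Function.Injective (torShift I 1 0 0 (Or.inl rfl) p' hq₁) := by
  have h1 : q = (q - 1) + (1 : ℕ) := by push_cast; ring
  have := finrank_tor_quotient hI hp h1 hq₁
  have hle := Submodule.finrank_le (LinearMap.range (torShift I 1 0 0 (Or.inl rfl) p h1))
  rw [h, zero_add] at this
  exact LinearMap.ker_eq_bot.1 (Submodule.finrank_eq_zero.1 (by omega))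

variable (hv : ∀ f ∈ I, eval (Pi.single 0 1) f = 0)

include hv

omit hI in
theorem projIdeal_ne_top : projIdeal I ≠ ⊤ := by
  intro h
  have h1 := hv _ (show rename Fin.succ 1 ∈ I from
    (h ▸ Submodule.mem_top : (1 : MvPolynomial (Fin N) k) ∈ projIdeal I))
  rw [map_one, map_one] at h1
  exact one_ne_zero h1

/-- The degree j part of E_j is spanned by x_0^j, whose multiple x_0^l is nonzero in E_l because K_l
is proper. In the lowest strand there are no boundaries, so injectivity passes to Tor. -/
theorem torShift_injective_lowest {a j l : ℕ} (hl : l = j + a) (p : ℤ) {q q' : ℤ} (hq : q' = q + a)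
    (hj : q = j) : Function.Injective (torShift I a j l (Or.inr hl.ge) p hq) :=
  torMap_injective_of_lowest _ p hq (elimDeg_eq_bot (by omega)) fun _ hx h0 =>
    elimMap_injective_lowest hl (leadingCoeffNth_ne_top hI hv l) hj hx h0

/-- The dimension of `Tor_p` of the first elimination module in the lowest degree. -/
theorem finrank_elimTor_one (p : ℕ) : Module.finrank k (ElimTor I 1 p 1) =
    (numLinearForms ((polyIdeal I).leadingCoeffNth 1)).choose p := by
  rw [← bettiQuot_zero_right (leadingCoeffNth_ne_top hI hv 1)]
  refine (LinearEquiv.finrank_eq (LinearEquiv.ofBijective (torIncl hI 1 p (q := 0) (q' := 1) rfl)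
    ⟨torIncl_injective hI _ (by norm_num), fun x => ?_⟩)).symm
  rw [← torShift_eq_zero_iff hI (l := 2) (h := Or.inr (by omega)) (hq' := by simp) rfl]
  exact @Subsingleton.elim _ (subsingleton_elimTor (by norm_num)) _ _

variable (hn : numLinearForms (projIdeal I) = 0)

include hn

/-- The place where nondegeneracy acts: Tor_p(S/K_0)_0 has dimension binom(0, p) = 0, and E_1
contributes nothing in degree 0. -/
theorem subsingleton_elimTor_zero {p : ℤ} (hp : 1 ≤ p) : Subsingleton (ElimTor I 0 p 0) := by
  have h1 : Subsingleton (CoeffTor I 0 p 0) := by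
    apply subsingleton_tor_of_bettiQuot
    lift p to ℕ using by omega
    rw [leadingCoeffNth_zero_polyIdeal, bettiQuot_zero_right (projIdeal_ne_top hv), hn]
    exact Nat.choose_eq_zero_of_lt (by omega)
  refine subsingleton_of_forall_eq 0 fun x => ?_
  exact torShift_injective hI (j := 0) (l := 1) rfl (q := 0) (q' := 0) rfl h1 (h := Or.inl rfl)
    (hq' := by simp) (@Subsingleton.elim _ (subsingleton_elimTor (by norm_num)) _ _)

/-- The number of linear syzygies of `I`, in terms of those of the projection and two correction
terms. -/
theorem bettiQuot_one_eq (p' : ℕ) :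
    bettiQuot I (p' + 1) 1 +
      (Module.finrank k (LinearMap.ker (torIncl hI 0 p' (q := 2) (q' := 2) rfl)) +
      Module.finrank k (LinearMap.range (torShift I 1 0 0 (Or.inl rfl) p' (q := 1) (q' := 2) rfl ∘ₗ
        torIncl hI 0 p' (q := 1) (q' := 1) rfl))) =
      bettiQuot (projIdeal I) (p' + 1) 1 + bettiQuot (projIdeal I) p' 1 +
        (numLinearForms ((polyIdeal I).leadingCoeffNth 1)).choose (p' + 1) := by
  have hβ : ∀ p q : ℤ, Module.finrank k (CoeffTor I 0 p q) = bettiQuot (projIdeal I) p q := by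
    intro p q
    rw [← leadingCoeffNth_zero_polyIdeal]
    rfl
  -- Since Tor_{p'+1}(E_0)_0 = 0, the Betti number is dim Tor_{p'+1}(E_0)_1 plus the dimension of
  -- the kernel of x_0 on Tor_{p'}(E_0)_1.
  have hcone := finrank_tor_quotient hI (p := p' + 1) (p' := p') (q₀ := 0) (q := 1) (q₁ := 2) rfl rfl rfl
  have h0 := subsingleton_elimTor_zero hI hv hn (p := p' + 1) (by omega)
  rw [finrank_range_eq_zero_of_subsingleton _ h0, add_zero] at hcone
  -- The first summand is β_{p'+1,1} of the projection plus the rank of the map to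
  -- Tor_{p'+1}(E_1)_1. That target has dimension binom(t, p'+1), and the defect of the rank is the
  -- first correction.
  have hδ := finrank_ker_torIncl hI (j := 0) (l := 1) rfl (p := p' + 1) (p' := p') (q := 1)
    (q' := 2) (q₁ := 2) rfl rfl rfl (h := Or.inl rfl) (hq' := by simp)
  have hone := finrank_elimTor_one hI hv (p' + 1)
  push_cast at hone
  rw [hone] at hδ
  have hπ := finrank_add_finrank_range_of_exact
    (torIncl_injective hI (j := 0) (p := p' + 1) (q := 1) (q' := 1) rfl (by norm_num))
    (torShift_eq_zero_iff hI (j := 0) (l := 1) rfl (p := p' + 1) (q := 1) (q' := 1) rfl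
      (h := Or.inl rfl) (hq' := by simp))
  -- If x_0 x = 0, the image of x in the lowest strand of E_1 is killed by the injective map x_0 :
  -- E_1 → E_2, so x comes from S/K_0. The kernel of x_0 is therefore β_{p',1} minus the second
  -- correction.
  have hρ := finrank_ker_add_finrank_range_comp
    (g := torShift I 1 0 0 (Or.inl rfl) p' (q := 1) (q' := 2) rfl)
    (torIncl_injective hI (j := 0) (p := p') (q := 1) (q' := 1) rfl (by norm_num)) fun x hx => by
      refine (torShift_eq_zero_iff hI (l := 1) (h := Or.inl rfl) (hq' := by simp) rfl _ x).1 ?_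
      apply torShift_injective_lowest hI hv (a := 1) (j := 1) (l := 2) rfl p' (q := 1) (q' := 2)
        rfl rfl
      rw [torShift_torShift (a := 0) (b := 1) (j := 1) (a' := 1) (b' := 0) (j' := 0) (l := 2)
        (q₃ := 2) _ _ (Or.inl rfl) (Or.inl rfl) rfl p' _ _ rfl (by simp), map_zero, hx, map_zero]
  have h1 := hβ (p' + 1) 1
  have h2 := hβ p' 1
  omega

omit hv hn in
-- The class y vanishes in E_1, so x_0 y vanishes in E_2. Hence its image in E_1 comes from S/K_1.
theorem torShift_torIncl_mem {p : ℤ} (y : CoeffTor I 0 p 1) :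
    ∃ z, torIncl hI 1 p (q := 1) (q' := 2) rfl z =
      torShift I 0 0 1 (Or.inl rfl) p (q := 2) (q' := 2) (by simp)
        (torShift I 1 0 0 (Or.inl rfl) p (q := 1) (q' := 2) rfl
          (torIncl hI 0 p (q := 1) (q' := 1) rfl y)) := by
  rw [← torShift_eq_zero_iff hI (l := 2) (h := Or.inr (by omega)) (hq' := by simp) rfl]
  rw [torShift_comp (c := 0) _ _ (Or.inl rfl) rfl p _ _ (by simp),
    torShift_torShift (a := 1) (b := 0) (j := 0) (a' := 0) (b' := 1) (j' := 1) (q₃ := 1) _ _ (Or.inl rfl)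
      (Or.inr (le_refl 2)) rfl p _ _ (by simp) rfl,
    torShift_torIncl hI rfl, map_zero]

omit hv hn in
/-- A bound on the two correction terms in `bettiQuot_one_eq`. -/
theorem finrank_corrections_le (p : ℤ) :
    Module.finrank k (LinearMap.ker (torIncl hI 0 p (q := 2) (q' := 2) rfl)) +
      Module.finrank k (LinearMap.range (torShift I 1 0 0 (Or.inl rfl) p (q := 1) (q' := 2) rfl ∘ₗ
        torIncl hI 0 p (q := 1) (q' := 1) rfl)) ≤
      bettiQuot (projIdeal I) p 2 + bettiQuot ((polyIdeal I).leadingCoeffNth 1) p 1 := by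
  have := finrank_ker_add_finrank_range_le
    (f' := torIncl hI 1 p (q := 1) (q' := 2) rfl)
    (ρ := torShift I 1 0 0 (Or.inl rfl) p (q := 1) (q' := 2) rfl ∘ₗ
      torIncl hI 0 p (q := 1) (q' := 1) rfl) (fun x => (torShift_eq_zero_iff hI (l := 1)
    (h := Or.inl rfl) (hq' := by simp) rfl (p := p) (q := 2) (q' := 2) rfl x).1)
    (torShift_torIncl_mem hI (p := p))
  rw [← leadingCoeffNth_zero_polyIdeal]
  exact this

/-! ### The case of partial elimination ideals that are generated by linear forms -/

variable (hlin : ∀ j : ℕ, 1 ≤ j → ∀ p q : ℤ, 1 ≤ q → Subsingleton (CoeffTor I j p q))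

omit hv hn in
theorem torShift_surjective_of_le {p : ℤ} (a : ℕ)
    (h : ∀ q : ℤ, 2 ≤ q → bettiQuot I p q = 0) {q : ℤ} (hq : q = 1 + a) :
    Function.Surjective (torShift I a 0 0 (Or.inl rfl) p hq) := by
  induction a generalizing q with
  | zero =>
    obtain rfl : q = 1 := by simpa using hq
    exact fun x => ⟨x, torShift_zero_self _ _ _ _ _ _⟩
  | succ a ih =>
    intro x
    obtain ⟨y, rfl⟩ := torShift_surjective_of_bettiQuot hI (p := p) (q := q) (q₀ := 1 + a)
      (by push_cast at hq ⊢; omega) (h q (by push_cast at hq; omega)) x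
    obtain ⟨z, rfl⟩ := ih rfl y
    exact ⟨z, (torShift_comp _ _ _ rfl p _ _ _ z).symm⟩

omit hv hn in
theorem torShift_injective_of_le {p p' : ℤ} (hp : p = p' + 1) (a : ℕ)
    (h : ∀ q : ℤ, 2 ≤ q → bettiQuot I p q = 0) {q : ℤ} (hq : q = 2 + a) :
    Function.Injective (torShift I a 0 0 (Or.inl rfl) p' hq) := by
  induction a generalizing q with
  | zero =>
    obtain rfl : q = 2 := by simpa using hq
    intro x y hxy
    rwa [torShift_zero_self, torShift_zero_self] at hxy
  | succ a ih =>
    intro x y hxy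
    refine ih rfl (torShift_injective_of_bettiQuot hI (q := 2 + a) (q₁ := q) hp
      (by push_cast at hq ⊢; omega) (h _ (by omega)) ?_)
    rwa [torShift_comp (c := a + 1) _ _ (Or.inl rfl) rfl p' _ _ hq,
      torShift_comp (c := a + 1) _ _ (Or.inl rfl) rfl p' _ _ hq]

include hlin

omit hv hn in
-- The step E_j → E_{j+1} loses only the image of Tor_p(S/K_j)_{q-j}, which is zero for 1 ≤ j < q.
theorem torShift_one_injective {p : ℤ} (l : ℕ) {q : ℤ} (hl : (l : ℤ) + 2 ≤ q + 1)
    (hq : q = q + (0 : ℕ)) :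
    Function.Injective (torShift I 0 1 (l + 1) (Or.inr (by omega)) p hq) := by
  induction l with
  | zero =>
    intro x y hxy
    rwa [torShift_zero_self, torShift_zero_self] at hxy
  | succ l ih =>
    intro x y hxy
    refine ih (by push_cast at hl; omega) (torShift_injective hI (j := l + 1) rfl
      (q := q - (l + 1)) (q' := q) (by push_cast; ring)
      (hlin (l + 1) (by omega) p _ (by push_cast at hl; omega)) (h := Or.inr (by omega)) (hq' := hq) ?_)
    rwa [torShift_comp (c := 0) _ _ (Or.inr (by omega)) rfl p _ _ hq,
      torShift_comp (c := 0) _ _ (Or.inr (by omega)) rfl p _ _ hq]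

omit hv hn in
-- The obstruction at the step E_j → E_{j+1} lies in Tor_{p-1}(S/K_j)_{q+1-j}. It vanishes by
-- linearity for 1 ≤ j ≤ q and by `h0` for j = 0.
theorem torShift_zero_surjective {p p' : ℤ} (hp : p = p' + 1) (l : ℕ) {q : ℤ} (hl : (l : ℤ) ≤ q)
    (h0 : Subsingleton (CoeffTor I 0 p' (q + 1))) (hq : q = q + (0 : ℕ)) :
    Function.Surjective (torShift I 0 0 (l + 1) (Or.inl rfl) p hq) := by
  induction l with
  | zero => exact torShift_surjective hI rfl hp (by simp) h0
  | succ l ih =>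
    intro x
    obtain ⟨y, rfl⟩ := torShift_surjective hI (j := l + 1) rfl (q := q)
      (q' := q + 1 - (l + 1)) (h := Or.inr (by omega)) (hq' := hq) hp (by push_cast; ring)
      (hlin (l + 1) (by omega) p' _ (by push_cast at hl; omega)) x
    obtain ⟨z, rfl⟩ := ih (by push_cast at hl; omega) y
    exact ⟨z, (torShift_comp (c := 0) _ _ _ rfl p _ _ _ z).symm⟩

omit hn in
/-- If all syzygies of `R / I` in homological degree `p` are linear, then the projection has no
quadratic syzygies in homological degree `p - 1`. -/
theorem bettiQuot_projIdeal_two_eq_zero {p p' : ℤ} (hp : p = p' + 1)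
    (h : ∀ q : ℤ, 2 ≤ q → bettiQuot I p q = 0) : bettiQuot (projIdeal I) p' 2 = 0 := by
  rw [← leadingCoeffNth_zero_polyIdeal]
  -- Multiplication by x_0^b will move everything into degrees where Tor_{p'}(S/K_0) vanishes.
  obtain ⟨b, hb⟩ := tor_quotient_eventually_zero _ (leadingCoeffNth_isHomogeneous hI 0) p'
  -- the connecting map is zero
  have hsurj : Function.Surjective
      (torShift I 0 0 1 (Or.inl rfl) p (q := 1) (q' := 1) (by simp)) := by
    -- The class x_0^b u in E_{b+1} lifts to Tor_p(E_0)_{1+b}, and there it is x_0^b w because the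
    -- syzygies in step p are linear. Injectivity of x_0^b on the lowest strand of E_1 shows that w
    -- lifts u.
    intro u
    obtain ⟨v, hv'⟩ := torShift_zero_surjective hI hlin hp b (q := 1 + b) (by omega)
      (hb _ (by omega)) (by simp) (torShift I b 1 (b + 1) (Or.inr (by omega)) p rfl u)
    obtain ⟨w, rfl⟩ := torShift_surjective_of_le hI b h rfl v
    refine ⟨w, torShift_injective_lowest hI hv (a := b) (j := 1) (l := b + 1) (by omega) p rfl rfl ?_⟩
    rw [← hv', torShift_torShift (a' := b) (b' := 0) (j' := 0) _ _ (Or.inl rfl) (Or.inl rfl)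
      (by omega) p _ _ rfl (by simp)]
  have hker := finrank_ker_torIncl hI (j := 0) (l := 1) rfl (q := 1) (q' := 2) (q₁ := 2) hp
    rfl rfl (h := Or.inl rfl) (hq' := by simp)
  rw [LinearMap.range_eq_top.2 hsurj, finrank_top] at hker
  have hinj : Function.Injective (torIncl hI 0 p' (q := 2) (q' := 2) rfl) :=
    LinearMap.ker_eq_bot.1 (Submodule.finrank_eq_zero.1 (by omega))
  -- the image is zero
  suffices hs : Subsingleton (CoeffTor I 0 p' 2) from
    Module.finrank_zero_of_subsingleton (M := CoeffTor I 0 p' 2)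
  refine subsingleton_of_forall_eq 0 fun y => hinj ?_
  rw [map_zero]
  -- It suffices to kill x_0^b y. Its image in E_1 is zero, since it is zero in E_{b+1} and no class
  -- is lost in between. So it comes from Tor_{p'}(S/K_0)_{2+b} = 0.
  refine torShift_injective_of_le hI hp b h (q := 2 + b) rfl ?_
  rw [map_zero]
  have hz : torShift I 0 0 1 (Or.inl rfl) p' (q := 2 + b) (q' := 2 + b) (by simp)
      (torShift I b 0 0 (Or.inl rfl) p' (q := 2) (q' := 2 + b) rfl
        (torIncl hI 0 p' (q := 2) (q' := 2) rfl y)) = 0 := by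
    apply torShift_one_injective hI hlin b (q := 2 + b) (by omega) (by simp)
    rw [map_zero, torShift_comp (c := 0) _ _ (Or.inl rfl) rfl p' _ _ (by simp),
      torShift_torShift (a' := 0) (b' := b) (j' := 1) (q₃ := 2) _ _ (Or.inl rfl)
        (Or.inr (by omega)) (by omega) p' _ _ (by simp) rfl,
      torShift_torIncl hI rfl, map_zero]
  obtain ⟨y', hy'⟩ := (torShift_eq_zero_iff hI rfl (q := 2 + b) (q' := 2 + b) (by simp) _).1 hz
  rw [← hy', @Subsingleton.elim _ (hb (2 + b) (by omega)) y' 0, map_zero]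

omit hn in
/-- The correction terms in `bettiQuot_one_eq`, if `R / I` has no quadratic syzygies in homological
degree `p`. -/
theorem finrank_corrections_eq {p : ℤ} (h : bettiQuot I p 2 = 0) :
    Module.finrank k (LinearMap.ker (torIncl hI 0 p (q := 2) (q' := 2) rfl)) +
      Module.finrank k (LinearMap.range (torShift I 1 0 0 (Or.inl rfl) p (q := 1) (q' := 2) rfl ∘ₗ
        torIncl hI 0 p (q := 1) (q' := 1) rfl)) = bettiQuot (projIdeal I) p 2 := by
  have h5 : Module.finrank k (CoeffTor I 0 p 2) = bettiQuot (projIdeal I) p 2 := by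
    rw [← leadingCoeffNth_zero_polyIdeal]
    rfl
  -- Once the two images agree, the corrections are nullity and rank of the same map Tor_p(S/K_0)_2
  -- → Tor_p(E_0)_2.
  have hrange : LinearMap.range (torShift I 1 0 0 (Or.inl rfl) p (q := 1) (q' := 2) rfl ∘ₗ
      torIncl hI 0 p (q := 1) (q' := 1) rfl) =
      LinearMap.range (torIncl hI 0 p (q := 2) (q' := 2) rfl) := by
    apply le_antisymm
    · rintro _ ⟨y, rfl⟩
      obtain ⟨z, hz⟩ := torShift_torIncl_mem hI y
      rw [@Subsingleton.elim _ (hlin 1 le_rfl p 1 le_rfl) z 0, map_zero] at hz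
      exact (torShift_eq_zero_iff hI rfl (q := 2) (q' := 2) rfl _).1 hz.symm
    · rintro _ ⟨y, rfl⟩
      -- The image of y is x_0 v. It dies in E_1, hence in E_2, so v dies in the lowest strand of
      -- E_1 and comes from S/K_0.
      obtain ⟨v, hv'⟩ := torShift_surjective_of_bettiQuot hI (p := p) (q := 2) (q₀ := 1) rfl h
        (torIncl hI 0 p (q := 2) (q' := 2) rfl y)
      obtain ⟨w, rfl⟩ := (torShift_eq_zero_iff hI (l := 1) (h := Or.inl rfl)
        (hq' := by simp) rfl (p := p) (q := 1) (q' := 1) rfl v).1 (by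
          apply torShift_injective_lowest hI hv (a := 1) (j := 1) (l := 2) rfl p (q := 1) (q' := 2)
            rfl rfl
          rw [torShift_torShift (a := 0) (b := 1) (j := 1) (a' := 1) (b' := 0) (j' := 0) (l := 2)
            (q₃ := 2) _ _ (Or.inl rfl)
            (Or.inl rfl) rfl p _ _ rfl (by simp), hv', map_zero,
            ← torShift_comp (a := 0) (b := 0) (j := 1) (l := 2) (Or.inl rfl) (Or.inr (by omega))
              _ rfl p (q₁ := 2) (by simp) (by simp),
            torShift_torIncl hI rfl, map_zero])
      exact ⟨w, hv'⟩
  rw [hrange, add_comm, LinearMap.finrank_range_add_finrank_ker, h5]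

end EliminationTor

/-! ### Smooth formal germs -/

section FormalGerms

variable {k : Type*} [Field k] {n : ℕ}

theorem mem_pow_idealOfVars_iff_order {d : ℕ} {f : MvPolynomial (Fin n) k} :
    f ∈ idealOfVars (Fin n) k ^ d ↔ (d : ℕ∞) ≤ (f : MvPowerSeries (Fin n) k).order := by
  rw [mem_pow_idealOfVars_iff']
  constructor
  · intro h
    exact MvPowerSeries.nat_le_order fun x hx => by rw [coeff_coe, h x hx]
  · intro h x hx
    rw [← coeff_coe]
    exact MvPowerSeries.coeff_of_lt_order (lt_of_lt_of_le (by exact_mod_cast hx) h)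

/-- The order of power series over a field is additive. -/
theorem mul_notMem_pow_idealOfVars {d d' : ℕ} {f g : MvPolynomial (Fin n) k}
    (hf : f ∉ idealOfVars (Fin n) k ^ d) (hg : g ∉ idealOfVars (Fin n) k ^ d') :
    f * g ∉ idealOfVars (Fin n) k ^ (d + d') := by
  rw [mem_pow_idealOfVars_iff_order, not_le] at hf hg ⊢
  rw [coe_mul, MvPowerSeries.order_mul, Nat.cast_add]
  exact ENat.add_lt_add hf hg

/-- The substitution `x_j ↦ φ_j`. -/
abbrev substVars (φ : Fin n → MvPolynomial (Fin n) k) :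
    MvPolynomial (Fin n) k →ₐ[k] MvPolynomial (Fin n) k := aeval φ

/-- The substitution that kills the variables in `U`. -/
def killVars (U : Finset (Fin n)) : MvPolynomial (Fin n) k →ₐ[k] MvPolynomial (Fin n) k :=
  aeval fun i => if i ∈ U then 0 else X i

theorem sub_killVars_mem (U : Finset (Fin n)) (f : MvPolynomial (Fin n) k) :
    f - killVars U f ∈ Ideal.span (X '' (U : Set (Fin n))) := by
  induction f using MvPolynomial.induction_on with
  | C a => rw [algHom_C, algebraMap_eq, sub_self]; exact zero_mem _
  | add p q hp hq => rw [map_add, add_sub_add_comm]; exact add_mem hp hq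
  | mul_X p i hp =>
    rw [map_mul, show p * X i - killVars U p * killVars U (X i) =
      (p - killVars U p) * X i + killVars U p * (X i - killVars U (X i)) by ring]
    refine add_mem (Ideal.mul_mem_right _ _ hp) (Ideal.mul_mem_left _ _ ?_)
    rw [killVars, aeval_X]
    split_ifs with h
    · rw [sub_zero]; exact Ideal.subset_span ⟨i, h, rfl⟩
    · rw [sub_self]; exact zero_mem _

theorem killVars_mem_pow (U : Finset (Fin n)) {d : ℕ} {f : MvPolynomial (Fin n) k}
    (hf : f ∈ idealOfVars (Fin n) k ^ d) : killVars U f ∈ idealOfVars (Fin n) k ^ d := by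
  have h : (idealOfVars (Fin n) k ^ d).map (killVars U) ≤ idealOfVars (Fin n) k ^ d := by
    rw [Ideal.map_pow]
    refine Ideal.pow_right_mono ?_ d
    rw [idealOfVars, Ideal.map_span, Ideal.span_le]
    rintro _ ⟨_, ⟨i, rfl⟩, rfl⟩
    rw [killVars, aeval_X]
    split_ifs
    · exact zero_mem _
    · exact Ideal.subset_span ⟨i, rfl⟩
  exact h (Ideal.mem_map_of_mem _ hf)

theorem killVars_mem_iff {U : Finset (Fin n)} {d : ℕ} {f : MvPolynomial (Fin n) k} :
    killVars U f ∈ idealOfVars (Fin n) k ^ d ↔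
      f ∈ Ideal.span (X '' (U : Set (Fin n))) ⊔ idealOfVars (Fin n) k ^ d := by
  constructor
  · intro h
    rw [← sub_add_cancel f (killVars U f)]
    exact Submodule.add_mem_sup (sub_killVars_mem U f) h
  · intro h
    obtain ⟨a, ha, b, hb, rfl⟩ := Submodule.mem_sup.1 h
    have h0 : killVars U a = 0 := by
      have : Ideal.span (X '' (U : Set (Fin n))) ≤ RingHom.ker (killVars (k := k) U) := by
        rw [Ideal.span_le]
        rintro _ ⟨i, hi, rfl⟩
        rw [SetLike.mem_coe, RingHom.mem_ker, killVars, aeval_X, if_pos (Finset.mem_coe.1 hi)]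
      exact this ha
    rw [map_add, h0, zero_add]
    exact killVars_mem_pow U hb

variable {φ : Fin n → MvPolynomial (Fin n) k}

/-- Approximations of the ideal generated by the `φ_j` with `j ∈ U`. -/
abbrev germApprox (φ : Fin n → MvPolynomial (Fin n) k) (U : Finset (Fin n)) (d : ℕ) :
    Ideal (MvPolynomial (Fin n) k) :=
  Ideal.span (φ '' (U : Set (Fin n))) ⊔ idealOfVars (Fin n) k ^ d

/-- The ideal of the formal germ defined by the `φ_j` with `j ∈ U`. -/
def germIdeal (φ : Fin n → MvPolynomial (Fin n) k) (U : Finset (Fin n)) :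
    Ideal (MvPolynomial (Fin n) k) := ⨅ d : ℕ, germApprox φ U d

theorem mem_germIdeal {U : Finset (Fin n)} {f : MvPolynomial (Fin n) k} :
    f ∈ germIdeal φ U ↔ ∀ d, f ∈ germApprox φ U d := Submodule.mem_iInf _

theorem mem_germIdeal_of_mem {U : Finset (Fin n)} {i : Fin n} (hi : i ∈ U) : φ i ∈ germIdeal φ U :=
  mem_germIdeal.2 fun _ => Submodule.mem_sup_left (Ideal.subset_span ⟨i, hi, rfl⟩)

variable (hφ : ∀ i, φ i - X i ∈ idealOfVars (Fin n) k ^ 2)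

include hφ

/-- Because φ_i ≡ x_i mod 𝔪², where 𝔪 = (x_1, …, x_n), the substitution is the identity on
𝔪^d/𝔪^{d+1}. It is therefore an automorphism modulo every power of 𝔪, a substitute for the formal
inverse function theorem. -/
theorem subst_sub_self_mem {d : ℕ} {f : MvPolynomial (Fin n) k} (hf : f ∈ idealOfVars (Fin n) k ^ d) :
    substVars φ f - f ∈ idealOfVars (Fin n) k ^ (d + 1) := by
  have hX : ∀ i, (X i : MvPolynomial (Fin n) k) ∈ idealOfVars (Fin n) k := fun i =>
    Ideal.subset_span ⟨i, rfl⟩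
  have hφ1 : ∀ i, φ i ∈ idealOfVars (Fin n) k := fun i => by
    rw [← sub_add_cancel (φ i) (X i)]
    exact add_mem (Ideal.pow_le_self two_ne_zero (hφ i)) (hX i)
  have h0 : ∀ f : MvPolynomial (Fin n) k, substVars φ f - f ∈ idealOfVars (Fin n) k := by
    intro f
    induction f using MvPolynomial.induction_on with
    | C a => rw [algHom_C, algebraMap_eq, sub_self]; exact zero_mem _
    | add p q hp hq => rw [map_add, add_sub_add_comm]; exact add_mem hp hq
    | mul_X p i hp =>
      rw [map_mul]
      exact sub_mem (Ideal.mul_mem_left _ _ (by rw [aeval_X]; exact hφ1 i)) (Ideal.mul_mem_left _ _ (hX i))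
  have h1 : ∀ f ∈ idealOfVars (Fin n) k, substVars φ f - f ∈ idealOfVars (Fin n) k ^ 2 := by
    intro f hf
    refine Submodule.span_induction ?_ ?_ ?_ ?_ hf
    · rintro _ ⟨i, rfl⟩
      rw [aeval_X]; exact hφ i
    · rw [map_zero, sub_zero]; exact zero_mem _
    · intro x y _ _ hx hy
      rw [map_add, add_sub_add_comm]; exact add_mem hx hy
    · intro c x hx hx'
      rw [smul_eq_mul, map_mul, show substVars φ c * substVars φ x - c * x =
        (substVars φ c - c) * x + substVars φ c * (substVars φ x - x) by ring]
      refine add_mem ?_ (Ideal.mul_mem_left _ _ hx')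
      rw [pow_two]
      exact Ideal.mul_mem_mul (h0 c) hx
  induction d generalizing f with
  | zero => rw [zero_add, pow_one]; exact h0 f
  | succ d ih =>
    rw [pow_succ] at hf
    refine Submodule.mul_induction_on hf (fun a ha b hb => ?_) (fun x y hx hy => ?_)
    · rw [map_mul, show substVars φ a * substVars φ b - a * b =
        (substVars φ a - a) * b + (substVars φ a - a) * (substVars φ b - b) +
          a * (substVars φ b - b) by ring]
      have ha' := ih ha
      have hb' := h1 b hb
      refine add_mem (add_mem ?_ ?_) ?_
      · rw [pow_succ]; exact Ideal.mul_mem_mul ha' hb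
      · have := Ideal.mul_mem_mul ha' hb'
        rw [← pow_add] at this
        exact Ideal.pow_le_pow_right (by omega) this
      · have := Ideal.mul_mem_mul ha hb'
        rw [← pow_add] at this
        exact Ideal.pow_le_pow_right (by omega) this
    · rw [map_add, add_sub_add_comm]; exact add_mem hx hy

theorem subst_mem_pow_iff {d : ℕ} {f : MvPolynomial (Fin n) k} :
    substVars φ f ∈ idealOfVars (Fin n) k ^ d ↔ f ∈ idealOfVars (Fin n) k ^ d := by
  constructor
  · intro h
    have key : ∀ e ≤ d, f ∈ idealOfVars (Fin n) k ^ e := by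
      intro e
      induction e with
      | zero => intro _; rw [pow_zero, Ideal.one_eq_top]; trivial
      | succ e ih =>
        intro he
        have := subst_sub_self_mem hφ (ih (by omega))
        rw [← sub_sub_cancel (substVars φ f) f]
        exact sub_mem (Ideal.pow_le_pow_right he h) this
    exact key d le_rfl
  · intro h
    rw [← sub_add_cancel (substVars φ f) f]
    exact add_mem (Ideal.pow_le_pow_right (Nat.le_succ d) (subst_sub_self_mem hφ h)) h

theorem exists_sub_subst_mem (d : ℕ) (f : MvPolynomial (Fin n) k) :
    ∃ g, f - substVars φ g ∈ idealOfVars (Fin n) k ^ d := by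
  induction d with
  | zero => exact ⟨0, by rw [pow_zero, Ideal.one_eq_top]; trivial⟩
  | succ d ih =>
    obtain ⟨g, hg⟩ := ih
    refine ⟨g + (f - substVars φ g), ?_⟩
    have := subst_sub_self_mem hφ hg
    rw [map_add, ← sub_sub, ← neg_sub]
    exact neg_mem this

/-- Modulo 𝔪^d the substitution straightens the germ: it takes the ideal of the x_i, i ∈ U, to that
of the φ_i. -/
theorem subst_mem_germApprox_iff {U : Finset (Fin n)} {d : ℕ} {g : MvPolynomial (Fin n) k} :
    substVars φ g ∈ germApprox φ U d ↔ killVars U g ∈ idealOfVars (Fin n) k ^ d := by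
  rw [killVars_mem_iff]
  constructor
  · intro h
    obtain ⟨a, ha, b, hb, hab⟩ := Submodule.mem_sup.1 h
    have key : ∃ c ∈ Ideal.span (X '' (U : Set (Fin n))),
        a - substVars φ c ∈ idealOfVars (Fin n) k ^ d := by
      refine Submodule.span_induction ?_ ?_ ?_ ?_ ha
      · rintro _ ⟨i, hi, rfl⟩
        exact ⟨X i, Ideal.subset_span ⟨i, hi, rfl⟩, by rw [aeval_X, sub_self]; exact zero_mem _⟩
      · exact ⟨0, zero_mem _, by rw [map_zero, sub_self]; exact zero_mem _⟩
      · rintro x y _ _ ⟨c, hc, hxc⟩ ⟨c', hc', hyc⟩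
        exact ⟨c + c', add_mem hc hc', by rw [map_add, add_sub_add_comm]; exact add_mem hxc hyc⟩
      · rintro r x _ ⟨c, hc, hxc⟩
        obtain ⟨r', hr⟩ := exists_sub_subst_mem hφ d r
        refine ⟨r' * c, Ideal.mul_mem_left _ _ hc, ?_⟩
        rw [smul_eq_mul, map_mul, show r * x - substVars φ r' * substVars φ c =
          r * (x - substVars φ c) + (r - substVars φ r') * substVars φ c by ring]
        exact add_mem (Ideal.mul_mem_left _ _ hxc) (Ideal.mul_mem_right _ _ hr)
    obtain ⟨c, hc, hac⟩ := key
    rw [← add_sub_cancel c g]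
    refine Submodule.add_mem_sup hc ((subst_mem_pow_iff hφ).1 ?_)
    rw [map_sub, ← hab, add_sub_right_comm]
    exact add_mem hac hb
  · intro h
    obtain ⟨a, ha, b, hb, rfl⟩ := Submodule.mem_sup.1 h
    rw [map_add]
    refine Submodule.add_mem_sup ?_ ((subst_mem_pow_iff hφ).2 hb)
    have := Ideal.mem_map_of_mem (substVars φ) ha
    rw [Ideal.map_span, ← Set.image_comp] at this
    convert this using 3
    exact (aeval_X _ _).symm

/-- A straightened germ is a linear space, whose formal functions form a domain. If f and g are
nonzero to orders d and d', approximating both modulo 𝔪^{d+d'} shows that fg is nonzero to order d +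
d'. -/
theorem germIdeal_isPrime (U : Finset (Fin n)) : (germIdeal φ U).IsPrime := by
  refine Ideal.isPrime_iff.2 ⟨fun h => ?_, fun {f g} hfg => ?_⟩
  · have h1 := mem_germIdeal.1 (h ▸ Submodule.mem_top : (1 : MvPolynomial (Fin n) k) ∈ germIdeal φ U) 1
    rw [← map_one (substVars φ), subst_mem_germApprox_iff hφ, map_one, ← C_1,
      C_mem_pow_idealOfVars_iff] at h1
    simp at h1
  · by_contra! hne
    obtain ⟨d, hd⟩ := not_forall.1 (mt mem_germIdeal.2 hne.1)
    obtain ⟨d', hd'⟩ := not_forall.1 (mt mem_germIdeal.2 hne.2)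
    obtain ⟨a, ha⟩ := exists_sub_subst_mem hφ (d + d') f
    obtain ⟨b, hb⟩ := exists_sub_subst_mem hφ (d + d') g
    have hle : ∀ e ≤ d + d', idealOfVars (Fin n) k ^ (d + d') ≤ germApprox φ U e := fun e he =>
      (Ideal.pow_le_pow_right he).trans le_sup_right
    have h1 : killVars U a ∉ idealOfVars (Fin n) k ^ d := fun h => hd (by
      rw [← sub_add_cancel f (substVars φ a)]
      exact add_mem (hle _ (by omega) ha) ((subst_mem_germApprox_iff hφ).2 h))
    have h2 : killVars U b ∉ idealOfVars (Fin n) k ^ d' := fun h => hd' (by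
      rw [← sub_add_cancel g (substVars φ b)]
      exact add_mem (hle _ (by omega) hb) ((subst_mem_germApprox_iff hφ).2 h))
    refine mul_notMem_pow_idealOfVars h1 h2 ?_
    rw [← map_mul, ← subst_mem_germApprox_iff hφ, map_mul]
    rw [show substVars φ a * substVars φ b = f * g - ((f - substVars φ a) * g +
      substVars φ a * (g - substVars φ b)) by ring]
    exact sub_mem (mem_germIdeal.1 hfg _) (add_mem (Ideal.mul_mem_right _ _ (hle _ le_rfl ha))
      (Ideal.mul_mem_left _ _ (hle _ le_rfl hb)))

/-- The function φ_i separates the two ideals already modulo 𝔪²: after straightening it is x_i,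
which survives killing the variables in U. The resulting chain of primes bounds the height. -/
theorem germIdeal_lt_insert {U : Finset (Fin n)} {i : Fin n} (hi : i ∉ U) :
    germIdeal φ U < germIdeal φ (insert i U) := by
  refine lt_of_le_of_ne (fun f hf => mem_germIdeal.2 fun d => ?_) fun h => ?_
  · have hU : (U : Set (Fin n)) ⊆ (insert i U : Finset (Fin n)) := by simp
    exact sup_le_sup_right (Ideal.span_mono (Set.image_mono hU)) (idealOfVars (Fin n) k ^ d)
      (mem_germIdeal.1 hf d)
  · have h1 := mem_germIdeal_of_mem (φ := φ) (Finset.mem_insert_self i U)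
    rw [← h, mem_germIdeal] at h1
    have h2 := h1 2
    rw [← aeval_X (R := k) φ i, subst_mem_germApprox_iff hφ, killVars, aeval_X, if_neg hi, X,
      monomial_mem_pow_idealOfVars_iff _ _ one_ne_zero] at h2
    simp at h2

theorem card_le_height_germIdeal (U : Finset (Fin n)) : (U.card : ℕ∞) ≤ (germIdeal φ U).height := by
  induction U using Finset.induction_on with
  | empty => simp
  | insert i U hi ih =>
    have := germIdeal_isPrime hφ U
    have := germIdeal_isPrime hφ (insert i U)
    rw [Finset.card_insert_of_notMem hi]
    push_cast
    exact (add_le_add_left ih 1).trans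
      (Ideal.height_add_one_le_of_lt_of_isPrime (germIdeal_lt_insert hφ hi))

omit hφ in
-- The germ ideal lies in every P + 𝔪^d. Krull's intersection theorem in the domain A/P, where 𝔪
-- remains proper as P ≤ 𝔪, puts it into P.
theorem germIdeal_le {P : Ideal (MvPolynomial (Fin n) k)} [P.IsPrime] (hP : P ≤ idealOfVars (Fin n) k)
    {U : Finset (Fin n)} (hU : ∀ i ∈ U, φ i ∈ P) : germIdeal φ U ≤ P := by
  intro f hf
  have hne : (idealOfVars (Fin n) k).map (Ideal.Quotient.mk P) ≠ ⊤ := by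
    intro h
    have h1 := congrArg (Ideal.comap (Ideal.Quotient.mk P)) h
    rw [Ideal.comap_map_of_surjective _ Ideal.Quotient.mk_surjective, Ideal.comap_top,
      ← RingHom.ker_eq_comap_bot, Ideal.mk_ker, sup_eq_left.2 hP, Ideal.eq_top_iff_one, ← C_1,
      ← pow_one (idealOfVars (Fin n) k), C_mem_pow_idealOfVars_iff] at h1
    simp at h1
  rw [← Ideal.Quotient.eq_zero_iff_mem, ← Ideal.mem_bot, ← Ideal.iInf_pow_eq_bot_of_isDomain _ hne,
    Ideal.mem_iInf]
  intro d
  rw [← Ideal.map_pow]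
  obtain ⟨a, ha, b, hb, rfl⟩ := Submodule.mem_sup.1 (mem_germIdeal.1 hf d)
  have ha' : a ∈ P := by
    refine Ideal.span_le.2 ?_ ha
    rintro _ ⟨i, hi, rfl⟩
    exact hU i hi
  rw [map_add, Ideal.Quotient.eq_zero_iff_mem.2 ha', zero_add]
  exact Ideal.mem_map_of_mem _ hb

/-- A prime ideal with `t` functions that have independent linear parts has height at least `t`. -/
theorem card_le_height {P : Ideal (MvPolynomial (Fin n) k)} [P.IsPrime]
    (hP : P ≤ idealOfVars (Fin n) k) {U : Finset (Fin n)} (hU : ∀ i ∈ U, φ i ∈ P) :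
    (U.card : ℕ∞) ≤ P.height :=
  (card_le_height_germIdeal hφ U).trans (Ideal.height_mono (germIdeal_le hP hU))

/-- In the case of equality, the lowest forms of elements of `P` are generated by the linear
ones. -/
theorem mem_span_of_height_le {P : Ideal (MvPolynomial (Fin n) k)} [P.IsPrime]
    (hP : P ≤ idealOfVars (Fin n) k) {U : Finset (Fin n)} (hU : ∀ i ∈ U, φ i ∈ P)
    (hht : P.height ≤ U.card) {d : ℕ} {f s : MvPolynomial (Fin n) k} (hf : f ∈ P)
    (hs : s.IsHomogeneous d) (hfs : f - s ∈ idealOfVars (Fin n) k ^ (d + 1)) :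
    s ∈ Ideal.span (X '' (U : Set (Fin n))) := by
  have := germIdeal_isPrime hφ U
  have hfin : (germIdeal φ U).FiniteHeight := ⟨Or.inr (ne_top_of_le_ne_top (ENat.natCast_ne_top U.card)
    ((Ideal.height_mono (germIdeal_le hP hU)).trans hht))⟩
  -- Two nested primes of the same finite height coincide, so P is the ideal of the germ.
  obtain rfl := Ideal.eq_of_le_of_height_le _ (germIdeal_le hP hU)
    (hht.trans (card_le_height_germIdeal hφ U))
  have hsd : s ∈ idealOfVars (Fin n) k ^ d := by
    rw [mem_pow_idealOfVars_iff']
    intro x hx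
    by_contra hne
    exact hne (hs.coeff_eq_zero (by omega))
  -- Both f and the substituted s have s as their part of degree d, so modulo 𝔪^{d+1} they agree.
  -- Straightening then places s in (x_i : i ∈ U) up to terms of higher degree, which cannot affect
  -- its monomials.
  have h1 : substVars φ s ∈ germApprox φ U (d + 1) := by
    rw [show substVars φ s = f - (f - s) + (substVars φ s - s) by ring]
    exact add_mem (sub_mem (mem_germIdeal.1 hf _) (Submodule.mem_sup_right hfs))
      (Submodule.mem_sup_right (subst_sub_self_mem hφ hsd))
  rw [subst_mem_germApprox_iff hφ, killVars_mem_iff] at h1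
  obtain ⟨a, ha, b, hb, hab⟩ := Submodule.mem_sup.1 h1
  rw [mem_ideal_span_X_image] at ha ⊢
  intro m hm
  refine ha m (mem_support_iff.2 ?_)
  have hdeg := not_imp_comm.1 hs.coeff_eq_zero (mem_support_iff.1 hm)
  have hb0 := (mem_pow_idealOfVars_iff' _ _).1 hb m (by omega)
  rw [mem_support_iff, ← hab, coeff_add, hb0, add_zero] at hm
  exact hm

end FormalGerms

/-! ### Partial elimination ideals and the germ at the centre of projection -/

section TangentCone

variable {k : Type*} [Field k] {N : ℕ}

theorem IsHomogeneous.mem_pow_idealOfVars {n d : ℕ} {f : MvPolynomial (Fin n) k}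
    (hf : f.IsHomogeneous d) : f ∈ idealOfVars (Fin n) k ^ d := by
  rw [mem_pow_idealOfVars_iff']
  intro x hx
  exact hf.coeff_eq_zero (by omega)

/-- The affine coordinate change `x_0 ↦ x_0 + c`, `x_i ↦ ∑_j a_{ij} x_j` for `i ≥ 1`. -/
def affineSub (c : k) (A : Matrix (Fin N) (Fin N) k) :
    MvPolynomial (Fin (N + 1)) k →ₐ[k] MvPolynomial (Fin (N + 1)) k :=
  aeval (Fin.cons (X 0 + C c) fun i => rename Fin.succ (linSub A (X i)) :
    Fin (N + 1) → MvPolynomial (Fin (N + 1)) k)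

theorem affineSub_X_zero (c : k) (A : Matrix (Fin N) (Fin N) k) :
    affineSub c A (X 0) = X 0 + C c := by rw [affineSub, aeval_X, Fin.cons_zero]

theorem affineSub_rename (c : k) (A : Matrix (Fin N) (Fin N) k) (s : MvPolynomial (Fin N) k) :
    affineSub c A (rename Fin.succ s) = rename Fin.succ (linSub A s) := by
  have : (affineSub c A).comp (rename Fin.succ) = (rename Fin.succ).comp (linSub A) := by
    refine algHom_ext fun i => ?_
    rw [AlgHom.comp_apply, AlgHom.comp_apply, rename_X, affineSub, aeval_X, Fin.cons_succ]
  exact DFunLike.congr_fun this s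

theorem affineSub_affineSub {A B : Matrix (Fin N) (Fin N) k} (h : A * B = 1) (c : k)
    (f : MvPolynomial (Fin (N + 1)) k) : affineSub (-c) B (affineSub c A f) = f := by
  have : (affineSub (-c) B).comp (affineSub c A) = AlgHom.id k _ := by
    refine algHom_ext fun i => ?_
    refine Fin.cases ?_ (fun i => ?_) i
    · rw [AlgHom.comp_apply, affineSub_X_zero, map_add, affineSub_X_zero, algHom_C, algebraMap_eq,
        map_neg, AlgHom.id_apply]
      ring
    · rw [AlgHom.comp_apply, ← rename_X, affineSub_rename, affineSub_rename, linSub_linSub, h,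
        linSub_one]
      rfl
  exact DFunLike.congr_fun this f

/-- The affine coordinate change as an automorphism. -/
def affineSubEquiv (c : k) (A : Matrix (Fin N) (Fin N) k) (hA : A.det ≠ 0) :
    MvPolynomial (Fin (N + 1)) k ≃ₐ[k] MvPolynomial (Fin (N + 1)) k :=
  AlgEquiv.ofAlgHom (affineSub c A) (affineSub (-c) A⁻¹)
    (AlgHom.ext fun f => by
      have := affineSub_affineSub (Matrix.nonsing_inv_mul _ (isUnit_iff_ne_zero.2 hA)) (-c) f
      rwa [neg_neg] at this)
    (AlgHom.ext fun f => affineSub_affineSub (Matrix.mul_nonsing_inv _ (isUnit_iff_ne_zero.2 hA)) c f)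

/-- The coefficient of x_0^i has degree d + j - i. After x_0 ↦ x_0 + 1 the terms with i < j have
order above d, and the term i = j contributes its coefficient plus multiples of it by x_0. Leading
coefficients in x_0 thus become lowest forms at the centre of projection. -/
theorem affineSub_sub_mem (A : Matrix (Fin N) (Fin N) k) {H : Polynomial (MvPolynomial (Fin N) k)}
    {j d : ℕ} (hH : H ∈ polyDeg k N (d + j)) (hj : ∀ i, j < i → H.coeff i = 0) :
    affineSub 1 A ((finSuccEquiv k N).symm H) - rename Fin.succ (linSub A (H.coeff j)) ∈
      idealOfVars (Fin (N + 1)) k ^ (d + 1) := by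
  have hsum : affineSub 1 A ((finSuccEquiv k N).symm H) =
      ∑ i ∈ Finset.range (j + 1), rename Fin.succ (linSub A (H.coeff i)) * (X 0 + 1) ^ i := by
    conv_lhs => rw [Polynomial.as_sum_range_C_mul_X_pow' H (n := j + 1)
      (Nat.lt_succ_of_le (Polynomial.natDegree_le_iff_coeff_eq_zero.2 hj))]
    rw [map_sum, map_sum]
    refine Finset.sum_congr rfl fun i _ => ?_
    rw [map_mul, map_pow, finSuccEquiv_symm_C, ← finSuccEquiv_X_zero, AlgEquiv.symm_apply_apply,
      map_mul, map_pow, affineSub_rename, affineSub_X_zero, C_1]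
  have hom : ∀ i ≤ j, (rename Fin.succ (linSub A (H.coeff i)) : MvPolynomial (Fin (N + 1)) k) ∈
      idealOfVars (Fin (N + 1)) k ^ (d + (j - i)) := by
    intro i hi
    have := mem_polyDeg.1 hH i
    rw [show (d + j - i : ℤ) = ((d + (j - i) : ℕ) : ℤ) by omega, mem_homPart_natCast] at this
    exact IsHomogeneous.mem_pow_idealOfVars (linSub_isHomogeneous A this).rename_isHomogeneous
  rw [hsum, Finset.sum_range_succ, add_sub_assoc]
  refine add_mem (sum_mem fun i hi => ?_) ?_
  · rw [Finset.mem_range] at hi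
    exact Ideal.mul_mem_right _ _ (Ideal.pow_le_pow_right (by omega) (hom i hi.le))
  · rw [← mul_sub_one, pow_succ]
    have h1 := hom j le_rfl
    rw [Nat.sub_self, add_zero] at h1
    refine Ideal.mul_mem_mul h1 ?_
    have h2 := sub_dvd_pow_sub_pow (X 0 + 1 : MvPolynomial (Fin (N + 1)) k) 1 j
    rw [add_sub_cancel_right, one_pow] at h2
    exact Ideal.mem_of_dvd _ h2 (Ideal.subset_span ⟨0, rfl⟩)

theorem height_comap_affineSub (A : Matrix (Fin N) (Fin N) k) (hA : A.det ≠ 0) (c : k)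
    (P : Ideal (MvPolynomial (Fin (N + 1)) k)) : (P.comap (affineSub (-c) A⁻¹)).height = P.height :=
  RingEquiv.height_comap (affineSubEquiv c A hA).symm.toRingEquiv P

theorem eval_affineSub (A : Matrix (Fin N) (Fin N) k) (f : MvPolynomial (Fin (N + 1)) k) :
    eval (Pi.single 0 1) (affineSub (-1) A f) = coeff 0 f := by
  have hev : (aeval (Pi.single 0 1 : Fin (N + 1) → k)).comp (affineSub (-1) A) =
      aeval (0 : Fin (N + 1) → k) := by
    refine algHom_ext fun i => ?_
    refine Fin.cases ?_ (fun i => ?_) i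
    · rw [AlgHom.comp_apply, affineSub_X_zero]
      simp
    · rw [AlgHom.comp_apply, ← rename_X, affineSub_rename, aeval_rename]
      simp [linSub_X, Function.comp_def]
  rw [← constantCoeff_eq, ← eval_zero, ← aeval_eq_eval, ← aeval_eq_eval]
  exact DFunLike.congr_fun hev f

variable {I : Ideal (MvPolynomial (Fin (N + 1)) k)}
  (hI : I.IsHomogeneous (homogeneousSubmodule (Fin (N + 1)) k))

include hI

/-- A homogeneous element of a partial elimination ideal comes from a homogeneous element. -/
theorem exists_homogeneous_of_mem_leadingCoeffNth {j d : ℕ} {s : MvPolynomial (Fin N) k}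
    (hs : s ∈ (polyIdeal I).leadingCoeffNth j) (hd : s.IsHomogeneous d) :
    ∃ H ∈ polyIdeal I, H ∈ polyDeg k N (d + j) ∧ H.coeff j = s ∧ ∀ i, j < i → H.coeff i = 0 := by
  obtain ⟨G, hG, rfl, hG0⟩ := mem_leadingCoeffNth_iff.1 hs
  obtain ⟨H, hH, hHd, hHG⟩ := exists_homogeneous_polyIdeal hI hG (d + j)
  refine ⟨H, hH, hHd, ?_, fun i hi => by rw [hHG, hG0 i hi, map_zero]⟩
  rw [hHG, add_sub_cancel_right, homProj_self (mem_homPart_natCast.2 hd)]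

/-- The data of a germ of a component `P` of `I`, after a coordinate change. -/
theorem exists_germ {P : Ideal (MvPolynomial (Fin (N + 1)) k)} [hP : P.IsPrime] (hIP : I ≤ P)
    (hv : ∀ f ∈ P, eval (Pi.single 0 1) f = 0) {A : Matrix (Fin N) (Fin N) k} (hA : A.det ≠ 0)
    {T : Finset (Fin N)}
    (hT : HasLinearForms (((polyIdeal I).leadingCoeffNth 1).map (linSub A)) T) :
    ∃ (P' : Ideal (MvPolynomial (Fin (N + 1)) k)) (φ : Fin (N + 1) → MvPolynomial (Fin (N + 1)) k),
      P'.IsPrime ∧ P' ≤ idealOfVars (Fin (N + 1)) k ∧ P'.height = P.height ∧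
      (∀ f ∈ I, affineSub 1 A f ∈ P') ∧
      (∀ i, φ i - X i ∈ idealOfVars (Fin (N + 1)) k ^ 2) ∧ ∀ i ∈ succSet T, φ i ∈ P' := by
  have hA' := Matrix.mul_nonsing_inv _ (isUnit_iff_ne_zero.2 hA)
  have hmem : ∀ f ∈ I, affineSub 1 A f ∈ P.comap (affineSub (-1) A⁻¹) := by
    intro f hf
    rw [Ideal.mem_comap, affineSub_affineSub hA']
    exact hIP hf
  have hex : ∀ i, ∃ f, f - X i ∈ idealOfVars (Fin (N + 1)) k ^ 2 ∧
      (i ∈ succSet T → f ∈ P.comap (affineSub (-1) A⁻¹)) := by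
    intro i
    by_cases hi : i ∈ succSet T
    · obtain ⟨i, hi', rfl⟩ := Finset.mem_map.1 hi
      -- The variable x_i is the transform of a linear form in K_1; a homogeneous quadric in I with
      -- that leading coefficient becomes a function with linear part x_i.
      have h1 := (mem_map_linSub hA).1 (hT.X_mem hi')
      obtain ⟨H, hH, hHd, hH1, hH0⟩ := exists_homogeneous_of_mem_leadingCoeffNth hI h1
        (linSub_isHomogeneous A⁻¹ (isHomogeneous_X k i))
      refine ⟨_, ?_, fun _ => hmem _ (mem_polyIdeal.1 hH)⟩
      have h2 := affineSub_sub_mem A hHd hH0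
      rwa [hH1, linSub_linSub, Matrix.nonsing_inv_mul _ (isUnit_iff_ne_zero.2 hA), linSub_one,
        AlgHom.id_apply, rename_X] at h2
    · exact ⟨X i, by rw [sub_self]; exact zero_mem _, fun h => absurd h hi⟩
  choose φ hφ hφP using hex
  refine ⟨P.comap (affineSub (-1) A⁻¹), φ, Ideal.comap_isPrime _ _, fun f hf => ?_,
    height_comap_affineSub A hA 1 P, hmem, hφ, hφP⟩
  have h0 := hv _ (Ideal.mem_comap.1 hf)
  rw [eval_affineSub] at h0
  rw [← pow_one (idealOfVars (Fin (N + 1)) k), mem_pow_idealOfVars_iff']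
  intro x hx
  rwa [(Finsupp.degree_eq_zero_iff x).1 (by omega)]

theorem numLinearForms_le_height {P : Ideal (MvPolynomial (Fin (N + 1)) k)} [P.IsPrime] (hIP : I ≤ P)
    (hv : ∀ f ∈ P, eval (Pi.single 0 1) f = 0) :
    (numLinearForms ((polyIdeal I).leadingCoeffNth 1) : ℕ∞) ≤ P.height := by
  obtain ⟨A, T, hA, hT, h⟩ := exists_hasLinearForms ((polyIdeal I).leadingCoeffNth 1)
  obtain ⟨P', φ, hP', hP'0, hht, -, hφ, hφP⟩ := exists_germ hI hIP hv hA h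
  rw [← hT, ← hht, ← card_succSet T]
  exact card_le_height hφ hP'0 hφP

/-- If `q` is a smooth point of a component, then the partial elimination ideals are generated by
linear forms. -/
theorem leadingCoeffNth_eq_span {P : Ideal (MvPolynomial (Fin (N + 1)) k)} [P.IsPrime] (hIP : I ≤ P)
    (hv : ∀ f ∈ P, eval (Pi.single 0 1) f = 0)
    (hht : P.height ≤ numLinearForms ((polyIdeal I).leadingCoeffNth 1)) {j : ℕ} (hj : 1 ≤ j) :
    (polyIdeal I).leadingCoeffNth j =
      Ideal.span {f | f ∈ (polyIdeal I).leadingCoeffNth j ∧ f.IsHomogeneous 1} := by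
  obtain ⟨A, T, hA, hT, h⟩ := exists_hasLinearForms ((polyIdeal I).leadingCoeffNth 1)
  obtain ⟨P', φ, hP', hP'0, hht', hmem, hφ, hφP⟩ := exists_germ hI hIP hv hA h
  rw [← hT, ← hht', ← card_succSet T] at hht
  have hAA := Matrix.mul_nonsing_inv _ (isUnit_iff_ne_zero.2 hA)
  refine le_antisymm (fun s hs => ?_) (Ideal.span_le.2 fun f hf => hf.1)
  rw [← sum_homogeneousComponent s]
  refine sum_mem fun d _ => ?_
  have hsd := homogeneousComponent_mem_of_mem (leadingCoeffNth_isHomogeneous hI j) hs d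
  obtain ⟨H, hH, hHd, hHs, hH0⟩ := exists_homogeneous_of_mem_leadingCoeffNth hI hsd
    (homogeneousComponent_isHomogeneous d s)
  have h1 := affineSub_sub_mem A hHd hH0
  rw [hHs] at h1
  -- A homogeneous element of K_j is a lowest form of an element of P', so it lies in the ideal of
  -- the linear forms of K_1.
  have h2 := mem_span_of_height_le hφ hP'0 hφP hht (hmem _ (mem_polyIdeal.1 hH))
    (linSub_isHomogeneous A (homogeneousComponent_isHomogeneous d s)).rename_isHomogeneous h1
  -- Setting x_0 = 0 and undoing the substitution returns to S.
  have h3 := Ideal.mem_map_of_mem ((linSub A⁻¹).comp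
    (aeval (Fin.cons 0 X : Fin (N + 1) → MvPolynomial (Fin N) k))) h2
  rw [AlgHom.comp_apply, aeval_rename, show (Fin.cons 0 X : Fin (N + 1) → MvPolynomial (Fin N) k) ∘
    Fin.succ = X by funext i; simp, aeval_X_left, AlgHom.id_apply, linSub_linSub, hAA, linSub_one,
    AlgHom.id_apply, Ideal.map_span] at h3
  refine Ideal.span_mono ?_ h3
  rintro _ ⟨_, ⟨i, hi, rfl⟩, rfl⟩
  obtain ⟨i, hi', rfl⟩ := Finset.mem_map.1 hi
  change linSub A⁻¹ (aeval _ (X i.succ)) ∈ _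
  rw [aeval_X, Fin.cons_succ]
  exact ⟨Ideal.leadingCoeffNth_mono _ hj ((mem_map_linSub hA).1 (h.X_mem hi')),
    linSub_isHomogeneous _ (isHomogeneous_X k i)⟩

end TangentCone

/-! ### Ideals generated by quadrics and the Jacobian matrix -/

section Quadrics

variable {k : Type*} [Field k] {n : ℕ}

/-- If `Tor_0(I)` is zero in degree `m`, then `I_m = A_1 I_{m-1}`. -/
theorem mem_of_subsingleton_tor_zero {I : Ideal (MvPolynomial (Fin n) k)} {m : ℕ}
    (h : Subsingleton (KoszulTor n (idealDeg I) 0 (m + 1))) {f : MvPolynomial (Fin n) k}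
    (hf : f ∈ I) (hfm : f.IsHomogeneous (m + 1)) :
    f ∈ Ideal.span {g | g ∈ I ∧ g.IsHomogeneous m} := by
  -- The element f as a chain in homological degree 0, automatically a cycle. A primitive writes f
  -- as a combination of variables times elements of I of degree m.
  let z : Finset (Fin n) → I := fun s => if s = ∅ then ⟨f, hf⟩ else 0
  have hz : z ∈ koszulChain n (idealDeg I) 0 (m + 1) := by
    rw [mem_koszulChain]
    intro s
    by_cases hs : s = ∅
    · subst hs
      refine ⟨fun _ => ?_, fun h => absurd rfl h⟩
      change f ∈ homPart k n (m + 1)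
      rw [show (m + 1 : ℤ) = ((m + 1 : ℕ) : ℤ) by push_cast; rfl, mem_homPart_natCast]
      exact hfm
    · refine ⟨fun h => absurd h (by simp [hs]), fun _ => if_neg hs⟩
  have hd : koszulDk k n I z = 0 := by
    funext s
    change koszulD k n I z s = 0
    rw [koszulD_apply]
    refine Finset.sum_eq_zero fun i _ => ?_
    rw [show z (insert i s) = 0 from if_neg (Finset.insert_ne_empty i s), smul_zero, smul_zero]
  have h0 := Subsingleton.elim (homologyClass (koszulDk k n I) (koszulChain n (idealDeg I) (0 + 1)
    (m + 1 - 1)) _ z hz hd) 0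
  rw [homologyClass_eq_zero] at h0
  obtain ⟨y, hy, hyz⟩ := h0
  have hf' := congrArg Subtype.val (congrFun hyz ∅)
  change (koszulD k n I y ∅ : MvPolynomial (Fin n) k) = f at hf'
  rw [← hf', koszulD_apply, AddSubmonoidClass.coe_finsetSum]
  refine sum_mem fun i _ => ?_
  have hi : ((y (insert i ∅) : I) : MvPolynomial (Fin n) k) ∈ homPart k n (m + 1 - 1) :=
    koszulChain_apply_mem hy _
  rw [add_sub_cancel_right, mem_homPart_natCast] at hi
  change (((-1 : ℤ) ^ _ • ((X i : MvPolynomial (Fin n) k) • (y (insert i ∅))) : I) :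
    MvPolynomial (Fin n) k) ∈ _
  rw [Submodule.coe_smul_of_tower, Submodule.coe_smul]
  have hmem : ((y (insert i ∅) : I) : MvPolynomial (Fin n) k) ∈
      Ideal.span {g | g ∈ I ∧ g.IsHomogeneous m} := Ideal.subset_span ⟨(y (insert i ∅)).2, hi⟩
  exact zsmul_mem (Ideal.mul_mem_left _ _ hmem) _

/-- As Tor_1(A/I)_q = 0, the group Tor_0(I)_{q+1} injects into Tor_0(A)_{q+1}, which is zero in
positive degree. -/
theorem subsingleton_tor_zero_ideal {I : Ideal (MvPolynomial (Fin n) k)} {q : ℤ} (hq : 1 ≤ q)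
    (h : bettiQuot I 1 q = 0) : Subsingleton (KoszulTor n (idealDeg I) 0 (q + 1)) := by
  have hq' : q + 1 = q + 1 + 0 := by ring
  have h1 := (gradedShortExact_ideal I).torMap_injective (p := 1) (p' := 0) rfl hq' rfl
    (subsingleton_tor_of_bettiQuot h)
  have := subsingleton_tor_homPart (k := k) (n := n) (p := 0) (q := q + 1) (by omega)
  exact h1.subsingleton

/-- A nondegenerate homogeneous ideal is generated by quadrics if its first syzygies satisfy
`β_{1,q} = 0` for `q ≥ 2`. -/
theorem eq_span_quadrics {I : Ideal (MvPolynomial (Fin n) k)}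
    (hI : I.IsHomogeneous (homogeneousSubmodule (Fin n) k)) (hI0 : I ≠ ⊤)
    (hI1 : ∀ f ∈ I, f.IsHomogeneous 1 → f = 0) (h : ∀ q : ℤ, 2 ≤ q → bettiQuot I 1 q = 0) :
    I = Ideal.span {f | f ∈ I ∧ f.IsHomogeneous 2} := by
  have key : ∀ m : ℕ, ∀ f ∈ I, f.IsHomogeneous m → f ∈ Ideal.span {f | f ∈ I ∧ f.IsHomogeneous 2} := by
    intro m
    induction m with
    | zero =>
      intro f hf hf0
      have hC := eq_C_of_mem_homPart (mem_homPart_natCast.2 hf0)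
      have hc : coeff 0 f = 0 := by
        by_contra hne
        exact hI0 (Ideal.eq_top_of_isUnit_mem _ hf (hC ▸ (isUnit_iff_ne_zero.2 hne).map C))
      rw [hC, hc, map_zero]
      exact zero_mem _
    | succ m ih =>
      intro f hf hfm
      -- Degree 1 is excluded by nondegeneracy, degree 2 is given, and from degree 3 on there are no
      -- new generators.
      match m, ih, hfm with
      | 0, _, hfm => rw [hI1 f hf hfm]; exact zero_mem _
      | 1, _, hfm => exact Ideal.subset_span ⟨hf, hfm⟩
      | m + 2, ih, hfm =>
        refine Ideal.span_le.2 (fun g hg => ih g hg.1 hg.2) (mem_of_subsingleton_tor_zero ?_ hf hfm)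
        exact subsingleton_tor_zero_ideal (by push_cast; omega) (h _ (by push_cast; omega))
  refine le_antisymm (fun f hf => ?_) (Ideal.span_le.2 fun f hf => hf.1)
  rw [← sum_homogeneousComponent f]
  exact sum_mem fun d _ => key d _ (homogeneousComponent_mem_of_mem hI hf d)
    (homogeneousComponent_isHomogeneous d f)

/-- The gradient of a polynomial at a point. -/
def gradientAt (v : Fin n → k) (f : MvPolynomial (Fin n) k) : Fin n → k :=
  fun i => eval v (pderiv i f)

theorem gradientAt_add (v : Fin n → k) (f g : MvPolynomial (Fin n) k) :
    gradientAt v (f + g) = gradientAt v f + gradientAt v g := by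
  funext i; simp [gradientAt]

theorem gradientAt_mul (v : Fin n → k) (f g : MvPolynomial (Fin n) k) :
    gradientAt v (f * g) = eval v f • gradientAt v g + eval v g • gradientAt v f := by
  funext i; simp [gradientAt, Derivation.leibniz]

theorem eval_linSub (A : Matrix (Fin n) (Fin n) k) (v : Fin n → k) (f : MvPolynomial (Fin n) k) :
    eval v (linSub A f) = eval (A.mulVec v) f := by
  induction f using MvPolynomial.induction_on with
  | C a => rw [algHom_C, algebraMap_eq, eval_C, eval_C]
  | add p q hp hq => rw [map_add, map_add, hp, hq, map_add]
  | mul_X p i hp =>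
    rw [map_mul, map_mul, hp, map_mul, linSub_X, eval_X]
    simp [Matrix.mulVec, dotProduct]

/-- The chain rule for a linear substitution. -/
theorem gradientAt_linSub (A : Matrix (Fin n) (Fin n) k) (v : Fin n → k)
    (f : MvPolynomial (Fin n) k) :
    gradientAt v (linSub A f) = Matrix.vecMul (gradientAt (A.mulVec v) f) A := by
  induction f using MvPolynomial.induction_on with
  | C a =>
    funext i
    simp [gradientAt, Matrix.vecMul, dotProduct]
  | add p q hp hq => rw [map_add, gradientAt_add, hp, hq, gradientAt_add, Matrix.add_vecMul]
  | mul_X p i hp =>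
    have hX : gradientAt v (linSub A (X i)) = Matrix.vecMul (gradientAt (A.mulVec v) (X i)) A := by
      funext j
      simp [gradientAt, linSub_X, Matrix.vecMul, dotProduct, pderiv_X, Pi.single_apply,
        Derivation.leibniz]
    rw [map_mul, gradientAt_mul, gradientAt_mul, hp, hX, eval_linSub, eval_linSub,
      Matrix.add_vecMul, Matrix.smul_vecMul, Matrix.smul_vecMul]

end Quadrics

/-! ### Gradients at the centre of projection -/

section Jacobian

variable {k : Type*} [Field k] {N : ℕ}

theorem eval_rename_succ (s : MvPolynomial (Fin N) k) :
    eval (Pi.single 0 1 : Fin (N + 1) → k) (rename Fin.succ s) = coeff 0 s := by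
  rw [eval_rename, ← constantCoeff_eq, ← eval_zero]
  congr 2

theorem gradientAt_rename_succ (s : MvPolynomial (Fin N) k) :
    gradientAt (Pi.single 0 1 : Fin (N + 1) → k) (rename Fin.succ s) =
      Fin.cons 0 fun i => coeff 0 (pderiv i s) := by
  funext i
  refine Fin.cases ?_ (fun i => ?_) i
  · rw [gradientAt, Fin.cons_zero, pderiv_eq_zero_of_notMem_vars, map_zero]
    intro h
    obtain ⟨j, -, hj⟩ := Finset.mem_image.1 (vars_rename _ _ h)
    exact Fin.succ_ne_zero j hj
  · rw [gradientAt, Fin.cons_succ, pderiv_rename (Fin.succ_injective N), eval_rename_succ]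

theorem coeff_zero_pderiv_linForm (c : Fin N → k) (i : Fin N) :
    coeff 0 (pderiv i (linForm c)) = c i := by
  rw [linForm, map_sum, coeff_sum, Finset.sum_eq_single i]
  · simp
  · intro j _ hj
    rw [pderiv_C_mul, pderiv_X_of_ne hj, mul_zero, coeff_zero]
  · simp

variable {I : Ideal (MvPolynomial (Fin (N + 1)) k)}

/-- The gradients at `(1 : 0 : … : 0)` of elements of an ideal that is generated by quadrics are the
coefficient vectors of linear forms in the first partial elimination ideal. -/
theorem gradientAt_mem (hv : ∀ f ∈ I, eval (Pi.single 0 1) f = 0)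
    (hI2 : I = Ideal.span {f | f ∈ I ∧ f.IsHomogeneous 2}) {f : MvPolynomial (Fin (N + 1)) k}
    (hf : f ∈ I) : ∃ c ∈ linCoeffs ((polyIdeal I).leadingCoeffNth 1),
      gradientAt (Pi.single 0 1) f = Fin.cons 0 c := by
  rw [hI2] at hf
  have hspan : ∀ f ∈ Ideal.span {f | f ∈ I ∧ f.IsHomogeneous 2}, f ∈ I := fun f hf => by rwa [hI2]
  induction hf using Submodule.span_induction with
  | mem f hf =>
    obtain ⟨hf, hf2⟩ := hf
    set H := finSuccEquiv k N f with hHdef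
    have hHd : H ∈ polyDeg k N (2 : ℕ) := ⟨f, mem_homPart_natCast.2 hf2, rfl⟩
    have hHI : H ∈ polyIdeal I := mem_polyIdeal.2 (by rwa [hHdef, AlgEquiv.symm_apply_apply])
    have hdeg := mem_polyDeg.1 hHd
    have h3 : ∀ i, 2 < i → H.coeff i = 0 := fun i hi => (mem_homPart.1 (hdeg i)).2 (by push_cast; omega)
    have hH : H = Polynomial.C (H.coeff 0) + Polynomial.C (H.coeff 1) * Polynomial.X +
        Polynomial.C (H.coeff 2) * Polynomial.X ^ 2 := by
      conv_lhs => rw [Polynomial.as_sum_range_C_mul_X_pow' H (n := 3)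
        (Nat.lt_succ_of_le (Polynomial.natDegree_le_iff_coeff_eq_zero.2 h3))]
      simp [Finset.sum_range_succ]
    have hfeq : f = rename Fin.succ (H.coeff 0) + rename Fin.succ (H.coeff 1) * X 0 +
        rename Fin.succ (H.coeff 2) * X 0 ^ 2 := by
      rw [← (finSuccEquiv k N).symm_apply_apply f, ← hHdef]
      conv_lhs => rw [hH]
      rw [map_add, map_add, map_mul, map_mul, map_pow, finSuccEquiv_symm_C, finSuccEquiv_symm_C,
        finSuccEquiv_symm_C, ← finSuccEquiv_X_zero, AlgEquiv.symm_apply_apply]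
    have d0 : (H.coeff 0).IsHomogeneous 2 := mem_homPart_natCast.1 (hdeg 0)
    have d1 : (H.coeff 1).IsHomogeneous 1 := mem_homPart_natCast.1 (hdeg 1)
    have d2 := eq_C_of_mem_homPart (hdeg 2)
    -- A quadric through the point has no term x_0², so it is x_0 ℓ plus a quadric in S. Then ℓ ∈
    -- K_1, and the gradient at the point is (0, ℓ).
    have hc2 : H.coeff 2 = 0 := by
      have h := hv f hf
      rw [hfeq] at h
      simp only [map_add, map_mul, map_pow, eval_rename_succ, eval_X, Pi.single_eq_same, one_pow,
        mul_one] at h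
      rw [d0.coeff_eq_zero (by simp), d1.coeff_eq_zero (by simp), zero_add, zero_add] at h
      rw [d2, h, map_zero]
    obtain ⟨c, hc⟩ := exists_linForm d1
    refine ⟨c, ?_, ?_⟩
    · rw [mem_linCoeffs, ← hc]
      refine mem_leadingCoeffNth_iff.2 ⟨H, hHI, rfl, fun i hi => ?_⟩
      rcases (Nat.succ_le_of_lt hi).eq_or_lt with rfl | hi
      · exact hc2
      · exact h3 i hi
    · rw [hfeq, hc2, map_zero, zero_mul, add_zero, gradientAt_add, gradientAt_mul,
        gradientAt_rename_succ, gradientAt_rename_succ, eval_rename_succ,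
        d1.coeff_eq_zero (by simp), zero_smul, zero_add, eval_X, Pi.single_eq_same, one_smul, hc]
      funext i
      refine Fin.cases ?_ (fun i => ?_) i
      · simp
      · simp only [Pi.add_apply, Fin.cons_succ, coeff_zero_pderiv_linForm]
        rw [d0.pderiv.coeff_eq_zero (by simp), zero_add]
  | zero =>
    refine ⟨0, zero_mem _, ?_⟩
    funext i
    refine Fin.cases ?_ (fun i => ?_) i <;> simp [gradientAt]
  | add f g _ _ ihf ihg =>
    obtain ⟨c, hc, hfc⟩ := ihf
    obtain ⟨c', hc', hgc⟩ := ihg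
    refine ⟨c + c', add_mem hc hc', ?_⟩
    rw [gradientAt_add, hfc, hgc]
    funext i
    refine Fin.cases ?_ (fun i => ?_) i <;> simp
  | smul a f hf ih =>
    obtain ⟨c, hc, hfc⟩ := ih
    refine ⟨eval (Pi.single 0 1) a • c, Submodule.smul_mem _ _ hc, ?_⟩
    rw [smul_eq_mul, gradientAt_mul, hv f (hspan f hf), zero_smul, add_zero, hfc]
    funext i
    refine Fin.cases ?_ (fun i => ?_) i <;> simp

/-- By the chain rule, multiplication by the invertible matrix A takes gradients at q to gradients
at (1, 0, …, 0), so ranks can be compared there. -/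
theorem jacobianRank_le {A : Matrix (Fin (N + 1)) (Fin (N + 1)) k} (hA : A.det ≠ 0)
    {q : Fin (N + 1) → k} (hq : ∀ i, A i 0 = q i)
    (hv : ∀ f ∈ I.map (linSub A), eval (Pi.single 0 1) f = 0)
    (hI2 : I.map (linSub A) =
      Ideal.span {f | f ∈ I.map (linSub A) ∧ f.IsHomogeneous 2}) :
    jacobianRank I q ≤ numLinearForms ((polyIdeal (I.map (linSub A))).leadingCoeffNth 1) := by
  have hAq : A.mulVec (Pi.single 0 1) = q := by
    funext i; simp [hq]
  have hinj : Function.Injective A.vecMulLinear := by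
    intro x y hxy
    exact Matrix.vecMul_injective_of_isUnit ((Matrix.isUnit_iff_isUnit_det A).2
      (isUnit_iff_ne_zero.2 hA)) hxy
  let ι : (Fin N → k) →ₗ[k] (Fin (N + 1) → k) :=
    { toFun := fun c => Fin.cons 0 c
      map_add' := fun c c' => by
        funext i; refine Fin.cases ?_ (fun i => ?_) i <;> simp
      map_smul' := fun a c => by
        funext i; refine Fin.cases ?_ (fun i => ?_) i <;> simp }
  rw [← finrank_linCoeffs, jacobianRank, (Submodule.equivMapOfInjective _ hinj _).finrank_eq]
  refine le_trans (Submodule.finrank_mono (t := (linCoeffs _).map ι) ?_) (Submodule.finrank_map_le _ _)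
  rw [Submodule.map_span, Submodule.span_le]
  rintro _ ⟨_, ⟨f, hf, rfl⟩, rfl⟩
  obtain ⟨c, hc, hfc⟩ := gradientAt_mem hv hI2 (Ideal.mem_map_of_mem (linSub A) hf)
  refine ⟨c, hc, ?_⟩
  rw [gradientAt_linSub, hAq] at hfc
  exact hfc.symm

end Jacobian

section Assembly

variable {k : Type*} [Field k] {N : ℕ}

/-! ### Transport along a linear coordinate change -/

theorem isHomogeneous_map_linSub {n : ℕ} (A : Matrix (Fin n) (Fin n) k)
    {I : Ideal (MvPolynomial (Fin n) k)} (hI : I.IsHomogeneous (homogeneousSubmodule (Fin n) k)) :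
    (I.map (linSub A)).IsHomogeneous (homogeneousSubmodule (Fin n) k) := by
  obtain ⟨S, rfl⟩ := (Ideal.IsHomogeneous.iff_exists _ _).1 hI
  rw [Ideal.map_span]
  refine Ideal.homogeneous_span _ _ ?_
  rintro _ ⟨_, ⟨⟨f, d, hf⟩, -, rfl⟩, rfl⟩
  exact ⟨d, linSub_isHomogeneous A hf⟩

theorem height_comap_linSub {n : ℕ} {A : Matrix (Fin n) (Fin n) k} (hA : A.det ≠ 0)
    (P : Ideal (MvPolynomial (Fin n) k)) : (P.comap (linSub A⁻¹)).height = P.height :=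
  RingEquiv.height_comap (linSubEquiv A hA).symm.toRingEquiv P

theorem linSub_linSub_inv {n : ℕ} {A : Matrix (Fin n) (Fin n) k} (hA : A.det ≠ 0)
    (f : MvPolynomial (Fin n) k) : linSub A (linSub A⁻¹ f) = f := by
  rw [linSub_linSub, Matrix.nonsing_inv_mul _ (isUnit_iff_ne_zero.2 hA), linSub_one, AlgHom.id_apply]

theorem eval_linSub_single (A : Matrix (Fin (N + 1)) (Fin (N + 1)) k) {q : Fin (N + 1) → k}
    (hq : ∀ i, A i 0 = q i) (f : MvPolynomial (Fin (N + 1)) k) :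
    eval (Pi.single 0 1) (linSub A f) = eval q f := by
  rw [eval_linSub]
  congr 2
  funext i
  simp [hq]

/-- The codimension at a point is attained by a component. -/
theorem exists_height_eq_codimAt {n : ℕ} {I : Ideal (MvPolynomial (Fin n) k)} {v : Fin n → k} {e : ℕ}
    (he : codimAt I v = e) :
    ∃ P : Ideal (MvPolynomial (Fin n) k), P.IsPrime ∧ I ≤ P ∧ (∀ f ∈ P, eval v f = 0) ∧
      P.height = e := by
  by_contra! hne
  -- If no height equals e, integrality raises the lower bound for all of them to e + 1,
  -- contradicting that the finite infimum is e.
  have : ((e + 1 : ℕ) : ℕ∞) ≤ codimAt I v := by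
    refine le_iInf₂ fun P hP => ?_
    have h1 : codimAt I v ≤ P.height := iInf₂_le P hP
    have h2 := hne P hP.1.1.1 hP.1.1.2 hP.2
    rw [he] at h1
    exact_mod_cast Order.add_one_le_of_lt (lt_of_le_of_ne h1 h2.symm)
  rw [he] at this
  exact absurd (Nat.cast_le.1 this) (by omega)

/-- A nonzero β_{p,q} with p ≤ a and q ≥ 2 would bound every admissible index by a - 1, and hence
the supremum as well. -/
theorem bettiQuot_eq_zero_of_le_linearIndex {n : ℕ} {I : Ideal (MvPolynomial (Fin n) k)} {a : ℕ}
    (ha1 : 1 ≤ a) (ha : (a : ℕ∞) ≤ linearIndex I) (p q : ℤ) (hp : 1 ≤ p) (hpa : p ≤ a) (hq : 2 ≤ q) :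
    bettiQuot I p q = 0 := by
  by_contra hne
  have : linearIndex I ≤ ((a - 1 : ℕ) : ℕ∞) := by
    refine iSup₂_le fun b hb => ?_
    by_contra hlt
    have h1 : a - 1 < b := by exact_mod_cast not_le.1 hlt
    exact hne (hb p q hp (by omega) hq)
  have h2 := Nat.cast_le.1 (ha.trans this)
  omega

theorem numLinearForms_eq_zero {K : Ideal (MvPolynomial (Fin N) k)}
    (h : ∀ f ∈ K, f.IsHomogeneous 1 → f = 0) : numLinearForms K = 0 := by
  rw [numLinearForms, show K.restrictScalars k ⊓ homogeneousSubmodule (Fin N) k 1 = ⊥ from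
    eq_bot_iff.2 fun f hf => h f hf.1 hf.2, finrank_bot]

end Assembly

end

/-- `X` is the subscheme of `ℙ^N` defined by the homogeneous ideal `I`, and `g` is any linear
coordinate change that sends `(1 : 0 : ⋯ : 0)` to the point `q` of `X`. -/
theorem theorem3p1 {k : Type*} [Field k] {N : ℕ}
    (I : Ideal (MvPolynomial (Fin (N + 1)) k))
    (hI : I.IsHomogeneous (homogeneousSubmodule (Fin (N + 1)) k))
    (hnondeg : ∀ f ∈ I, f.IsHomogeneous 1 → f = 0)
    (q : Fin (N + 1) → k) (hq : ∀ f ∈ I, eval q f = 0)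
    (g : GL (Fin (N + 1)) k) (hg : ∀ i, g.val i 0 = q i)
    (e : ℕ) (he : codimAt I q = e)
    (J : Ideal (MvPolynomial (Fin N) k)) (hJ : J = projIdeal (changeCoords g I))
    (K₁ : Ideal (MvPolynomial (Fin N) k)) (hK₁ : K₁ = partialElim (changeCoords g I) 1)
    (t : ℕ) (ht : t = numLinearForms K₁) :
    (∀ p : ℕ, 1 ≤ p →
      bettiQuot I p 1 ≤ bettiQuot J p 1 + bettiQuot J (p - 1) 1 + t.choose p ∧
      bettiQuot J p 1 + bettiQuot J (p - 1) 1 + t.choose p ≤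
        bettiQuot J p 1 + bettiQuot J (p - 1) 1 + e.choose p ∧
      (bettiQuot J p 1 : ℤ) + bettiQuot J (p - 1) 1 + t.choose p
        - bettiQuot J (p - 1) 2 - bettiIdeal K₁ (p - 2) 2 ≤ bettiQuot I p 1) ∧
    (bettiQuot I 1 1 = bettiQuot J 1 1 + t ∧ bettiQuot J 1 1 + t ≤ bettiQuot J 1 1 + e) ∧
    (IsSmoothPoint I q → ∀ a : ℕ, 1 ≤ a → (a : ℕ∞) ≤ linearIndex I →
      (∀ p : ℕ, 1 ≤ p → p ≤ a →
        bettiQuot I p 1 = bettiQuot J p 1 + bettiQuot J (p - 1) 1 + e.choose p) ∧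
      (bettiQuot I (a + 1) 1 : ℤ) =
        bettiQuot J (a + 1) 1 + bettiQuot J a 1 - bettiQuot J a 2 + e.choose (a + 1)) := by
  have hdet : g.val.det ≠ 0 := ((Matrix.isUnit_iff_isUnit_det _).1 g.isUnit).ne_zero
  rw [changeCoords_eq] at hJ hK₁
  subst hJ
  change K₁ = (polyIdeal (I.map (linSub g.val))).leadingCoeffNth 1 at hK₁
  -- Betti numbers are coordinate free, so the problem is moved to the ideal with centre (1 : 0 : …
  -- : 0).
  simp only [← bettiQuot_map_linSub g.val hdet I]
  have hsmooth : IsSmoothPoint I q → e ≤ jacobianRank I q := fun h => by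
    rw [IsSmoothPoint, he] at h
    exact (Nat.cast_inj.1 h).ge
  obtain ⟨P, hP, hIP, hPq, hPe⟩ := exists_height_eq_codimAt he
  have hlin : ∀ a : ℕ, (a : ℕ∞) ≤ linearIndex I → 1 ≤ a → ∀ p q : ℤ, 1 ≤ p → p ≤ a → 2 ≤ q →
      bettiQuot (I.map (linSub g.val)) p q = 0 := fun a ha ha1 p q hp hpa hq => by
    rw [bettiQuot_map_linSub g.val hdet]
    exact bettiQuot_eq_zero_of_le_linearIndex ha1 ha p q hp hpa hq
  have hjac := fun hv hI2 => jacobianRank_le (I := I) hdet hg hv hI2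
  have hI' := isHomogeneous_map_linSub g.val hI
  have hv' : ∀ f ∈ I.map (linSub g.val), eval (Pi.single 0 1) f = 0 := fun f hf => by
    rw [← linSub_linSub_inv hdet f, eval_linSub_single _ hg]
    exact hq _ ((mem_map_linSub hdet).1 hf)
  have hnd' : ∀ f ∈ I.map (linSub g.val), f.IsHomogeneous 1 → f = 0 := fun f hf hf1 => by
    rw [← linSub_linSub_inv hdet f,
      hnondeg _ ((mem_map_linSub hdet).1 hf) (linSub_isHomogeneous _ hf1), map_zero]
  have hP' : (P.comap (linSub g.val⁻¹)).IsPrime := Ideal.comap_isPrime _ _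
  have hIP' : I.map (linSub g.val) ≤ P.comap (linSub g.val⁻¹) := fun f hf =>
    hIP ((mem_map_linSub hdet).1 hf)
  have hPv : ∀ f ∈ P.comap (linSub g.val⁻¹), eval (Pi.single 0 1) f = 0 := fun f hf => by
    rw [← linSub_linSub_inv hdet f, eval_linSub_single _ hg]
    exact hPq _ hf
  have hPe' : (P.comap (linSub g.val⁻¹)).height = e := by rw [height_comap_linSub hdet, hPe]
  generalize I.map (linSub g.val) = I' at *
  generalize P.comap (linSub g.val⁻¹) = P' at *
  subst hK₁
  rw [← ht] at hjac
  have hn : numLinearForms (projIdeal I') = 0 := numLinearForms_eq_zero fun f hf hf1 =>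
    rename_injective _ (Fin.succ_injective N)
      ((hnd' _ hf hf1.rename_isHomogeneous).trans (map_zero _).symm)
  have hte : t ≤ e := by
    have := numLinearForms_le_height hI' hIP' hPv
    rw [hPe', ← ht] at this
    exact Nat.cast_le.1 this
  have hmain := bettiQuot_one_eq hI' hv' hn
  rw [← ht] at hmain
  have hbound := finrank_corrections_le hI'
  refine ⟨fun p hp => ?_, ⟨?_, by omega⟩, fun hs a ha1 ha => ?_⟩
  · obtain ⟨p, rfl⟩ := Nat.exists_eq_add_of_le' hp
    have h1 := hmain p
    have h2 := hbound p
    -- The bound on the corrections involves Tor_{p-1}(S/K_1)_1, which embeds into Tor_{p-2}(K_1)_2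
    -- in the numbering of the statement.
    have h3 := bettiQuot_le_bettiIdeal ((polyIdeal I').leadingCoeffNth 1) (p := p) (p' := p - 1)
      (q := 1) (q' := 2) (by ring) rfl le_rfl
    have h4 := Nat.choose_le_choose (p + 1) hte
    push_cast
    rw [add_sub_cancel_right, show (p + 1 - 2 : ℤ) = p - 1 by ring]
    omega
  -- For p = 1 the corrections are bounded by Tor_0 of cyclic modules in positive degree, which is
  -- zero.
  · have h1 := hmain 0
    have h2 := hbound (0 : ℕ)
    have h3 := bettiQuot_zero_left (projIdeal I') (q := 1) le_rfl
    have h4 := bettiQuot_zero_left (projIdeal I') (q := 2) (by norm_num)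
    have h5 := bettiQuot_zero_left ((polyIdeal I').leadingCoeffNth 1) (q := 1) le_rfl
    rw [Nat.choose_one_right] at h1
    simp only [Nat.cast_zero, zero_add] at h1 h2
    omega
  · have hI2 := eq_span_quadrics hI' (fun h => by
      have := hv' 1 (h ▸ Submodule.mem_top)
      rw [map_one] at this
      exact one_ne_zero this) hnd' fun q hq => hlin a ha ha1 1 q le_rfl (by omega) hq
    -- Smoothness gives e = Jacobian rank ≤ t, the inequality using that I is generated by quadrics.
    obtain rfl : t = e := le_antisymm hte ((hsmooth hs).trans (hjac hv' hI2))
    have hK : ∀ j : ℕ, 1 ≤ j → ∀ p q : ℤ, 1 ≤ q → bettiQuot ((polyIdeal I').leadingCoeffNth j) p q = 0 :=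
      fun j hj p q hq => bettiQuot_of_span_linearForms
        (leadingCoeffNth_eq_span hI' hIP' hPv (by rw [hPe', ht]) hj) p q hq
    have hK' : ∀ j : ℕ, 1 ≤ j → ∀ p q : ℤ, 1 ≤ q → Subsingleton (CoeffTor I' j p q) :=
      fun j hj p q hq => subsingleton_tor_of_bettiQuot (hK j hj p q hq)
    refine ⟨fun p hp hpa => ?_, ?_⟩
    · obtain ⟨p, rfl⟩ := Nat.exists_eq_add_of_le' hp
      have h1 := hmain p
      have h2 := hbound p
      have h3 := bettiQuot_projIdeal_two_eq_zero hI' hv' hK' (p := p + 1) (p' := p) rfl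
        fun q hq => hlin a ha ha1 (p + 1) q (by omega) (by exact_mod_cast hpa) hq
      have h4 := hK 1 le_rfl p 1 le_rfl
      push_cast
      rw [add_sub_cancel_right]
      omega
    · have h1 := hmain a
      -- In step a + 1 only linearity up to step a is available, so β_{a,2} of the projection
      -- survives as the full correction.
      have h2 := finrank_corrections_eq hI' hv' hK' (hlin a ha ha1 a 2 (by omega) le_rfl le_rfl)
      omega
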